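/- **Setting.** Fix $\lambda>0$. A system with $n$ degrees of freedom has phase space $\mathcal M=\mathbb R^{2n}$ with canonical coordinates $z=(q_1,p_1,\dots,q_n,p_n)$ and symplectic matrix $\Sigma$, the block-diagonal matrix with blocks $\begin{pmatrix}0&-1\\1&0\end{pmatrix}$; for a composite system, $\Sigma_{AB}=\mathrm{diag}(\Sigma_A,\Sigma_B)$. A *Liouville distribution* is a probability density $\mu$ on $\mathcal M$; if it has finite second moments, its covariance matrix is $\gamma_{ij}(\mu)=2\langle (z_i-\langle z_i\rangle)(z_j-\langle z_j\rangle)\rangle_\mu$. A Liouville distribution $\mu$ with finite second moments is a *valid epistemic state*, $\mu\in L_{\rm valid}(\mathcal M)$, if $\gamma(\mu)+i\lambda\Sigma\ge 0$ and if its entropy $-\int\mu\log\mu$ is finite and maximal among all Liouville distributions with the same covariance matrix. A nonzero locally finite measure $m$ on $\mathcal M$, possibly of infinite mass, is a *valid idealized epistemic state* if there are $\mu_j\in L_{\rm valid}(\mathcal M)$ and $c_j>0$ with $c_j\int f\,d\mu_j\to\int f\,dm$ for all continuous compactly supported $f$. The *perfectly correlated state* on two copies $A,B$ of a system is the measure $\mu^{\rm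 corr}_{AB}=\prod_i\delta(q_{iA}-q_{iB})\,\delta(p_{iA}+p_{iB})$, i.e. the image of Lebesgue measure under $(q,p)\mapsto((q,p),(q,-p))$. A *transfer functional* $\Gamma_A$ is given by a Markov kernel $\eta(dz'|z)$ on $\mathcal M_A$ via $\Gamma_A[\mu](dz')=\int\eta(dz'|z)\,\mu(dz)$; two kernels define the same transfer functional if they act identically on all Liouville distributions. $\Gamma_A\otimes\mathrm{id}_B$ applies the kernel to the $A$-variables and leaves the $B$-variables unchanged. $\Gamma_A$ is *valid* if * it is completely validity-preserving: for every system $B$, $\Gamma_A\otimes\mathrm{id}_B$ maps $L_{\rm valid}(\mathcal M_A\times\mathcal M_B)$ into itself; and * it satisfies ontic supervenience: there are an ancilla $E$ (with $m\ge 0$ degrees of freedom; $m=0$ is the reversible case), a state $\nu\in L_{\rm valid}(\mathcal M_E)$, a real matrix $S$ with $S\Sigma_{AE}S^{T}=\Sigma_{AE}$ and a displacement $a$, such that for every Liouville distribution $\mu$ on $\mathcal M_A$, $\Gamma_A[\mu]$ is the marginal on $A$ of the image of $\mu\otimes\nu$ under $z\mapsto Sz+a$. **Proposition (Valid transformations).**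 Let $\mu^\Gamma_{AB}=(\Gamma_A\otimes\mathrm{id}_B)[\mu^{\rm corr}_{AB}]$. 1. A transfer functional $\Gamma_A$ is valid if and only if $\mu^\Gamma_{AB}$ is a valid (idealized) epistemic state on $\mathcal M_A\times\mathcal M_B$. 2. $\mu^\Gamma_{AB}$ always has uniform marginal on $B$, namely Lebesgue measure. 3. $\Gamma_A\mapsto\mu^\Gamma_{AB}$ is well defined and injective on transfer functionals, and every valid idealized state on $\mathcal M_A\times\mathcal M_B$ whose marginal on $B$ is Lebesgue measure equals $\mu^\Gamma_{AB}$ for some valid $\Gamma_A$. Hence valid transfer functionals on $A$ are in one-to-one correspondence with valid bipartite states on two copies of $A$ with uniform marginal on $B$ (normalized so that this marginal is Lebesgue measure). -/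

import Mathlib

open MeasureTheory ProbabilityTheory Filter Topology
open scoped ComplexOrder

noncomputable section

namespace ERL

/-- Canonical coordinates of a system with `n` degrees of freedom:
`Sum.inl i` labels the position `q_i`, `Sum.inr i` the momentum `p_i`. -/
abbrev Coord (n : ℕ) : Type := Fin n ⊕ Fin n

/-- The phase space of a system with `n` degrees of freedom. -/
abbrev Phase (n : ℕ) : Type := Coord n → ℝ

/-- The matrix `Σ` of the symplectic form; `Matrix.J` is `-1` at `(q_i, p_i)` and `1` at
`(p_i, q_i)`. -/
def form (n : ℕ) : Matrix (Coord n) (Coord n) ℝ := Matrix.J (Fin n) ℝ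

/-- The symplectic form of a composite system, `Σ_AB = diag(Σ_A, Σ_B)`. -/
def jointForm (n k : ℕ) : Matrix (Coord n ⊕ Coord k) (Coord n ⊕ Coord k) ℝ :=
  Matrix.fromBlocks (form n) 0 0 (form k)

/-- A measure on `M_A × M_B`, written in the combined canonical coordinates of the two systems. -/
def joint {n k : ℕ} (μ : Measure (Phase n × Phase k)) : Measure (Coord n ⊕ Coord k → ℝ) :=
  μ.map (fun p => Sum.elim p.1 p.2)

section States

variable {d : Type} [Fintype d]

/-- Liouville distributions: probability densities on phase space, regarded as the probability
measures that have a density. -/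
def IsLiouville (μ : Measure (d → ℝ)) : Prop :=
  IsProbabilityMeasure μ ∧ μ ≪ volume

/-- All coordinates are square integrable, so that means and covariances exist. -/
def FiniteSecondMoments (μ : Measure (d → ℝ)) : Prop :=
  ∀ i, MemLp (fun z : d → ℝ => z i) 2 μ

/-- The covariance matrix `γ_ij = 2 ⟨(z_i - d_i)(z_j - d_j)⟩`, with the factor `2`. -/
def covMatrix (μ : Measure (d → ℝ)) : Matrix d d ℝ :=
  Matrix.of fun i j => 2 * covariance (fun z : d → ℝ => z i) (fun z => z j) μ

/-- The integrand `-μ(z) log μ(z)` of the entropy. -/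
def entropyDensity (μ : Measure (d → ℝ)) (z : d → ℝ) : ℝ :=
  Real.negMulLog (μ.rnDeriv volume z).toReal

/-- The entropy `S(μ) = -∫ μ log μ` (meaningful when the integrand is integrable). -/
def entropy (μ : Measure (d → ℝ)) : ℝ := ∫ z, entropyDensity μ z

/-- The classical uncertainty principle `γ(μ) + i λ Σ ≥ 0`. -/
def CUP (lam : ℝ) (Ω : Matrix d d ℝ) (μ : Measure (d → ℝ)) : Prop :=
  ((covMatrix μ).map (fun x : ℝ => (x : ℂ))
    + (Complex.I * (lam : ℂ)) • Ω.map (fun x : ℝ => (x : ℂ))).PosSemidef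

/-- The entropy of `μ` is finite and maximal among all distributions with the same covariance
matrix. Given finite second moments, a competitor whose entropy integrand is not integrable has
entropy `-∞`, so that only integrable competitors have to be compared. -/
def MaxEnt (μ : Measure (d → ℝ)) : Prop :=
  Integrable (entropyDensity μ) ∧
    ∀ ν : Measure (d → ℝ), IsLiouville ν → FiniteSecondMoments ν →
      covMatrix ν = covMatrix μ → Integrable (entropyDensity ν) → entropy ν ≤ entropy μ

/-- The set `L_valid` of valid (normalized) epistemic states. -/
def IsValidState (lam : ℝ) (Ω : Matrix d d ℝ) (μ : Measure (d → ℝ)) : Prop :=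
  IsLiouville μ ∧ FiniteSecondMoments μ ∧ CUP lam Ω μ ∧ MaxEnt μ

/-- Valid epistemic states in the sense that includes the idealized, not necessarily normalizable
ones (perfect knowledge of some quadratures, no knowledge of their conjugates): nonzero locally
finite measures that are, up to normalization, limits of valid normalized states when tested
against continuous compactly supported functions. -/
def IsValidIdealState (lam : ℝ) (Ω : Matrix d d ℝ) (m : Measure (d → ℝ)) : Prop :=
  IsLocallyFiniteMeasure m ∧ m ≠ 0 ∧
    ∃ (μ : ℕ → Measure (d → ℝ)) (c : ℕ → ℝ),
      (∀ j, IsValidState lam Ω (μ j) ∧ 0 < c j) ∧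
      ∀ f : (d → ℝ) → ℝ, Continuous f → HasCompactSupport f →
        Tendsto (fun j => c j * ∫ z, f z ∂(μ j)) atTop (𝓝 (∫ z, f z ∂m))

end States

section Transformations

variable {n : ℕ}

/-- Momentum inversion `(q, p) ↦ (q, -p)`. -/
def momentumFlip (z : Phase n) : Phase n :=
  Sum.elim (fun i => z (Sum.inl i)) (fun i => -z (Sum.inr i))

/-- The perfectly correlated state `∏ᵢ δ(q_iA - q_iB) δ(p_iA + p_iB)` on two copies of a system:
the image of Lebesgue measure under `z ↦ (z, momentumFlip z)`. -/
def corrState (n : ℕ) : Measure (Phase n × Phase n) :=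
  (volume : Measure (Phase n)).map (fun z => (z, momentumFlip z))

/-- The transfer functional of the transition probabilities `η(dz' | z)`, acting on measures:
`Γ[μ](dz') = ∫ η(dz' | z) μ(dz)`. -/
def transfer (η : Kernel (Phase n) (Phase n)) (μ : Measure (Phase n)) : Measure (Phase n) :=
  μ.bind η

/-- The action of `Γ_A ⊗ id_B` on measures on `M_A × M_B`. -/
def transferLeft {k : ℕ} (η : Kernel (Phase n) (Phase n)) (μ : Measure (Phase n × Phase k)) :
    Measure (Phase n × Phase k) :=
  μ.bind (Kernel.parallelComp η Kernel.id)

/-- Completely validity-preserving: for every further system `B`, `Γ_A ⊗ id_B` maps valid states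
to valid states. -/
def IsCVP (lam : ℝ) (η : Kernel (Phase n) (Phase n)) : Prop :=
  ∀ (k : ℕ) (μ : Measure (Phase n × Phase k)),
    IsValidState lam (jointForm n k) (joint μ) →
      IsValidState lam (jointForm n k) (joint (transferLeft η μ))

/-- The map `z ↦ S z + a` on a composite phase space `M_A × M_E`. -/
def affineEvolution {m : ℕ} (S : Matrix (Coord n ⊕ Coord m) (Coord n ⊕ Coord m) ℝ)
    (a : Coord n ⊕ Coord m → ℝ) (p : Phase n × Phase m) : Phase n × Phase m :=
  (fun i => (S.mulVec (Sum.elim p.1 p.2) + a) (Sum.inl i),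
    fun j => (S.mulVec (Sum.elim p.1 p.2) + a) (Sum.inr j))

/-- Ontic supervenience: the transformation arises by adjoining an ancilla in a valid epistemic
state, letting the pair evolve by a linear symplectic transformation (phase-space displacements
included), and marginalizing over the ancilla. An ancilla with `m = 0` degrees of freedom gives
the reversible transformations. -/
def OnticSupervenience (lam : ℝ) (η : Kernel (Phase n) (Phase n)) : Prop :=
  ∃ (m : ℕ) (ν : Measure (Phase m)) (S : Matrix (Coord n ⊕ Coord m) (Coord n ⊕ Coord m) ℝ)
    (a : Coord n ⊕ Coord m → ℝ),
    IsValidState lam (form m) ν ∧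
    S * jointForm n m * S.transpose = jointForm n m ∧
    ∀ μ : Measure (Phase n), IsLiouville μ →
      transfer η μ = ((μ.prod ν).map (affineEvolution S a)).map Prod.fst

/-- Valid transformations. -/
def IsValidTransformation (lam : ℝ) (η : Kernel (Phase n) (Phase n)) : Prop :=
  IsCVP lam η ∧ OnticSupervenience lam η

/-- Two transition probabilities define the same transfer functional: they act in the same way on
all Liouville distributions. -/
def SameTransfer (η η' : Kernel (Phase n) (Phase n)) : Prop :=
  ∀ μ : Measure (Phase n), IsLiouville μ → transfer η μ = transfer η' μ

/-- The bipartite state `μ^Γ = (Γ_A ⊗ id_B)[μ^corr]`. -/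
def choiState (η : Kernel (Phase n) (Phase n)) : Measure (Phase n × Phase n) :=
  transferLeft η (corrState n)

end Transformations

end ERL

end

/-! Call a transition `z ↦ X z + w` with independent Gaussian noise `w` of covariance matrix `Y`
admissible if `Y + iλ(Ω - X Ω Xᵀ) ≥ 0`, where `Ω` is the symplectic form. The theorem holds because
validity of a kernel and validity of its Choi state both single out, up to null sets of inputs,
exactly the admissible Gaussian channels.

By Gibbs' inequality the valid states are the nondegenerate Gaussians obeying the uncertainty
principle (`IsValidState.exists_rotGauss`, `isValidState_gauss`). In a symplectic evolution with a
Gaussian ancilla, the system block of `S Σ Sᵀ = Σ` turns the ancilla's uncertainty principle into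
admissibility (`OnticSupervenience.exists_noiseChannel`). Conversely, a factorization `Y + iλ(Ω - X
Ω Xᵀ) = G Gᴴ` yields an ancilla and a coupling, which complete to a symplectic matrix
(`exists_symplectic_dilation`). Admissible channels preserve validity completely because uncertainty
relations can be transported by real matrices and added (`isCVP_noiseChannel`).

The perfectly correlated state is a limit of valid Gaussians: the sums of the correlated coordinates
spread out while their differences sharpen. Applying an admissible channel to these Gaussians
exhibits its Choi state as a valid idealized state (`isValidIdealState_choiState_noiseChannel`).

For the converse, let rescaled valid Gaussians converge to a measure with Lebesgue marginal on `B`.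
Their means grow at most like their variances, so a subsequence of the parameters converges, and the
limit is an affine image of an exponential density times a standard Gaussian (`exists_limit_form`).
The uniform marginal rules out the exponential and makes the `B`-part of the flat directions
invertible, so the limit is a graph over `B` with Gaussian noise (`eq_map_of_uniform_marginal`).
Admissibility survives in the limit by using the combination of coordinates that is blind to the
diverging variances (`posSemidef_uncMatrix_limit`).

Finally, up to a swap and a momentum inversion the Choi state is `volume ⊗ₘ η`, so uniqueness of
disintegration gives injectivity. -/

noncomputable section

namespace ERL

/-! ### Calculus of uncertainty relations -/

section UncertaintyMatrices

open Matrix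

/-- The complex matrix `γ + i λ Ω`. -/
def uncMatrix {d : Type} (lam : ℝ) (Ω γ : Matrix d d ℝ) : Matrix d d ℂ :=
  γ.map (fun x : ℝ => (x : ℂ)) + (Complex.I * (lam : ℂ)) • Ω.map (fun x : ℝ => (x : ℂ))

/-- A real matrix regarded as a complex one. -/
abbrev toC {d e : Type} (A : Matrix d e ℝ) : Matrix d e ℂ := A.map (fun x : ℝ => (x : ℂ))

theorem toC_mul {d e f : Type} [Fintype e] (A : Matrix d e ℝ) (B : Matrix e f ℝ) :
    toC (A * B) = toC A * toC B := by
  ext i j; simp [Matrix.mul_apply]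

theorem toC_conjTranspose {d e : Type} (A : Matrix d e ℝ) : (toC A)ᴴ = toC Aᵀ := by
  ext i j; simp [Matrix.conjTranspose_apply]

theorem toC_add {d e : Type} (A B : Matrix d e ℝ) : toC (A + B) = toC A + toC B := by
  ext i j; simp

/-- A real congruence acts on the real and the imaginary part alike. `M` may be rectangular and need
not be symplectic: the form is transported along with the covariance. -/
theorem posSemidef_uncMatrix_conj {d e : Type} [Fintype d] [Fintype e] {lam : ℝ} {Ω γ : Matrix d d ℝ}
    (h : (uncMatrix lam Ω γ).PosSemidef) (M : Matrix e d ℝ) :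
    (uncMatrix lam (M * Ω * Mᵀ) (M * γ * Mᵀ)).PosSemidef := by
  have h2 := h.mul_mul_conjTranspose_same (toC M)
  convert h2 using 1
  change toC _ + _ • toC _ = toC M * (toC γ + _ • toC Ω) * _
  rw [toC_conjTranspose, toC_mul, toC_mul, toC_mul, toC_mul]
  simp [Matrix.mul_add, Matrix.add_mul]

/-- Allowing the two forms to differ is what lets noise make up for the part of the symplectic form
that a nonsymplectic `X` fails to preserve. -/
theorem posSemidef_uncMatrix_add {d : Type} {lam : ℝ} {Ω γ Ω' γ' : Matrix d d ℝ}
    (h : (uncMatrix lam Ω γ).PosSemidef) (h' : (uncMatrix lam Ω' γ').PosSemidef) :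
    (uncMatrix lam (Ω + Ω') (γ + γ')).PosSemidef := by
  convert h.add h' using 1
  change toC _ + _ • toC _ = (toC _ + _ • toC _) + (toC _ + _ • toC _)
  rw [toC_add, toC_add, smul_add]; abel

theorem transpose_eq_of_posSemidef_uncMatrix {d : Type} {lam : ℝ} {Ω γ : Matrix d d ℝ}
    (h : (uncMatrix lam Ω γ).PosSemidef) : γᵀ = γ := by
  ext i j
  have := congrArg Complex.re (h.1.apply i j)
  simpa [uncMatrix] using this

/-- The real part of a positive semidefinite `γ + i λ Ω` with nondegenerate `Ω` is positive
definite. -/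
theorem posDef_of_posSemidef_uncMatrix {d : Type} [Fintype d] {lam : ℝ} (hlam : 0 < lam) {Ω γ : Matrix d d ℝ}
    (hΩ : ∀ x, Ω *ᵥ x = 0 → x = 0) (h : (uncMatrix lam Ω γ).PosSemidef) : γ.PosDef := by
  have hsymm := transpose_eq_of_posSemidef_uncMatrix h
  have hmv : ∀ x : d → ℝ, uncMatrix lam Ω γ *ᵥ (fun i => (x i : ℂ)) =
      fun i => ((γ *ᵥ x) i : ℂ) + Complex.I * (lam * (Ω *ᵥ x) i : ℝ) := by
    intro x; ext i
    simp only [uncMatrix, Matrix.mulVec, dotProduct, Matrix.add_apply, Matrix.smul_apply,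
      Matrix.map_apply, smul_eq_mul, add_mul, Finset.sum_add_distrib]
    push_cast
    rw [Finset.mul_sum, Finset.mul_sum]
    simp only [mul_assoc]
  have hre : ∀ x : d → ℝ, (star (fun i => (x i : ℂ)) ⬝ᵥ (uncMatrix lam Ω γ *ᵥ
      (fun i => (x i : ℂ)))).re = x ⬝ᵥ (γ *ᵥ x) := by
    intro x
    rw [hmv]
    simp [dotProduct]
  have hnn : ∀ x : d → ℝ, 0 ≤ star (fun i => (x i : ℂ)) ⬝ᵥ (uncMatrix lam Ω γ *ᵥ
      (fun i => (x i : ℂ))) := fun x => h.dotProduct_mulVec_nonneg _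
  refine Matrix.PosDef.of_dotProduct_mulVec_pos ?_ ?_
  · rw [Matrix.IsHermitian, Matrix.conjTranspose_eq_transpose_of_trivial, hsymm]
  · intro x hx
    have h0 : 0 ≤ x ⬝ᵥ (γ *ᵥ x) := by
      rw [← hre]; exact (Complex.le_def.1 (hnn x)).1
    rw [star_trivial]
    refine lt_of_le_of_ne h0 fun h1 => hx (hΩ x ?_)
    -- For a real vector the quadratic form equals that of `γ`. If it vanishes, positivity puts the
    -- vector in the kernel of the complex matrix, and the imaginary part of that equation is `λ Ω x
    -- = 0`.
    have hz : star (fun i => (x i : ℂ)) ⬝ᵥ (uncMatrix lam Ω γ *ᵥ (fun i => (x i : ℂ))) = 0 := by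
      apply Complex.ext
      · rw [hre, ← h1]; rfl
      · exact (Complex.le_def.1 (hnn x)).2.symm
    rw [h.dotProduct_mulVec_zero_iff, hmv] at hz
    ext i
    have := congrArg Complex.im (congrFun hz i)
    simpa [hlam.ne'] using this

end UncertaintyMatrices

/-! ### Symplectic forms and the momentum inversion -/

section SymplecticForms

open Matrix

theorem form_mul_form (n : ℕ) : form n * form n = -1 := Matrix.J_squared _ _

theorem form_transpose (n : ℕ) : (form n)ᵀ = -form n := Matrix.J_transpose _ _

theorem jointForm_mul_jointForm (n k : ℕ) : jointForm n k * jointForm n k = -1 := by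
  rw [jointForm, Matrix.fromBlocks_multiply, ← Matrix.fromBlocks_one, Matrix.fromBlocks_neg]
  simp [form_mul_form]

theorem jointForm_transpose (n k : ℕ) : (jointForm n k)ᵀ = -jointForm n k := by
  rw [jointForm, Matrix.fromBlocks_transpose, Matrix.fromBlocks_neg]
  simp [form_transpose]

theorem eq_zero_of_mulVec_eq_zero_of_sq {d : Type} [Fintype d] [DecidableEq d]
    {Ω : Matrix d d ℝ} (h : Ω * Ω = -1) (x : d → ℝ) (hx : Ω *ᵥ x = 0) : x = 0 := by
  have : (Ω * Ω) *ᵥ x = 0 := by rw [← Matrix.mulVec_mulVec, hx, Matrix.mulVec_zero]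
  rw [h, Matrix.neg_mulVec, Matrix.one_mulVec, neg_eq_zero] at this
  exact this

/-- The matrix of `momentumFlip`. -/
def flipMatrix (n : ℕ) : Matrix (Coord n) (Coord n) ℝ := Matrix.fromBlocks 1 0 0 (-1)

theorem flipMatrix_mulVec {n : ℕ} (z : Phase n) : flipMatrix n *ᵥ z = momentumFlip z := by
  ext i
  rcases i with i | i <;>
    simp [flipMatrix, momentumFlip, Matrix.fromBlocks_mulVec, Matrix.neg_mulVec]

theorem flipMatrix_mul_self (n : ℕ) : flipMatrix n * flipMatrix n = 1 := by
  rw [flipMatrix, Matrix.fromBlocks_multiply, ← Matrix.fromBlocks_one]; simp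

theorem flipMatrix_transpose (n : ℕ) : (flipMatrix n)ᵀ = flipMatrix n := by
  rw [flipMatrix, Matrix.fromBlocks_transpose]; simp

/-- Momentum inversion is antisymplectic. This sign is the reason why the correlated state pairs
`p_A` with `-p_B`. -/
theorem flipMatrix_mul_form_mul (n : ℕ) : flipMatrix n * form n * flipMatrix n = -form n := by
  rw [flipMatrix, form, Matrix.J, Matrix.fromBlocks_multiply, Matrix.fromBlocks_multiply,
    Matrix.fromBlocks_neg]
  simp

/-- The pure state with covariance matrix `λ 1` satisfies the uncertainty principle. -/
theorem posSemidef_uncMatrix_vacuum {d : Type} [Fintype d] [DecidableEq d] {lam : ℝ}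
    (hlam : 0 ≤ lam) {Ω : Matrix d d ℝ} (hsq : Ω * Ω = -1) (ht : Ωᵀ = -Ω) :
    (uncMatrix lam Ω (lam • 1)).PosSemidef := by
  set M : Matrix d d ℂ := 1 + Complex.I • toC Ω with hM
  have hH : Mᴴ = M := by
    rw [hM, Matrix.conjTranspose_add, Matrix.conjTranspose_smul, toC_conjTranspose, ht]
    ext i j; simp
  -- `iΩ` is Hermitian with square `1`, so `M / 2` is an orthogonal projection and `λ M` is
  -- positive.
  have hMM : M * Mᴴ = (2 : ℂ) • M := by
    have : toC Ω * toC Ω = -1 := by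
      rw [← toC_mul, hsq]; ext i j; simp [Matrix.one_apply]; split_ifs <;> simp
    rw [hH, hM]
    simp only [Matrix.mul_add, Matrix.add_mul, Matrix.one_mul, Matrix.mul_one, Matrix.smul_mul,
      Matrix.mul_smul, this]
    ext i j
    simp
    ring_nf
    rw [Complex.I_sq]
    ring
  have : uncMatrix lam Ω (lam • 1) = (lam / 2 : ℝ) • (M * Mᴴ) := by
    rw [hMM, hM]
    ext i j
    simp [uncMatrix, Matrix.one_apply]
    split_ifs <;> push_cast <;> ring
  rw [this]
  exact (Matrix.posSemidef_self_mul_conjTranspose M).smul (by positivity)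

end SymplecticForms

end ERL
end

noncomputable section

namespace ERL

/-! ### Symplectic dilation of Gaussian channels -/

section Dilation

open Matrix

theorem exists_mul_conjTranspose_of_posSemidef {d : Type} [Fintype d]
    {M : Matrix d d ℂ} (hM : M.PosSemidef) : ∃ G : Matrix d d ℂ, M = G * Gᴴ := by
  classical
  open scoped MatrixOrder Matrix.Norms.L2Operator in
  obtain ⟨B, hB⟩ := CStarAlgebra.nonneg_iff_eq_star_mul_self.mp hM.nonneg
  exact ⟨Bᴴ, by rw [Matrix.conjTranspose_conjTranspose]; exact hB⟩

theorem J_submatrix_sumCongr {k l : Type} [DecidableEq k] [DecidableEq l] (e : k ≃ l) :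
    (Matrix.J l ℝ).submatrix (Equiv.sumCongr e e) (Equiv.sumCongr e e) = Matrix.J k ℝ := by
  ext i j
  rcases i with i | i <;> rcases j with j | j <;> simp [Matrix.J, Matrix.one_apply]

/-- If `Y + i λ D ≥ 0` then `Y` and `D` are the images of the covariance matrix `λ 1` and of the
symplectic form under a linear map from a larger phase space. -/
theorem exists_noise_matrix {n : ℕ} {lam : ℝ} (hlam : 0 < lam) {D Y : Matrix (Coord n) (Coord n) ℝ}
    (h : (uncMatrix lam D Y).PosSemidef) :
    ∃ B : Matrix (Coord n) (Coord (n + n)) ℝ,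
      lam • (B * Bᵀ) = Y ∧ B * form (n + n) * Bᵀ = D := by
  obtain ⟨G, hG⟩ := exists_mul_conjTranspose_of_posSemidef h
  -- With `G = U + iV`, the real and imaginary parts of `G Gᴴ` are `U Uᵀ + V Vᵀ` and `V Uᵀ - U Vᵀ`.
  -- The second is the standard form evaluated on the rows of `(U V)`, so the columns of `U` act as
  -- positions and those of `V` as momenta. Each has `2n` columns, whence `n + n` degrees of
  -- freedom.
  set U : Matrix (Coord n) (Coord n) ℝ := G.map Complex.re with hU
  set V : Matrix (Coord n) (Coord n) ℝ := G.map Complex.im with hV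
  have hY : Y = U * Uᵀ + V * Vᵀ := by
    ext i j
    have := congrArg Complex.re (congrFun (congrFun hG i) j)
    simpa [uncMatrix, Matrix.mul_apply, Complex.mul_re, hU, hV, Finset.sum_add_distrib,
      -Fintype.sum_sum_type] using this
  have hD : lam • D = V * Uᵀ - U * Vᵀ := by
    ext i j
    have := congrArg Complex.im (congrFun (congrFun hG i) j)
    simp [uncMatrix, Matrix.mul_apply, Complex.mul_im, Finset.sum_add_distrib,
      -Fintype.sum_sum_type] at this
    simp [Matrix.mul_apply, hU, hV, this, -Fintype.sum_sum_type]
    ring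
  let e : Coord n ≃ Fin (n + n) := finSumFinEquiv
  let E := Equiv.sumCongr e e
  set B₀ : Matrix (Coord n) (Coord n ⊕ Coord n) ℝ := Matrix.fromCols U V with hB₀
  have h1 : B₀ * B₀ᵀ = Y := by
    rw [hB₀, Matrix.transpose_fromCols, Matrix.fromCols_mul_fromRows, hY]
  have h2 : B₀ * Matrix.J (Coord n) ℝ * B₀ᵀ = lam • D := by
    rw [hB₀, Matrix.transpose_fromCols, Matrix.J, Matrix.fromCols_mul_fromBlocks,
      Matrix.fromCols_mul_fromRows, hD]
    simp
    abel
  have hs : Real.sqrt lam⁻¹ * Real.sqrt lam⁻¹ = lam⁻¹ :=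
    Real.mul_self_sqrt (by positivity)
  refine ⟨Real.sqrt lam⁻¹ • B₀.submatrix id E.symm, ?_, ?_⟩
  · rw [Matrix.transpose_smul, Matrix.smul_mul, Matrix.mul_smul, smul_smul, smul_smul,
      Matrix.transpose_submatrix, Matrix.submatrix_mul_equiv, h1, mul_assoc, hs, mul_inv_cancel₀ hlam.ne']
    simp
  · have hf : form (n + n) = (Matrix.J (Coord n) ℝ).submatrix E.symm E.symm :=
      (J_submatrix_sumCongr e.symm).symm
    rw [Matrix.transpose_smul, Matrix.smul_mul, Matrix.smul_mul, Matrix.mul_smul, smul_smul,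
      Matrix.transpose_submatrix, hf, Matrix.submatrix_mul_equiv, Matrix.submatrix_mul_equiv, h2,
      hs, Matrix.submatrix_id_id, smul_smul, inv_mul_cancel₀ hlam.ne', one_smul]

/-- A symplectic coisometry `P` from `V` to `A`, extended by a further copy of `A` to a symplectic
map from `V ⊕ A` to `A ⊕ V`. -/
theorem symplectic_completion {a v : Type} [Fintype a] [Fintype v] [DecidableEq a]
    [DecidableEq v] {Ωa : Matrix a a ℝ} {Ωv : Matrix v v ℝ} (ha : Ωa * Ωa = -1)
    (hat : Ωaᵀ = -Ωa) (hvt : Ωvᵀ = -Ωv) {P : Matrix a v ℝ} (hP : P * Ωv * Pᵀ = Ωa) :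
    ∃ (C : Matrix v v ℝ) (ι : Matrix v a ℝ),
      Matrix.fromBlocks P 0 C ι * Matrix.fromBlocks Ωv 0 0 Ωa * (Matrix.fromBlocks P 0 C ι)ᵀ =
        Matrix.fromBlocks Ωa 0 0 Ωv := by
  -- `ι` is the symplectic adjoint of `P`, so `P ι = 1` and `ι P` is a symplectic projection. The
  -- form on `V` splits along `ι P` and `1 - ι P`; the additional copy of `A`, fed in through `ι`,
  -- replaces the part that `1 - ι P` discards.
  obtain ⟨ι, hι⟩ : ∃ ι : Matrix v a ℝ, ι = -(Ωv * Pᵀ * Ωa) := ⟨_, rfl⟩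
  have h1 : ι * Ωa = Ωv * Pᵀ := by
    rw [hι, Matrix.neg_mul, Matrix.mul_assoc _ Ωa, ha]; simp
  have h2 : Ωa * ιᵀ = P * Ωv := by
    have := congrArg Matrix.transpose h1
    simp only [Matrix.transpose_mul, hat, hvt, Matrix.transpose_transpose] at this
    simpa using this
  have h3 : ι * P * Ωv = ι * Ωa * ιᵀ := by rw [Matrix.mul_assoc, Matrix.mul_assoc, h2]
  have h4 : Ωv * Pᵀ * ιᵀ = ι * Ωa * ιᵀ := by rw [h1]
  have h5 : ι * P * Ωv * Pᵀ = Ωv * Pᵀ := by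
    rw [Matrix.mul_assoc ι, Matrix.mul_assoc ι, hP, h1]
  refine ⟨1 - ι * P, ι, ?_⟩
  rw [Matrix.fromBlocks_transpose, Matrix.fromBlocks_multiply, Matrix.fromBlocks_multiply]
  simp only [Matrix.transpose_sub, Matrix.transpose_mul, Matrix.transpose_one,
    Matrix.transpose_zero, Matrix.mul_zero, Matrix.zero_mul, add_zero, zero_add]
  congr 1
  · rw [Matrix.mul_sub, Matrix.mul_one, ← Matrix.mul_assoc, hP, h2, sub_self]
  · rw [Matrix.sub_mul, Matrix.one_mul, Matrix.sub_mul, h5, sub_self]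
  · simp only [Matrix.sub_mul, Matrix.one_mul, Matrix.mul_sub, Matrix.mul_one]
    rw [← Matrix.mul_assoc, ← Matrix.mul_assoc, h5, h4, h3]
    abel

/-- The coordinates of a composite system. -/
def coordAdd (m n : ℕ) : Coord (m + n) ≃ Coord m ⊕ Coord n :=
  (Equiv.sumCongr finSumFinEquiv.symm finSumFinEquiv.symm).trans
    (Equiv.sumSumSumComm (Fin m) (Fin n) (Fin m) (Fin n))

theorem jointForm_submatrix_coordAdd (m n : ℕ) :
    (jointForm m n).submatrix (coordAdd m n) (coordAdd m n) = form (m + n) := by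
  have : form (m + n) = (Matrix.J (Fin m ⊕ Fin n) ℝ).submatrix
      (Equiv.sumCongr finSumFinEquiv.symm finSumFinEquiv.symm)
      (Equiv.sumCongr finSumFinEquiv.symm finSumFinEquiv.symm) :=
    (J_submatrix_sumCongr finSumFinEquiv.symm).symm
  rw [this, coordAdd, Equiv.coe_trans, ← Matrix.submatrix_submatrix]
  congr 1
  ext i j
  rcases i with (i | i) | (i | i) <;> rcases j with (j | j) | (j | j) <;>
    simp [jointForm, form, Matrix.J, Matrix.one_apply]

/-- A noise matrix `B` with `X Ω Xᵀ + B Ω Bᵀ = Ω` makes `(X B)` a symplectic coisometry, which is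
then completed by one more copy of `A`. The ancilla thus consists of the noise modes and this copy;
the copy does not enter the output on `A`, so the noise remains `λ B Bᵀ`. -/
theorem exists_symplectic_dilation {n : ℕ} {lam : ℝ} (hlam : 0 < lam)
    {X Y : Matrix (Coord n) (Coord n) ℝ}
    (h : (uncMatrix lam (form n - X * form n * Xᵀ) Y).PosSemidef) :
    ∃ (m : ℕ) (S : Matrix (Coord n ⊕ Coord m) (Coord n ⊕ Coord m) ℝ),
      S * jointForm n m * Sᵀ = jointForm n m ∧ S.toBlocks₁₁ = X ∧
        lam • (S.toBlocks₁₂ * S.toBlocks₁₂ᵀ) = Y := by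
  obtain ⟨k, B, hB1, hB2⟩ : ∃ (k : ℕ) (B : Matrix (Coord n) (Coord k) ℝ),
      lam • (B * Bᵀ) = Y ∧ B * form k * Bᵀ = form n - X * form n * Xᵀ :=
    ⟨n + n, exists_noise_matrix hlam h⟩
  have hP : Matrix.fromCols X B * jointForm n k * (Matrix.fromCols X B)ᵀ = form n := by
    rw [jointForm, Matrix.transpose_fromCols, Matrix.fromCols_mul_fromBlocks,
      Matrix.fromCols_mul_fromRows]
    simp [hB2]
  obtain ⟨C, ι, hC⟩ := symplectic_completion (form_mul_form n) (form_transpose n)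
    (jointForm_transpose n k) hP
  -- The completed matrix goes from `(A ⊕ K) ⊕ A` to `A ⊕ (A ⊕ K)`. Both are identified with `A ⊕
  -- E`, but with a different copy of `A` playing the role of the system at input and output.
  let row : Coord n ⊕ Coord (k + n) ≃ Coord n ⊕ (Coord n ⊕ Coord k) :=
    Equiv.sumCongr (Equiv.refl _) ((coordAdd k n).trans (Equiv.sumComm _ _))
  let col : Coord n ⊕ Coord (k + n) ≃ (Coord n ⊕ Coord k) ⊕ Coord n :=
    (Equiv.sumCongr (Equiv.refl _) (coordAdd k n)).trans (Equiv.sumAssoc _ _ _).symm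
  have hjf : ∀ i j, form (k + n) i j = jointForm k n (coordAdd k n i) (coordAdd k n j) :=
    fun i j => (congrFun (congrFun (jointForm_submatrix_coordAdd k n) i) j).symm
  have hrow : jointForm n (k + n) =
      (Matrix.fromBlocks (form n) 0 0 (jointForm n k)).submatrix row row := by
    ext i j
    rcases i with i | i <;> rcases j with j | j <;> simp [row]
    · simp [jointForm]
    · simp [jointForm]
    · simp [jointForm]
    · conv_lhs => simp only [jointForm, Matrix.fromBlocks_apply₂₂]
      rw [hjf]
      rcases coordAdd k n i with a | a <;> rcases coordAdd k n j with b | b <;> simp [jointForm]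
  have hcol : jointForm n (k + n) =
      (Matrix.fromBlocks (jointForm n k) 0 0 (form n)).submatrix col col := by
    ext i j
    rcases i with i | i <;> rcases j with j | j <;> simp only [col, Matrix.submatrix_apply]
    · simp [jointForm]
    · rcases hb : coordAdd k n j with b | b <;> simp [jointForm, hb]
    · rcases ha : coordAdd k n i with a | a <;> simp [jointForm, ha]
    · conv_lhs => simp only [jointForm, Matrix.fromBlocks_apply₂₂]
      rw [hjf]
      rcases ha : coordAdd k n i with a | a <;> rcases hb : coordAdd k n j with b | b <;>
        simp [jointForm, ha, hb]
  set S₀ := Matrix.fromBlocks (Matrix.fromCols X B) 0 C ι with hS₀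
  refine ⟨k + n, S₀.submatrix row col, ?_, ?_, ?_⟩
  · conv_lhs => rw [hcol]
    rw [Matrix.transpose_submatrix, Matrix.submatrix_mul_equiv, Matrix.submatrix_mul_equiv, hC,
      ← hrow]
  · ext i j
    simp [Matrix.toBlocks₁₁, row, col, hS₀]
  · have : (S₀.submatrix row col).toBlocks₁₂ =
        (Matrix.fromCols B (0 : Matrix (Coord n) (Coord n) ℝ)).submatrix id (coordAdd k n) := by
      ext i j
      rcases hb : coordAdd k n j with b | b <;> simp [Matrix.toBlocks₁₂, row, col, hS₀, hb]
    rw [this, Matrix.transpose_submatrix, Matrix.submatrix_mul_equiv, Matrix.transpose_fromCols,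
      Matrix.fromCols_mul_fromRows]
    simpa using hB1

end Dilation

end ERL
end

noncomputable section

namespace ERL

/-! ### Gaussian distributions and their densities -/

section Gaussians

open Matrix
open scoped NNReal

variable {d e : Type} [Fintype d] [Fintype e]

/-- The standard Gaussian distribution on `ℝ^e`. -/
def std (e : Type) [Fintype e] : Measure (e → ℝ) := Measure.pi fun _ => gaussianReal 0 1

instance : IsProbabilityMeasure (std e) := by unfold std; infer_instance

/-- The distribution of `T y + b` for a standard Gaussian vector `y`. -/
def gauss (T : Matrix d e ℝ) (b : d → ℝ) : Measure (d → ℝ) :=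
  (std e).map (fun y => T *ᵥ y + b)

theorem measurable_mulVec_add (T : Matrix d e ℝ) (b : d → ℝ) :
    Measurable (fun y : e → ℝ => T *ᵥ y + b) := by
  have : Continuous (fun y : e → ℝ => T *ᵥ y + b) := by fun_prop
  exact this.measurable

theorem measurable_mulVec (T : Matrix d e ℝ) : Measurable (fun y : e → ℝ => T *ᵥ y) := by
  have : Continuous (fun y : e → ℝ => T *ᵥ y) := by fun_prop
  exact this.measurable

instance (T : Matrix d e ℝ) (b : d → ℝ) : IsProbabilityMeasure (gauss T b) :=
  Measure.isProbabilityMeasure_map (measurable_mulVec_add T b).aemeasurable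

/-- `T` enters only through `T * Tᵀ`. Degenerate covariances are included, as required for channel
noise. -/
theorem charFunDual_gauss [DecidableEq d] (T : Matrix d e ℝ) (b : d → ℝ)
    (L : StrongDual ℝ (d → ℝ)) :
    charFunDual (gauss T b) L = Complex.exp (L b * Complex.I -
      ((fun i => L (Pi.single i 1)) ⬝ᵥ (T * Tᵀ) *ᵥ (fun i => L (Pi.single i 1)) : ℝ) / 2) := by
  set l : d → ℝ := fun i => L (Pi.single i 1) with hl
  have hL : ∀ x, L x = l ⬝ᵥ x := by
    intro x
    conv_lhs => rw [pi_eq_sum_univ' x, map_sum]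
    simp [dotProduct, hl, mul_comm]
  set c := l ᵥ* T with hc
  have hLT : ∀ y, L (T *ᵥ y + b) = ∑ k, c k * y k + L b := by
    intro y
    rw [map_add, hL (T *ᵥ y), Matrix.dotProduct_mulVec]; rfl
  rw [charFunDual_apply, gauss, integral_map (measurable_mulVec_add T b).aemeasurable
    (by fun_prop)]
  simp_rw [hLT]
  have : ∀ y : e → ℝ, Complex.exp (((∑ k, c k * y k + L b : ℝ) : ℂ) * Complex.I) =
      Complex.exp (L b * Complex.I) * ∏ k, Complex.exp (c k * y k * Complex.I) := by
    intro y
    rw [← Complex.exp_sum, ← Complex.exp_add]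
    congr 1
    push_cast
    rw [← Finset.sum_mul]; ring
  simp_rw [this]
  rw [integral_const_mul, std, integral_fintype_prod_eq_prod
    (f := fun k (x : ℝ) => Complex.exp (c k * x * Complex.I))]
  simp_rw [← charFun_apply_real, charFun_gaussianReal]
  rw [← Complex.exp_sum, ← Complex.exp_add]
  congr 1
  have h2 : l ⬝ᵥ (T * Tᵀ) *ᵥ l = ∑ k, c k ^ 2 := by
    rw [← Matrix.mulVec_mulVec, Matrix.dotProduct_mulVec, Matrix.mulVec_transpose, ← hc]
    simp [dotProduct, sq]
  rw [h2]
  push_cast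
  rw [Finset.sum_div, sub_eq_add_neg, ← Finset.sum_neg_distrib]
  congr 1
  refine Finset.sum_congr rfl fun k _ => ?_
  simp

/-- Gaussian distributions are determined by their mean and covariance matrix. -/
theorem gauss_congr {e' : Type} [Fintype e'] {T : Matrix d e ℝ} {T' : Matrix d e' ℝ}
    (h : T * Tᵀ = T' * T'ᵀ) (b : d → ℝ) : gauss T b = gauss T' b := by
  classical
  refine Measure.ext_of_charFunDual ?_
  ext L
  rw [charFunDual_gauss, charFunDual_gauss, h]

theorem memLp_eval_std (k : e) : MemLp (fun y : e → ℝ => y k) 2 (std e) :=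
  (memLp_id_gaussianReal' (μ := 0) (v := 1) 2 (by simp)).comp_measurePreserving
    (measurePreserving_eval (fun _ : e => gaussianReal 0 1) k)

theorem covariance_eval_std [DecidableEq e] (k l : e) :
    covariance (fun y : e → ℝ => y k) (fun y => y l) (std e) = (1 : Matrix e e ℝ) k l := by
  rcases eq_or_ne k l with rfl | h
  · rw [covariance_self (measurable_pi_apply k).aemeasurable, Matrix.one_apply_eq]
    have h1 := measurePreserving_eval (fun _ : e => gaussianReal 0 1) k
    have h2 : Var[id; (std e).map (Function.eval k)] = Var[id ∘ Function.eval k; std e] :=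
      variance_map (by fun_prop) (measurable_pi_apply k).aemeasurable
    rw [std, h1.map_eq, variance_id_gaussianReal] at h2
    exact h2.symm
  · rw [Matrix.one_apply_ne h]
    have := (iIndepFun_pi (μ := fun _ : e => gaussianReal 0 1) (X := fun _ (x : ℝ) => x)
      (fun i => by fun_prop)).indepFun h
    exact this.covariance_eq_zero (memLp_eval_std k) (memLp_eval_std l)

theorem memLp_linear {μ : Measure (e → ℝ)} (h : FiniteSecondMoments μ) (c : e → ℝ) :
    MemLp (fun y : e → ℝ => ∑ k, c k * y k) 2 μ :=
  memLp_finsetSum _ fun k _ => (h k).const_mul (c k)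

theorem covariance_linear {μ : Measure (e → ℝ)} [IsProbabilityMeasure μ]
    (h : FiniteSecondMoments μ) (a c : e → ℝ) (s t : ℝ) :
    covariance (fun y : e → ℝ => ∑ k, a k * y k + s) (fun y => ∑ k, c k * y k + t) μ =
      ∑ k, ∑ l, a k * c l * covariance (fun y : e → ℝ => y k) (fun y => y l) μ := by
  rw [covariance_add_const_left ((memLp_linear h a).integrable (by norm_num)),
    covariance_add_const_right ((memLp_linear h c).integrable (by norm_num)),
    covariance_fun_sum_fun_sum (fun k => (h k).const_mul (a k)) (fun k => (h k).const_mul (c k))]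
  refine Finset.sum_congr rfl fun k _ => Finset.sum_congr rfl fun l _ => ?_
  rw [covariance_const_mul_left, covariance_const_mul_right]; ring

theorem finiteSecondMoments_std : FiniteSecondMoments (std e) := memLp_eval_std

theorem finiteSecondMoments_gauss (T : Matrix d e ℝ) (b : d → ℝ) :
    FiniteSecondMoments (gauss T b) := by
  intro i
  rw [gauss, memLp_map_measure_iff (measurable_pi_apply i).aestronglyMeasurable (measurable_mulVec_add T b).aemeasurable]
  exact (memLp_linear finiteSecondMoments_std (T i)).add (memLp_const (b i))

theorem covMatrix_gauss (T : Matrix d e ℝ) (b : d → ℝ) :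
    covMatrix (gauss T b) = (2 : ℝ) • (T * Tᵀ) := by
  classical
  ext i j
  rw [covMatrix, Matrix.of_apply, gauss, covariance_map_fun
    (measurable_pi_apply i).aestronglyMeasurable (measurable_pi_apply j).aestronglyMeasurable
    (measurable_mulVec_add T b).aemeasurable]
  have := covariance_linear (finiteSecondMoments_std (e := e)) (T i) (T j) (b i) (b j)
  simp only [covariance_eval_std] at this
  rw [show (fun ω : e → ℝ => (T *ᵥ ω + b) i) = fun y => ∑ k, T i k * y k + b i from rfl,
    show (fun ω : e → ℝ => (T *ᵥ ω + b) j) = fun y => ∑ k, T j k * y k + b j from rfl, this]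
  simp [Matrix.mul_apply, Matrix.one_apply]

/-- A product of one-dimensional Gaussian distributions. -/
def diagGauss (b : d → ℝ) (v : d → ℝ≥0) : Measure (d → ℝ) :=
  Measure.pi fun i => gaussianReal (b i) (v i)

instance (b : d → ℝ) (v : d → ℝ≥0) : IsProbabilityMeasure (diagGauss b v) := by
  unfold diagGauss; infer_instance

theorem gaussianReal_eq_map (b : ℝ) (v : ℝ≥0) :
    gaussianReal b v = (gaussianReal 0 1).map (fun x => √(v : ℝ) * x + b) := by
  have : (fun x : ℝ => √(v : ℝ) * x + b) = (fun x => x + b) ∘ (fun x => √(v : ℝ) * x) := rfl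
  rw [this, ← Measure.map_map (by fun_prop) (by fun_prop), gaussianReal_map_const_mul,
    gaussianReal_map_add_const]
  congr 1
  · simp
  · ext; simp

theorem diagGauss_eq_map (b : d → ℝ) (v : d → ℝ≥0) :
    diagGauss b v = (std d).map (fun y i => √(v i : ℝ) * y i + b i) := by
  have h : ∀ i : d, (gaussianReal 0 1).map (fun x => √(v i : ℝ) * x + b i) =
      gaussianReal (b i) (v i) := fun i => (gaussianReal_eq_map (b i) (v i)).symm
  have (i : d) : SigmaFinite ((gaussianReal 0 1).map (fun x => √(v i : ℝ) * x + b i)) := by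
    rw [h]; infer_instance
  rw [std, Measure.pi_map_pi (f := fun i x => √(v i : ℝ) * x + b i) (fun i => by fun_prop),
    diagGauss]
  simp_rw [h]

/-- The image of a product of one-dimensional Gaussian distributions under a matrix `U`. -/
def rotGauss (U : Matrix d d ℝ) (b : d → ℝ) (v : d → ℝ≥0) : Measure (d → ℝ) :=
  (diagGauss b v).map (fun x => U *ᵥ x)

theorem rotGauss_eq_gauss [DecidableEq d] (U : Matrix d d ℝ) (b : d → ℝ) (v : d → ℝ≥0) :
    rotGauss U b v = gauss (U * Matrix.diagonal fun i => √(v i : ℝ)) (U *ᵥ b) := by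
  rw [rotGauss, diagGauss_eq_map, gauss, Measure.map_map (measurable_mulVec U) (by fun_prop)]
  congr 1
  ext y : 1
  have : (fun i => √(v i : ℝ) * y i + b i) = (Matrix.diagonal fun i => √(v i : ℝ)) *ᵥ y + b := by
    ext i; simp [Matrix.mulVec_diagonal]
  simp only [Function.comp]
  rw [this, Matrix.mulVec_add, Matrix.mulVec_mulVec]

theorem sqrt_cov_mul_transpose [DecidableEq d] (U : Matrix d d ℝ) (v : d → ℝ≥0) :
    (U * Matrix.diagonal fun i => √(v i : ℝ)) * (U * Matrix.diagonal fun i => √(v i : ℝ))ᵀ =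
      U * Matrix.diagonal (fun i => (v i : ℝ)) * Uᵀ := by
  rw [Matrix.transpose_mul, Matrix.diagonal_transpose, Matrix.mul_assoc, ← Matrix.mul_assoc _ _ Uᵀ,
    Matrix.diagonal_mul_diagonal, ← Matrix.mul_assoc]
  simp

/-- The density of `rotGauss`. -/
def rotDensity (U : Matrix d d ℝ) (b : d → ℝ) (v : d → ℝ≥0) (w : d → ℝ) : ℝ :=
  ∏ i, gaussianPDFReal (b i) (v i) ((Uᵀ *ᵥ w) i)

theorem diagGauss_eq_withDensity (b : d → ℝ) {v : d → ℝ≥0} (hv : ∀ i, v i ≠ 0) :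
    diagGauss b v = (volume : Measure (d → ℝ)).withDensity
      (fun x => ENNReal.ofReal (∏ i, gaussianPDFReal (b i) (v i) (x i))) := by
  refine Measure.pi_eq fun s hs => ?_
  rw [withDensity_apply _ (MeasurableSet.univ_pi hs)]
  have hint : ∀ i, Integrable ((s i).indicator (gaussianPDFReal (b i) (v i))) := fun i =>
    (integrable_gaussianPDFReal _ _).indicator (hs i)
  rw [← ofReal_integral_eq_lintegral_ofReal]
  · rw [← integral_indicator (MeasurableSet.univ_pi hs)]
    have : ∀ x : d → ℝ, (Set.univ.pi s).indicator
        (fun x => ∏ i, gaussianPDFReal (b i) (v i) (x i)) x =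
        ∏ i, (s i).indicator (gaussianPDFReal (b i) (v i)) (x i) := by
      intro x
      by_cases hx : x ∈ Set.univ.pi s
      · rw [Set.indicator_of_mem hx]
        exact Finset.prod_congr rfl fun i _ => (Set.indicator_of_mem (hx i trivial) _).symm
      · rw [Set.indicator_of_notMem hx]
        simp only [Set.mem_pi, Set.mem_univ, true_imp_iff, not_forall] at hx
        obtain ⟨i, hi⟩ := hx
        exact (Finset.prod_eq_zero (Finset.mem_univ i) (Set.indicator_of_notMem hi _)).symm
    simp_rw [this]
    rw [volume_pi, integral_fintype_prod_eq_prod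
      (f := fun i => (s i).indicator (gaussianPDFReal (b i) (v i))),
      ENNReal.ofReal_prod_of_nonneg]
    · refine Finset.prod_congr rfl fun i _ => ?_
      rw [gaussianReal_apply_eq_integral _ (hv i), integral_indicator (hs i)]
    · intro i _
      exact integral_nonneg fun x => Set.indicator_nonneg (fun x _ => gaussianPDFReal_nonneg _ _ _) x
  · exact (Integrable.fintype_prod (f := fun i => gaussianPDFReal (b i) (v i))
      (fun i => integrable_gaussianPDFReal _ _)).integrableOn
  · exact ae_of_all _ fun x => Finset.prod_nonneg fun i _ => gaussianPDFReal_nonneg _ _ _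

theorem measurePreserving_orthogonal [DecidableEq d] {U : Matrix d d ℝ} (hU : U * Uᵀ = 1) :
    MeasurePreserving (fun x : d → ℝ => U *ᵥ x) := by
  refine ⟨measurable_mulVec U, ?_⟩
  have hdet : U.det * U.det = 1 := by
    have := congrArg Matrix.det hU
    rwa [Matrix.det_mul, Matrix.det_transpose, Matrix.det_one] at this
  have h0 : U.det ≠ 0 := fun h => by simp [h] at hdet
  have := Real.map_matrix_volume_pi_eq_smul_volume_pi h0
  have habs : |U.det⁻¹| = 1 := by
    rw [abs_inv, inv_eq_one]
    have : |U.det| * |U.det| = 1 := by rw [abs_mul_abs_self, hdet]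
    nlinarith [abs_nonneg U.det]
  rw [habs, ENNReal.ofReal_one, one_smul] at this
  exact this

theorem measurable_rotDensity (U : Matrix d d ℝ) (b : d → ℝ) (v : d → ℝ≥0) :
    Measurable (rotDensity U b v) := by
  unfold rotDensity
  refine Finset.measurable_prod _ fun i _ => (measurable_gaussianPDFReal _ _).comp ?_
  exact (measurable_pi_apply i).comp (measurable_mulVec Uᵀ)

theorem rotGauss_eq_withDensity [DecidableEq d] {U : Matrix d d ℝ} (hU : U * Uᵀ = 1) (b : d → ℝ) {v : d → ℝ≥0}
    (hv : ∀ i, v i ≠ 0) : rotGauss U b v =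
      (volume : Measure (d → ℝ)).withDensity (fun w => ENNReal.ofReal (rotDensity U b v w)) := by
  have hU' : Uᵀ * U = 1 := mul_eq_one_comm.1 hU
  have hmp := measurePreserving_orthogonal hU
  ext s hs
  rw [rotGauss, diagGauss_eq_withDensity b hv, Measure.map_apply (measurable_mulVec U) hs,
    withDensity_apply _ (measurable_mulVec U hs), withDensity_apply _ hs,
    ← hmp.setLIntegral_comp_preimage hs (measurable_rotDensity U b v).ennreal_ofReal]
  simp [rotDensity, Matrix.mulVec_mulVec, hU']

theorem rotDensity_pos {U : Matrix d d ℝ} {b : d → ℝ} {v : d → ℝ≥0} (hv : ∀ i, v i ≠ 0)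
    (w : d → ℝ) : 0 < rotDensity U b v w :=
  Finset.prod_pos fun i _ => gaussianPDFReal_pos _ _ _ (hv i)

end Gaussians

end ERL
end

noncomputable section

namespace ERL

/-! ### Maximal entropy characterizes Gaussians -/

section MaximalEntropy

open Matrix
open scoped NNReal

/-- This is `log t ≤ t - 1` at `t = g / f`, multiplied by `f`; strictness of that bound for `t ≠ 1`
gives the case of equality below. -/
theorem negMulLog_add_mul_log_le {f g : ℝ} (hf : 0 ≤ f) (hg : 0 < g) :
    Real.negMulLog f + f * Real.log g ≤ g - f := by
  rcases hf.eq_or_lt with rfl | hf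
  · simpa using hg.le
  · have h := Real.log_le_sub_one_of_pos (div_pos hg hf)
    rw [Real.log_div hg.ne' hf.ne'] at h
    have h2 := mul_le_mul_of_nonneg_left h hf.le
    have h3 : f * (g / f - 1) = g - f := by field_simp
    rw [h3] at h2
    rw [Real.negMulLog]
    linarith

theorem eq_of_negMulLog_add_mul_log_eq {f g : ℝ} (hf : 0 ≤ f) (hg : 0 < g)
    (h : Real.negMulLog f + f * Real.log g = g - f) : f = g := by
  rcases hf.eq_or_lt with rfl | hf
  · simp at h; linarith
  · by_contra hne
    have h1 : g / f ≠ 1 := fun h => hne ((div_eq_one_iff_eq hf.ne').1 h).symm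
    have h' := Real.log_lt_sub_one_of_pos (div_pos hg hf) h1
    rw [Real.log_div hg.ne' hf.ne'] at h'
    have h2 := mul_lt_mul_of_pos_left h' hf
    have h3 : f * (g / f - 1) = g - f := by field_simp
    rw [h3] at h2
    rw [Real.negMulLog] at h
    linarith

variable {d : Type} [Fintype d]

theorem integral_rnDeriv_toReal {ν : Measure (d → ℝ)} (hν : IsLiouville ν) :
    ∫ x, (ν.rnDeriv volume x).toReal = 1 := by
  have := hν.1
  rw [Measure.integral_toReal_rnDeriv hν.2]
  simp

/-- **Gibbs' inequality**, with the case of equality, for a distribution `ν` and a positive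
probability density `g`. -/
theorem entropy_le_neg_integral_log {ν : Measure (d → ℝ)} (hν : IsLiouville ν)
    (hint : Integrable (entropyDensity ν)) {g : (d → ℝ) → ℝ} (hg : ∀ x, 0 < g x)
    (hgm : Integrable g) (hg1 : ∫ x, g x = 1) (hlog : Integrable (fun x => Real.log (g x)) ν) :
    entropy ν ≤ -∫ x, Real.log (g x) ∂ν ∧
      (-∫ x, Real.log (g x) ∂ν ≤ entropy ν →
        ν = volume.withDensity (fun x => ENNReal.ofReal (g x))) := by
  have := hν.1
  set f : (d → ℝ) → ℝ := fun x => (ν.rnDeriv volume x).toReal with hf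
  have hf0 : ∀ x, 0 ≤ f x := fun x => ENNReal.toReal_nonneg
  have hfi : Integrable f := Measure.integrable_toReal_rnDeriv
  have hfl : Integrable (fun x => f x * Real.log (g x)) :=
    (integrable_rnDeriv_smul_iff hν.2).2 hlog
  have hfl2 : ∫ x, f x * Real.log (g x) = ∫ x, Real.log (g x) ∂ν :=
    integral_rnDeriv_smul hν.2
  -- The defect in the pointwise inequality. It is nonnegative and its integral is the entropy gap,
  -- so a vanishing gap forces `f = g` almost everywhere.
  set h : (d → ℝ) → ℝ := fun x => g x - f x - (entropyDensity ν x + f x * Real.log (g x)) with hh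
  have hh0 : ∀ x, 0 ≤ h x := fun x => sub_nonneg.2 (negMulLog_add_mul_log_le (hf0 x) (hg x))
  have hhi : Integrable h := (hgm.sub hfi).sub (hint.add hfl)
  have hhint : ∫ x, h x = -(entropy ν + ∫ x, Real.log (g x) ∂ν) := by
    have e1 : ∫ x, h x = (∫ x, (g x - f x)) - ∫ x, (entropyDensity ν x + f x * Real.log (g x)) :=
      integral_sub (hgm.sub hfi) (hint.add hfl)
    rw [e1, integral_sub hgm hfi, integral_add hint hfl, hfl2, hg1, integral_rnDeriv_toReal hν,
      entropy]
    ring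
  constructor
  · have : 0 ≤ ∫ x, h x := integral_nonneg hh0
    linarith
  · intro hle
    have hz : ∫ x, h x = 0 :=
      le_antisymm (by linarith) (integral_nonneg hh0)
    rw [integral_eq_zero_iff_of_nonneg hh0 hhi] at hz
    have hfg : ν.rnDeriv volume =ᵐ[volume] fun x => ENNReal.ofReal (g x) := by
      filter_upwards [hz, ν.rnDeriv_ne_top volume] with x hx hx2
      have : f x = g x := by
        refine eq_of_negMulLog_add_mul_log_eq (hf0 x) (hg x) ?_
        have : g x - f x - (entropyDensity ν x + f x * Real.log (g x)) = 0 := hx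
        simp only [entropyDensity] at this
        linarith
      rw [← this, hf, ENNReal.ofReal_toReal hx2]
    rw [← withDensity_congr_ae hfg, Measure.withDensity_rnDeriv_eq _ _ hν.2]

variable [DecidableEq d]

theorem log_gaussianPDFReal (b : ℝ) {v : ℝ≥0} (hv : v ≠ 0) (x : ℝ) :
    Real.log (gaussianPDFReal b v x) =
      -(Real.log (2 * Real.pi * v) / 2) - (x - b) ^ 2 / (2 * v) := by
  have hv' : (0 : ℝ) < v := by exact_mod_cast pos_iff_ne_zero.2 hv
  rw [gaussianPDFReal, Real.log_mul (by positivity) (by positivity), Real.log_exp, Real.log_inv,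
    Real.log_sqrt (by positivity)]
  ring

/-- The expected logarithm of the Gaussian density whose mean and covariance matrix are those
of `ν`. -/
theorem integral_log_rotDensity {U : Matrix d d ℝ} (hU : U * Uᵀ = 1) {b : d → ℝ} {v : d → ℝ≥0}
    (hv : ∀ i, v i ≠ 0) {ν : Measure (d → ℝ)} [IsProbabilityMeasure ν]
    (hν : FiniteSecondMoments ν)
    (hcov : covMatrix ν = (2 : ℝ) • (U * Matrix.diagonal (fun i => (v i : ℝ)) * Uᵀ))
    (hb : ∀ i, b i = ∫ w, (Uᵀ *ᵥ w) i ∂ν) :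
    Integrable (fun w => Real.log (rotDensity U b v w)) ν ∧
      ∫ w, Real.log (rotDensity U b v w) ∂ν =
        -∑ i, (Real.log (2 * Real.pi * v i) + 1) / 2 := by
  have hU' : Uᵀ * U = 1 := mul_eq_one_comm.1 hU
  -- The logarithm is quadratic in the rotated coordinates, so its expectation depends only on the
  -- first two moments of `ν`.
  have hlog : ∀ w, Real.log (rotDensity U b v w) = ∑ i, (-(Real.log (2 * Real.pi * v i) / 2) -
      ((Uᵀ *ᵥ w) i - b i) ^ 2 / (2 * v i)) := by
    intro w
    rw [rotDensity, Real.log_prod (fun i _ => (gaussianPDFReal_pos _ _ _ (hv i)).ne')]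
    exact Finset.sum_congr rfl fun i _ => log_gaussianPDFReal _ (hv i) _
  have hmem : ∀ i, MemLp (fun w : d → ℝ => (Uᵀ *ᵥ w) i) 2 ν := fun i => memLp_linear hν (Uᵀ i)
  have hsq : ∀ i, Integrable (fun w => ((Uᵀ *ᵥ w) i - b i) ^ 2) ν := fun i =>
    ((hmem i).sub (memLp_const (b i))).integrable_sq
  have hvar : ∀ i, ∫ w, ((Uᵀ *ᵥ w) i - b i) ^ 2 ∂ν = v i := by
    intro i
    have h1 : ∫ w, ((Uᵀ *ᵥ w) i - b i) ^ 2 ∂ν = Var[fun w : d → ℝ => (Uᵀ *ᵥ w) i; ν] := by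
      rw [variance_eq_integral (hmem i).aestronglyMeasurable.aemeasurable, hb]
    have h2 := covariance_linear hν (Uᵀ i) (Uᵀ i) 0 0
    simp only [add_zero] at h2
    have h3 : ∀ k l, covariance (fun y : d → ℝ => y k) (fun y => y l) ν =
        (U * Matrix.diagonal (fun i => (v i : ℝ)) * Uᵀ) k l := by
      intro k l
      have := congrFun (congrFun hcov k) l
      simp only [covMatrix, Matrix.of_apply, Matrix.smul_apply, smul_eq_mul] at this
      linarith
    simp only [h3] at h2
    rw [h1, ← covariance_self (hmem i).aestronglyMeasurable.aemeasurable]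
    change cov[fun y : d → ℝ => ∑ k, Uᵀ i k * y k, fun y => ∑ k, Uᵀ i k * y k; ν] = _
    rw [h2]
    have h4 : (Uᵀ * (U * Matrix.diagonal (fun i => (v i : ℝ)) * Uᵀ) * U) i i = v i := by
      rw [Matrix.mul_assoc, Matrix.mul_assoc, hU', Matrix.mul_one, ← Matrix.mul_assoc, hU',
        Matrix.one_mul, Matrix.diagonal_apply_eq]
    rw [← h4, Matrix.mul_apply, Finset.sum_comm]
    refine Finset.sum_congr rfl fun l _ => ?_
    rw [Matrix.mul_apply, Finset.sum_mul]
    refine Finset.sum_congr rfl fun k _ => ?_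
    simp only [Matrix.transpose_apply]; ring
  have hterm : ∀ i, Integrable (fun w => -(Real.log (2 * Real.pi * v i) / 2) -
      ((Uᵀ *ᵥ w) i - b i) ^ 2 / (2 * v i)) ν := fun i =>
    (integrable_const _).sub ((hsq i).div_const _)
  simp_rw [hlog]
  refine ⟨integrable_finsetSum _ fun i _ => hterm i, ?_⟩
  rw [integral_finsetSum _ fun i _ => hterm i, ← Finset.sum_neg_distrib]
  refine Finset.sum_congr rfl fun i _ => ?_
  have hv' : (v i : ℝ) ≠ 0 := by exact_mod_cast hv i
  rw [integral_sub (integrable_const _) ((hsq i).div_const _), integral_div, hvar, integral_const]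
  simp
  field_simp
  ring

variable {U : Matrix d d ℝ} {v : d → ℝ≥0}

instance (U : Matrix d d ℝ) (b : d → ℝ) (v : d → ℝ≥0) : IsProbabilityMeasure (rotGauss U b v) :=
  Measure.isProbabilityMeasure_map (measurable_mulVec U).aemeasurable

theorem isLiouville_rotGauss (hU : U * Uᵀ = 1) (b : d → ℝ) (hv : ∀ i, v i ≠ 0) :
    IsLiouville (rotGauss U b v) := by
  refine ⟨inferInstance, ?_⟩
  rw [rotGauss_eq_withDensity hU b hv]
  exact withDensity_absolutelyContinuous _ _

theorem finiteSecondMoments_rotGauss (U : Matrix d d ℝ) (b : d → ℝ) (v : d → ℝ≥0) :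
    FiniteSecondMoments (rotGauss U b v) := by
  rw [rotGauss_eq_gauss]; exact finiteSecondMoments_gauss _ _

theorem covMatrix_rotGauss (U : Matrix d d ℝ) (b : d → ℝ) (v : d → ℝ≥0) :
    covMatrix (rotGauss U b v) =
      (2 : ℝ) • (U * Matrix.diagonal (fun i => (v i : ℝ)) * Uᵀ) := by
  rw [rotGauss_eq_gauss, covMatrix_gauss, sqrt_cov_mul_transpose]

theorem integral_rotGauss (hU : U * Uᵀ = 1) (b : d → ℝ) (i : d) :
    ∫ w, (Uᵀ *ᵥ w) i ∂(rotGauss U b v) = b i := by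
  have hU' : Uᵀ * U = 1 := mul_eq_one_comm.1 hU
  have hm : Measurable (fun w : d → ℝ => (Uᵀ *ᵥ w) i) :=
    (measurable_pi_apply i).comp (measurable_mulVec Uᵀ)
  rw [rotGauss, integral_map (measurable_mulVec U).aemeasurable hm.aestronglyMeasurable]
  simp only [Matrix.mulVec_mulVec, hU', Matrix.one_mulVec]
  have h1 := measurePreserving_eval (fun i : d => gaussianReal (b i) (v i)) i
  have h3 : ∫ x : d → ℝ, x i ∂diagGauss b v = ∫ x, x ∂gaussianReal (b i) (v i) := by
    rw [← h1.map_eq, integral_map h1.aemeasurable (by fun_prop)]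
    rfl
  rw [h3, integral_id_gaussianReal]

theorem rotDensity_integrable (hU : U * Uᵀ = 1) (b : d → ℝ) (hv : ∀ i, v i ≠ 0) :
    Integrable (rotDensity U b v) ∧ ∫ w, rotDensity U b v w = 1 := by
  have h1 : ∫⁻ w, ENNReal.ofReal (rotDensity U b v w) = 1 := by
    have := congrArg (fun m : Measure (d → ℝ) => m Set.univ) (rotGauss_eq_withDensity hU b hv)
    simpa using this.symm
  have hm := measurable_rotDensity U b v
  have h0 : ∀ w, 0 ≤ rotDensity U b v w := fun w => (rotDensity_pos hv w).le
  refine ⟨⟨hm.aestronglyMeasurable, ?_⟩, ?_⟩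
  · rw [hasFiniteIntegral_iff_ofReal (ae_of_all _ h0), h1]; simp
  · rw [integral_eq_lintegral_of_nonneg_ae (ae_of_all _ h0) hm.aestronglyMeasurable, h1]; simp

theorem entropy_rotGauss (hU : U * Uᵀ = 1) (b : d → ℝ) (hv : ∀ i, v i ≠ 0) :
    Integrable (entropyDensity (rotGauss U b v)) ∧
      entropy (rotGauss U b v) = ∑ i, (Real.log (2 * Real.pi * v i) + 1) / 2 := by
  obtain ⟨h1, h2⟩ := integral_log_rotDensity hU hv (finiteSecondMoments_rotGauss U b v)
    (covMatrix_rotGauss U b v) (fun i => (integral_rotGauss hU b i).symm)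
  have hac := (isLiouville_rotGauss hU b hv).2
  have hrn : (rotGauss U b v).rnDeriv volume =ᵐ[volume]
      fun w => ENNReal.ofReal (rotDensity U b v w) := by
    rw [rotGauss_eq_withDensity hU b hv]
    exact Measure.rnDeriv_withDensity _ (measurable_rotDensity U b v).ennreal_ofReal
  have hae : entropyDensity (rotGauss U b v) =ᵐ[volume] fun w =>
      -(((rotGauss U b v).rnDeriv volume w).toReal * Real.log (rotDensity U b v w)) := by
    filter_upwards [hrn] with w hw
    rw [entropyDensity, hw, ENNReal.toReal_ofReal (rotDensity_pos hv w).le, Real.negMulLog]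
    ring
  have h3 := (integrable_rnDeriv_smul_iff hac).2 h1
  have h4 := integral_rnDeriv_smul (f := fun w => Real.log (rotDensity U b v w)) hac
  refine ⟨(integrable_congr hae).2 h3.neg, ?_⟩
  rw [entropy, integral_congr_ae hae, integral_neg]
  simp only [smul_eq_mul] at h4
  rw [h4, h2, neg_neg]

/-- Gibbs' inequality is applied with the Gaussian density centred at the mean of `ν`. The resulting
bound does not depend on that mean, so a prescribed covariance matrix suffices. -/
theorem entropy_le_of_covMatrix_eq (hU : U * Uᵀ = 1) (hv : ∀ i, v i ≠ 0)
    {ν : Measure (d → ℝ)} (hν : IsLiouville ν) (hν2 : FiniteSecondMoments ν)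
    (hcov : covMatrix ν = (2 : ℝ) • (U * Matrix.diagonal (fun i => (v i : ℝ)) * Uᵀ))
    (hint : Integrable (entropyDensity ν)) :
    entropy ν ≤ ∑ i, (Real.log (2 * Real.pi * v i) + 1) / 2 ∧
      (∑ i, (Real.log (2 * Real.pi * v i) + 1) / 2 ≤ entropy ν → ∃ b, ν = rotGauss U b v) := by
  have := hν.1
  set b : d → ℝ := fun i => ∫ w, (Uᵀ *ᵥ w) i ∂ν with hb
  obtain ⟨h1, h2⟩ := integral_log_rotDensity (b := b) hU hv hν2 hcov (fun i => rfl)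
  obtain ⟨h3, h4⟩ := rotDensity_integrable hU b hv
  have h5 := entropy_le_neg_integral_log hν hint (fun x => rotDensity_pos hv x) h3 h4 h1
  rw [h2, neg_neg] at h5
  exact ⟨h5.1, fun h => ⟨b, by rw [h5.2 h, rotGauss_eq_withDensity hU b hv]⟩⟩

theorem isValidState_rotGauss {lam : ℝ} {Ω : Matrix d d ℝ} (hU : U * Uᵀ = 1) (b : d → ℝ)
    (hv : ∀ i, v i ≠ 0)
    (h : (uncMatrix lam Ω
      ((2 : ℝ) • (U * Matrix.diagonal (fun i => (v i : ℝ)) * Uᵀ))).PosSemidef) :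
    IsValidState lam Ω (rotGauss U b v) := by
  refine ⟨isLiouville_rotGauss hU b hv, finiteSecondMoments_rotGauss U b v, ?_,
    (entropy_rotGauss hU b hv).1, ?_⟩
  · rw [← covMatrix_rotGauss U b v] at h
    exact h
  · intro ν hν hν2 hcov hint
    rw [(entropy_rotGauss hU b hv).2]
    exact (entropy_le_of_covMatrix_eq hU hv hν hν2
      (hcov.trans (covMatrix_rotGauss U b v)) hint).1

theorem exists_orthogonal_diagonalization {γ : Matrix d d ℝ} (h : γ.PosDef) :
    ∃ (U : Matrix d d ℝ) (v : d → ℝ≥0), U * Uᵀ = 1 ∧ (∀ i, v i ≠ 0) ∧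
      γ = U * Matrix.diagonal (fun i => (v i : ℝ)) * Uᵀ := by
  have hH := h.isHermitian
  refine ⟨hH.eigenvectorUnitary, fun i => ⟨hH.eigenvalues i, (h.eigenvalues_pos i).le⟩, ?_, ?_, ?_⟩
  · have := Unitary.coe_mul_star_self hH.eigenvectorUnitary
    rwa [Unitary.coe_star, Matrix.star_eq_conjTranspose,
      Matrix.conjTranspose_eq_transpose_of_trivial] at this
  · intro i hi
    exact (h.eigenvalues_pos i).ne' (congrArg NNReal.toReal hi)
  · have := hH.spectral_theorem
    rw [Unitary.conjStarAlgAut_apply, Matrix.star_eq_conjTranspose,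
      Matrix.conjTranspose_eq_transpose_of_trivial] at this
    exact this

/-- Valid states are Gaussian. -/
theorem IsValidState.exists_rotGauss {lam : ℝ} (hlam : 0 < lam) {Ω : Matrix d d ℝ}
    (hΩ : ∀ x, Ω *ᵥ x = 0 → x = 0) {μ : Measure (d → ℝ)} (h : IsValidState lam Ω μ) :
    ∃ (U : Matrix d d ℝ) (b : d → ℝ) (v : d → ℝ≥0), U * Uᵀ = 1 ∧ (∀ i, v i ≠ 0) ∧
      μ = rotGauss U b v ∧
      (uncMatrix lam Ω
        ((2 : ℝ) • (U * Matrix.diagonal (fun i => (v i : ℝ)) * Uᵀ))).PosSemidef := by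
  obtain ⟨h1, h2, h3, h4, h5⟩ := h
  have hpd : (covMatrix μ).PosDef := posDef_of_posSemidef_uncMatrix hlam hΩ h3
  have hpd2 : ((1 / 2 : ℝ) • covMatrix μ).PosDef := hpd.smul (by norm_num)
  obtain ⟨U, v, hU, hv, hγ⟩ := exists_orthogonal_diagonalization hpd2
  have hcov : covMatrix μ = (2 : ℝ) • (U * Matrix.diagonal (fun i => (v i : ℝ)) * Uᵀ) := by
    rw [← hγ, smul_smul]; norm_num
  obtain ⟨hi, he⟩ := entropy_rotGauss hU 0 hv
  -- The centred Gaussian with the same covariance matrix is an admissible competitor and already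
  -- attains the upper bound, so `μ` is in the case of equality.
  have hle := h5 (rotGauss U 0 v) (isLiouville_rotGauss hU 0 hv)
    (finiteSecondMoments_rotGauss U 0 v) ((covMatrix_rotGauss U 0 v).trans hcov.symm) hi
  rw [he] at hle
  obtain ⟨b, hb⟩ := (entropy_le_of_covMatrix_eq hU hv h1 h2 hcov h4).2 hle
  exact ⟨U, b, v, hU, hv, hb, hcov ▸ h3⟩

/-- The uncertainty principle for a nondegenerate form makes `T * Tᵀ` positive definite. Hence the
Gaussian has a density whatever the shape of `T`, and the diagonalized form applies. -/
theorem isValidState_gauss {e : Type} [Fintype e] {lam : ℝ} (hlam : 0 < lam) {Ω : Matrix d d ℝ}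
    (hΩ : ∀ x, Ω *ᵥ x = 0 → x = 0) {T : Matrix d e ℝ} (b : d → ℝ)
    (h : (uncMatrix lam Ω ((2 : ℝ) • (T * Tᵀ))).PosSemidef) : IsValidState lam Ω (gauss T b) := by
  have hpd : (T * Tᵀ).PosDef := by
    have := (posDef_of_posSemidef_uncMatrix hlam hΩ h).smul (show (0 : ℝ) < 1 / 2 by norm_num)
    rw [smul_smul] at this
    norm_num at this
    exact this
  obtain ⟨U, v, hU, hv, hγ⟩ := exists_orthogonal_diagonalization hpd
  have heq : gauss T b = rotGauss U (Uᵀ *ᵥ b) v := by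
    rw [rotGauss_eq_gauss, Matrix.mulVec_mulVec, hU, Matrix.one_mulVec]
    exact gauss_congr (by rw [sqrt_cov_mul_transpose, hγ]) b
  rw [heq]
  exact isValidState_rotGauss hU _ hv (hγ ▸ h)

end MaximalEntropy

end ERL
end

noncomputable section

namespace ERL

/-! ### Choi states and almost everywhere classes of kernels -/

section Kernels

open Matrix

variable {n : ℕ}

theorem measurable_momentumFlip : Measurable (momentumFlip : Phase n → Phase n) := by
  have : (momentumFlip : Phase n → Phase n) = fun z => flipMatrix n *ᵥ z := by
    ext z : 1; rw [flipMatrix_mulVec]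
  rw [this]; exact measurable_mulVec _

theorem momentumFlip_momentumFlip (z : Phase n) : momentumFlip (momentumFlip z) = z := by
  ext i; rcases i with i | i <;> simp [momentumFlip]

theorem measurePreserving_momentumFlip :
    MeasurePreserving (momentumFlip : Phase n → Phase n) := by
  have h : (momentumFlip : Phase n → Phase n) = fun z => flipMatrix n *ᵥ z := by
    ext z : 1; rw [flipMatrix_mulVec]
  rw [h]
  exact measurePreserving_orthogonal (by rw [flipMatrix_transpose, flipMatrix_mul_self])

theorem measurable_sumElim {a b : Type} :
    Measurable (fun p : (a → ℝ) × (b → ℝ) => (Sum.elim p.1 p.2 : a ⊕ b → ℝ)) := by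
  refine measurable_pi_lambda _ fun i => ?_
  rcases i with i | i
  · exact (measurable_pi_apply i).comp measurable_fst
  · exact (measurable_pi_apply i).comp measurable_snd

theorem measurable_sumSplit {a b : Type} :
    Measurable (fun w : a ⊕ b → ℝ => ((fun i => w (Sum.inl i)), (fun i => w (Sum.inr i)))) :=
  (measurable_pi_lambda _ fun _ => measurable_pi_apply _).prodMk
    (measurable_pi_lambda _ fun _ => measurable_pi_apply _)

theorem map_joint {k : ℕ} (μ : Measure (Phase n × Phase k)) :
    (joint μ).map (fun w => ((fun i => w (Sum.inl i)), (fun i => w (Sum.inr i)))) = μ := by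
  rw [joint, Measure.map_map measurable_sumSplit measurable_sumElim]
  exact Measure.map_id

theorem transferLeft_apply {k : ℕ} (η : Kernel (Phase n) (Phase n)) [IsMarkovKernel η]
    (μ : Measure (Phase n × Phase k)) {s : Set (Phase n × Phase k)} (hs : MeasurableSet s) :
    transferLeft η μ s = ∫⁻ p, η p.1 {x | (x, p.2) ∈ s} ∂μ := by
  rw [transferLeft, Measure.bind_apply hs (Kernel.aemeasurable _)]
  refine lintegral_congr fun p => ?_
  rw [Kernel.parallelComp_apply, Kernel.id_apply, Measure.prod_dirac,
    Measure.map_apply (by fun_prop) hs]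
  rfl

/-- This form makes the Choi state a disintegration problem: the kernel is the conditional law of
the `A`-variables given the flipped `B`-variables. -/
theorem choiState_eq (η : Kernel (Phase n) (Phase n)) [IsMarkovKernel η] :
    choiState η = ((volume : Measure (Phase n)) ⊗ₘ η).map (fun p => (p.2, momentumFlip p.1)) := by
  have hF := measurable_momentumFlip (n := n)
  have hm : Measurable (fun p : Phase n × Phase n => (p.2, momentumFlip p.1)) :=
    measurable_snd.prodMk (hF.comp measurable_fst)
  have hg : Measurable (fun z : Phase n => (z, momentumFlip z)) := measurable_id.prodMk hF
  ext s hs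
  rw [choiState, transferLeft_apply _ _ hs, Measure.map_apply hm hs,
    Measure.compProd_apply (hm hs), corrState, lintegral_map _ hg]
  · rfl
  · have := Kernel.measurable_coe (Kernel.parallelComp η (Kernel.id : Kernel (Phase n) (Phase n))) hs
    convert this using 2 with p
    rw [Kernel.parallelComp_apply, Kernel.id_apply, Measure.prod_dirac,
      Measure.map_apply (by fun_prop) hs]
    rfl

theorem choiState_map_snd (η : Kernel (Phase n) (Phase n)) [IsMarkovKernel η] :
    (choiState η).map Prod.snd = volume := by
  have hF := measurable_momentumFlip (n := n)
  have hm : Measurable (fun p : Phase n × Phase n => (p.2, momentumFlip p.1)) :=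
    measurable_snd.prodMk (hF.comp measurable_fst)
  rw [choiState_eq, Measure.map_map measurable_snd hm]
  have : (Prod.snd ∘ fun p : Phase n × Phase n => (p.2, momentumFlip p.1)) =
    momentumFlip ∘ Prod.fst := rfl
  rw [this, ← Measure.map_map hF measurable_fst]
  change Measure.map momentumFlip (Measure.fst _) = _
  rw [Measure.fst_compProd, measurePreserving_momentumFlip.map_eq]

/-- Over each set of finite volume the hypothesis says that the two composition-products agree on
rectangles, and disintegrations of a finite measure are almost everywhere unique. -/
theorem ae_eq_of_forall_setLIntegral_eq {η η' : Kernel (Phase n) (Phase n)} [IsMarkovKernel η]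
    [IsMarkovKernel η']
    (h : ∀ A T : Set (Phase n), MeasurableSet A → MeasurableSet T → volume A < ⊤ →
      ∫⁻ z in A, η z T = ∫⁻ z in A, η' z T) : ⇑η =ᵐ[volume] ⇑η' := by
  refine ae_of_forall_measure_lt_top_ae_restrict _ fun s hs hlt => ?_
  have : IsFiniteMeasure (volume.restrict s) := ⟨by simpa using hlt⟩
  refine Kernel.compProd_eq_iff.1 (Measure.ext_prod fun {A T} hA hT => ?_)
  rw [Measure.compProd_apply_prod hA hT, Measure.compProd_apply_prod hA hT,
    Measure.restrict_restrict hA]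
  exact h _ _ (hA.inter hs) hT ((measure_mono Set.inter_subset_right).trans_lt hlt)

/-- Uniform distributions on sets of finite positive volume are Liouville distributions and recover
the integrals of `η z T`. Conversely, densities do not see null sets. -/
theorem sameTransfer_iff_ae_eq {η η' : Kernel (Phase n) (Phase n)} [IsMarkovKernel η]
    [IsMarkovKernel η'] : SameTransfer η η' ↔ ⇑η =ᵐ[volume] ⇑η' := by
  constructor
  · intro h
    refine ae_eq_of_forall_setLIntegral_eq fun A T hA hT hlt => ?_
    rcases eq_or_ne (volume A) 0 with h0 | h0
    · rw [Measure.restrict_eq_zero.2 h0]; simp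
    have hprob : IsProbabilityMeasure (cond (volume : Measure (Phase n)) A) :=
      cond_isProbabilityMeasure_of_finite h0 hlt.ne
    have := congrArg (fun m : Measure (Phase n) => m T)
      (h (cond volume A) ⟨hprob, cond_absolutelyContinuous⟩)
    simp only [transfer] at this
    rw [Measure.bind_apply hT (Kernel.aemeasurable _), Measure.bind_apply hT (Kernel.aemeasurable _),
      ProbabilityTheory.cond, lintegral_smul_measure, lintegral_smul_measure, smul_eq_mul, smul_eq_mul] at this
    refine (ENNReal.mul_right_inj ?_ ?_).1 this
    · exact ENNReal.inv_ne_zero.2 hlt.ne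
    · exact ENNReal.inv_ne_top.2 h0
  · intro h μ hμ
    exact Measure.bind_congr_right (hμ.2.ae_le h)

/-- The Choi state gives the rectangle `T ×ˢ momentumFlip ⁻¹' A` the mass `∫⁻ z in A, η z T`. -/
theorem choiState_eq_iff_ae_eq {η η' : Kernel (Phase n) (Phase n)} [IsMarkovKernel η]
    [IsMarkovKernel η'] : choiState η = choiState η' ↔ ⇑η =ᵐ[volume] ⇑η' := by
  have hF := measurable_momentumFlip (n := n)
  have hm : Measurable (fun p : Phase n × Phase n => (p.2, momentumFlip p.1)) :=
    measurable_snd.prodMk (hF.comp measurable_fst)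
  constructor
  · intro h
    have key : ∀ (κ : Kernel (Phase n) (Phase n)) [IsMarkovKernel κ] (A T : Set (Phase n)),
        MeasurableSet A → MeasurableSet T →
        ∫⁻ z in A, κ z T = choiState κ (T ×ˢ (momentumFlip ⁻¹' A)) := by
      intro κ _ A T hA hT
      rw [choiState_eq, Measure.map_apply hm (hT.prod (hF hA)),
        ← Measure.compProd_apply_prod hA hT]
      congr 1
      ext p
      simp [momentumFlip_momentumFlip, and_comm]
    refine ae_eq_of_forall_setLIntegral_eq fun A T hA hT _ => ?_
    rw [key η A T hA hT, key η' A T hA hT, h]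
  · intro h
    rw [choiState_eq, choiState_eq, Measure.compProd_congr h]

theorem absolutelyContinuous_map_fst {k : ℕ} {μ : Measure (Phase n × Phase k)}
    (h : joint μ ≪ volume) : μ.map Prod.fst ≪ volume := by
  have h1 : μ.map Prod.fst = (joint μ).map (Prod.fst ∘ fun w : Coord n ⊕ Coord k → ℝ =>
      ((fun i => w (Sum.inl i)), (fun i => w (Sum.inr i)))) := by
    conv_lhs => rw [← map_joint μ]
    rw [Measure.map_map measurable_fst measurable_sumSplit]
  have h2 : MeasurePreserving (fun w : Coord n ⊕ Coord k → ℝ =>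
      ((fun i => w (Sum.inl i)), (fun i => w (Sum.inr i)))) volume volume :=
    volume_measurePreserving_sumPiEquivProdPi (fun _ : Coord n ⊕ Coord k => ℝ)
  rw [h1]
  refine (h.map (measurable_fst.comp measurable_sumSplit)).trans ?_
  exact (Measure.quasiMeasurePreserving_fst.comp h2.quasiMeasurePreserving).2

theorem transferLeft_congr {k : ℕ} {η η' : Kernel (Phase n) (Phase n)} [IsMarkovKernel η]
    [IsMarkovKernel η'] (h : ⇑η =ᵐ[volume] ⇑η') {μ : Measure (Phase n × Phase k)}
    (hμ : joint μ ≪ volume) : transferLeft η μ = transferLeft η' μ := by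
  refine Measure.bind_congr_right ?_
  have h2 := ae_of_ae_map measurable_fst.aemeasurable
    ((absolutelyContinuous_map_fst hμ).ae_le h)
  filter_upwards [h2] with p hp
  rw [Kernel.parallelComp_apply, Kernel.parallelComp_apply, hp]

/-- Both conditions test the kernel only on inputs with densities, whose `A`-marginals are
absolutely continuous. Validity is therefore a property of the transfer functional. -/
theorem IsValidTransformation.congr {lam : ℝ} {η η' : Kernel (Phase n) (Phase n)}
    [IsMarkovKernel η] [IsMarkovKernel η'] (h : ⇑η =ᵐ[volume] ⇑η')
    (hη : IsValidTransformation lam η) : IsValidTransformation lam η' := by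
  refine ⟨fun k μ hμ => ?_, ?_⟩
  · rw [← transferLeft_congr h hμ.1.2]
    exact hη.1 k μ hμ
  · obtain ⟨m, ν, S, a, h1, h2, h3⟩ := hη.2
    exact ⟨m, ν, S, a, h1, h2, fun μ hμ => by
      rw [← h3 μ hμ, sameTransfer_iff_ae_eq.2 h μ hμ]⟩

/-! ### Gaussian channels: supervenience and complete validity-preservation -/

/-- The transition probabilities `z ↦ X z + w`, with noise `w` distributed according to `N`. -/
def noiseChannel (X : Matrix (Coord n) (Coord n) ℝ) (N : Measure (Phase n)) :
    Kernel (Phase n) (Phase n) :=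
  (Kernel.id ×ₖ Kernel.const (Phase n) N).map (fun p => X *ᵥ p.1 + p.2)

theorem measurable_mulVec_fst_add (X : Matrix (Coord n) (Coord n) ℝ) :
    Measurable (fun p : Phase n × Phase n => X *ᵥ p.1 + p.2) := by
  have : Continuous (fun p : Phase n × Phase n => X *ᵥ p.1 + p.2) := by fun_prop
  exact this.measurable

instance (X : Matrix (Coord n) (Coord n) ℝ) (N : Measure (Phase n)) [IsProbabilityMeasure N] :
    IsMarkovKernel (noiseChannel X N) :=
  Kernel.IsMarkovKernel.map _ (measurable_mulVec_fst_add X)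

theorem noiseChannel_apply (X : Matrix (Coord n) (Coord n) ℝ) (N : Measure (Phase n))
    [IsProbabilityMeasure N] (z : Phase n) :
    noiseChannel X N z = N.map (fun w => X *ᵥ z + w) := by
  rw [noiseChannel, Kernel.map_apply _ (measurable_mulVec_fst_add X), Kernel.prod_apply,
    Kernel.id_apply, Kernel.const_apply, Measure.dirac_prod,
    Measure.map_map (measurable_mulVec_fst_add X) (by fun_prop)]
  rfl

theorem transfer_noiseChannel (X : Matrix (Coord n) (Coord n) ℝ) (N : Measure (Phase n))
    [IsProbabilityMeasure N] (μ : Measure (Phase n)) [SFinite μ] :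
    transfer (noiseChannel X N) μ = (μ.prod N).map (fun p => X *ᵥ p.1 + p.2) := by
  rw [transfer, noiseChannel, ← Measure.map_comp _ _ (measurable_mulVec_fst_add X),
    ← Measure.compProd_eq_comp_prod, Measure.compProd_const]

theorem joint_transferLeft_noiseChannel {k : ℕ} (X : Matrix (Coord n) (Coord n) ℝ)
    (N : Measure (Phase n)) [IsProbabilityMeasure N] (μ : Measure (Phase n × Phase k)) [SFinite μ] :
    joint (transferLeft (noiseChannel X N) μ) = ((joint μ).prod N).map (fun p =>
      Matrix.fromBlocks X 0 0 1 *ᵥ p.1 +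
        Matrix.fromRows 1 (0 : Matrix (Coord k) (Coord n) ℝ) *ᵥ p.2) := by
  have hc : Continuous (fun p : (Coord n ⊕ Coord k → ℝ) × Phase n =>
      Matrix.fromBlocks X 0 0 1 *ᵥ p.1 +
        Matrix.fromRows 1 (0 : Matrix (Coord k) (Coord n) ℝ) *ᵥ p.2) := by fun_prop
  have hsf : SFinite (joint μ) := by unfold joint; infer_instance
  have hpm : Measurable (Prod.map (fun p : Phase n × Phase k => Sum.elim p.1 p.2)
    (id : Phase n → Phase n)) := measurable_sumElim.prodMap measurable_id
  have hprod : (joint μ).prod N = (μ.prod N).map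
      (Prod.map (fun p : Phase n × Phase k => Sum.elim p.1 p.2) id) := by
    rw [← Measure.map_prod_map _ _ measurable_sumElim measurable_id, Measure.map_id]; rfl
  rw [hprod, Measure.map_map hc.measurable hpm]
  ext s hs
  rw [joint, Measure.map_apply measurable_sumElim hs,
    transferLeft_apply _ _ (measurable_sumElim hs),
    Measure.map_apply (hc.measurable.comp hpm) hs,
    Measure.prod_apply (hc.measurable.comp hpm hs)]
  refine lintegral_congr fun p => ?_
  have hms : MeasurableSet {x : Phase n | (x, p.2) ∈
      (fun q : Phase n × Phase k => Sum.elim q.1 q.2) ⁻¹' s} :=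
    (measurable_id.prodMk measurable_const) (measurable_sumElim hs)
  rw [noiseChannel_apply, Measure.map_apply (by fun_prop) hms]
  congr 1
  ext w
  simp [Matrix.fromBlocks_mulVec, Matrix.fromRows_mulVec, Function.comp_def]
  have : (Sum.elim (X *ᵥ p.1 + w) p.2 : Coord n ⊕ Coord k → ℝ) =
      Sum.elim (X *ᵥ p.1) p.2 + Sum.elim w 0 := by
    ext i; rcases i with i | i <;> simp
  rw [this]

/-- The image of two independent Gaussian vectors under an affine map is Gaussian. -/
theorem gauss_prod_map {a b c e f : Type} [Fintype a] [Fintype b] [Fintype c] [Fintype e]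
    [Fintype f] (T : Matrix a e ℝ) (s : a → ℝ) (R : Matrix b f ℝ) (t : b → ℝ)
    (M : Matrix c a ℝ) (K : Matrix c b ℝ) (r : c → ℝ) :
    ((gauss T s).prod (gauss R t)).map (fun p => M *ᵥ p.1 + K *ᵥ p.2 + r) =
      gauss (Matrix.fromCols (M * T) (K * R)) (M *ᵥ s + K *ᵥ t + r) := by
  have hc : Continuous (fun p : (a → ℝ) × (b → ℝ) => M *ᵥ p.1 + K *ᵥ p.2 + r) := by fun_prop
  have hstd : (std e).prod (std f) = (std (e ⊕ f)).map
      (fun w => ((fun i => w (Sum.inl i)), (fun i => w (Sum.inr i)))) :=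
    (measurePreserving_sumPiEquivProdPi (fun _ : e ⊕ f => gaussianReal 0 1)).map_eq.symm
  have hpm : Measurable (Prod.map (fun y : e → ℝ => T *ᵥ y + s) (fun y : f → ℝ => R *ᵥ y + t)) :=
    (measurable_mulVec_add T s).prodMap (measurable_mulVec_add R t)
  rw [gauss, gauss, Measure.map_prod_map _ _ (measurable_mulVec_add T s)
    (measurable_mulVec_add R t), Measure.map_map hc.measurable hpm, hstd,
    Measure.map_map (hc.measurable.comp hpm) measurable_sumSplit, gauss]
  congr 1
  ext w : 1
  simp only [Function.comp, Prod.map, Matrix.fromCols_mulVec, Matrix.mulVec_add,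
    Matrix.mulVec_mulVec]
  change (M * T) *ᵥ (fun i => w (Sum.inl i)) + M *ᵥ s +
    ((K * R) *ᵥ (fun i => w (Sum.inr i)) + K *ᵥ t) + r =
    (M * T) *ᵥ (fun i => w (Sum.inl i)) + (K * R) *ᵥ (fun i => w (Sum.inr i)) + _
  abel

theorem gauss_map_affine {a c e : Type} [Fintype a] [Fintype c] [Fintype e] (T : Matrix a e ℝ)
    (s : a → ℝ) (M : Matrix c a ℝ) (r : c → ℝ) :
    (gauss T s).map (fun x => M *ᵥ x + r) = gauss (M * T) (M *ᵥ s + r) := by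
  rw [gauss, Measure.map_map (measurable_mulVec_add M r) (measurable_mulVec_add T s), gauss]
  congr 1
  ext y : 1
  simp only [Function.comp, Matrix.mulVec_add, Matrix.mulVec_mulVec]
  abel

/-- The noise `N` is Gaussian, and strong enough for `X` to be compatible with the uncertainty
principle. -/
def IsAdmissibleNoise (lam : ℝ) (X : Matrix (Coord n) (Coord n) ℝ) (N : Measure (Phase n)) :
    Prop :=
  ∃ (e : Type) (_ : Fintype e) (R : Matrix (Coord n) e ℝ) (c : Phase n), N = gauss R c ∧
    (uncMatrix lam (form n - X * form n * Xᵀ) ((2 : ℝ) • (R * Rᵀ))).PosSemidef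

theorem IsAdmissibleNoise.isProbabilityMeasure {lam : ℝ} {X : Matrix (Coord n) (Coord n) ℝ}
    {N : Measure (Phase n)} (h : IsAdmissibleNoise lam X N) : IsProbabilityMeasure N := by
  obtain ⟨e, _, R, c, rfl, -⟩ := h
  infer_instance

theorem affineEvolution_fst {m : ℕ} (S : Matrix (Coord n ⊕ Coord m) (Coord n ⊕ Coord m) ℝ)
    (a : Coord n ⊕ Coord m → ℝ) (p : Phase n × Phase m) :
    (affineEvolution S a p).1 =
      S.toBlocks₁₁ *ᵥ p.1 + (S.toBlocks₁₂ *ᵥ p.2 + fun i => a (Sum.inl i)) := by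
  ext i
  simp [affineEvolution, Matrix.mulVec, dotProduct, Matrix.toBlocks₁₁, Matrix.toBlocks₁₂, add_assoc]

theorem measurable_affineEvolution {m : ℕ}
    (S : Matrix (Coord n ⊕ Coord m) (Coord n ⊕ Coord m) ℝ) (a : Coord n ⊕ Coord m → ℝ) :
    Measurable (affineEvolution S a) :=
  measurable_sumSplit.comp ((measurable_mulVec_add S a).comp measurable_sumElim)

/-- Only the upper block row of `S` affects the marginal on `A`, and the ancilla enters it as
independent additive noise. -/
theorem map_affineEvolution_fst {m : ℕ}
    (S : Matrix (Coord n ⊕ Coord m) (Coord n ⊕ Coord m) ℝ) (a : Coord n ⊕ Coord m → ℝ)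
    (μ : Measure (Phase n)) [SFinite μ] (ν : Measure (Phase m)) [IsProbabilityMeasure ν] :
    ((μ.prod ν).map (affineEvolution S a)).map Prod.fst =
      transfer (noiseChannel S.toBlocks₁₁
        (ν.map (fun w => S.toBlocks₁₂ *ᵥ w + fun i => a (Sum.inl i)))) μ := by
  have hm := measurable_mulVec_add S.toBlocks₁₂ (fun i => a (Sum.inl i))
  have : IsProbabilityMeasure (ν.map (fun w => S.toBlocks₁₂ *ᵥ w + fun i => a (Sum.inl i))) :=
    Measure.isProbabilityMeasure_map hm.aemeasurable
  rw [transfer_noiseChannel, Measure.map_map measurable_fst (measurable_affineEvolution S a)]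
  have h2 : μ.prod (ν.map (fun w => S.toBlocks₁₂ *ᵥ w + fun i => a (Sum.inl i))) =
      (μ.prod ν).map (Prod.map id (fun w => S.toBlocks₁₂ *ᵥ w + fun i => a (Sum.inl i))) := by
    rw [← Measure.map_prod_map _ _ measurable_id hm, Measure.map_id]
  rw [h2, Measure.map_map (measurable_mulVec_fst_add _) (measurable_id.prodMap hm)]
  congr 1
  ext p : 1
  exact affineEvolution_fst S a p

/-- Ontic supervenience forces a transformation to be a Gaussian channel with admissible noise. -/
theorem OnticSupervenience.exists_noiseChannel {lam : ℝ} (hlam : 0 < lam)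
    {η : Kernel (Phase n) (Phase n)} [IsMarkovKernel η] (h : OnticSupervenience lam η) :
    ∃ (X : Matrix (Coord n) (Coord n) ℝ) (N : Measure (Phase n)), IsAdmissibleNoise lam X N ∧
      ⇑η =ᵐ[volume] ⇑(noiseChannel X N) := by
  obtain ⟨m, ν, S, a, hν, hS, hη⟩ := h
  have := hν.1.1
  obtain ⟨U, b, v, -, -, rfl, hpsd⟩ := hν.exists_rotGauss hlam
    (eq_zero_of_mulVec_eq_zero_of_sq (form_mul_form m))
  set N := (rotGauss U b v).map (fun w => S.toBlocks₁₂ *ᵥ w + fun i => a (Sum.inl i)) with hN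
  have hprob : IsProbabilityMeasure N :=
    Measure.isProbabilityMeasure_map (measurable_mulVec_add _ _).aemeasurable
  refine ⟨S.toBlocks₁₁, N, ⟨Coord m, inferInstance,
    S.toBlocks₁₂ * (U * Matrix.diagonal fun i => √(v i : ℝ)),
    S.toBlocks₁₂ *ᵥ (U *ᵥ b) + fun i => a (Sum.inl i), ?_, ?_⟩, ?_⟩
  · rw [hN, rotGauss_eq_gauss, gauss_map_affine]
  · have h1 := posSemidef_uncMatrix_conj hpsd S.toBlocks₁₂
    -- The system block of the symplectic condition: the form missing from `X Ω Xᵀ` is the one the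
    -- ancilla transports through its coupling to `A`. The ancilla's uncertainty principle under
    -- that coupling is then admissibility.
    have h2 : S.toBlocks₁₁ * form n * S.toBlocks₁₁ᵀ + S.toBlocks₁₂ * form m * S.toBlocks₁₂ᵀ =
        form n := by
      have := congrArg Matrix.toBlocks₁₁ hS
      rw [← Matrix.fromBlocks_toBlocks S, jointForm, Matrix.fromBlocks_transpose,
        Matrix.fromBlocks_multiply, Matrix.fromBlocks_multiply, Matrix.toBlocks_fromBlocks₁₁,
        Matrix.toBlocks_fromBlocks₁₁] at this
      simpa using this
    have h3 : form n - S.toBlocks₁₁ * form n * S.toBlocks₁₁ᵀ =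
        S.toBlocks₁₂ * form m * S.toBlocks₁₂ᵀ := sub_eq_of_eq_add' h2.symm
    rw [h3]
    convert h1 using 2
    rw [Matrix.transpose_mul, Matrix.mul_assoc, ← Matrix.mul_assoc (U * _), sqrt_cov_mul_transpose]
    simp [Matrix.mul_assoc]
  · refine sameTransfer_iff_ae_eq.1 fun μ hμ => ?_
    have := hμ.1
    rw [hη μ hμ, map_affineEvolution_fst]

theorem onticSupervenience_noiseChannel {lam : ℝ} (hlam : 0 < lam)
    {X : Matrix (Coord n) (Coord n) ℝ} {N : Measure (Phase n)} (h : IsAdmissibleNoise lam X N) :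
    OnticSupervenience lam (noiseChannel X N) := by
  obtain ⟨e, _, R, c, rfl, hpsd⟩ := h
  obtain ⟨m, S, hS, hX, hY⟩ := exists_symplectic_dilation hlam hpsd
  have hs : √(lam / 2) * √(lam / 2) = lam / 2 := Real.mul_self_sqrt (by positivity)
  -- The ancilla is in the state of covariance matrix `λ 1`; the standard deviation is `√(λ/2)`
  -- because of the factor `2` in `covMatrix`. The mean of the noise is supplied by the displacement
  -- of `A`.
  refine ⟨m, gauss (√(lam / 2) • (1 : Matrix (Coord m) (Coord m) ℝ)) 0, S,
    Sum.elim c 0, isValidState_gauss hlam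
      (eq_zero_of_mulVec_eq_zero_of_sq (form_mul_form m)) 0 ?_, hS, fun μ hμ => ?_⟩
  · convert posSemidef_uncMatrix_vacuum hlam.le (form_mul_form m) (form_transpose m) using 2
    rw [Matrix.transpose_smul, Matrix.smul_mul, Matrix.mul_smul, smul_smul, smul_smul,
      mul_assoc, hs, mul_div_cancel₀ lam two_ne_zero, Matrix.transpose_one, Matrix.one_mul]
  · have := hμ.1
    rw [map_affineEvolution_fst, gauss_map_affine, hX]
    have hN : gauss R c = gauss (S.toBlocks₁₂ * (√(lam / 2) • (1 : Matrix (Coord m) (Coord m) ℝ)))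
        (S.toBlocks₁₂ *ᵥ 0 + fun i => Sum.elim c (0 : Phase m) (Sum.inl i)) := by
      have hc : (S.toBlocks₁₂ *ᵥ (0 : Phase m) + fun i => Sum.elim c (0 : Phase m) (Sum.inl i)) = c := by
        simp
      rw [hc]
      refine gauss_congr ?_ c
      have h2 : R * Rᵀ = (1 / 2 : ℝ) • ((2 : ℝ) • (R * Rᵀ)) := by rw [smul_smul]; norm_num
      rw [h2, ← hY]
      simp only [Matrix.mul_smul, Matrix.mul_one, Matrix.transpose_smul, Matrix.smul_mul,
        smul_smul, hs]
      congr 1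
      ring
    rw [hN]

/-- The output covariance is that of the input transported by `X ⊕ 1`, plus the noise on `A`. Adding
the two uncertainty relations, the forms combine as `X Ω Xᵀ + (Ω - X Ω Xᵀ) = Ω` on `A`, while `B` is
untouched. -/
theorem isCVP_noiseChannel {lam : ℝ} (hlam : 0 < lam)
    {X : Matrix (Coord n) (Coord n) ℝ} {N : Measure (Phase n)} (h : IsAdmissibleNoise lam X N) :
    IsCVP lam (noiseChannel X N) := by
  obtain ⟨e, _, R, c, rfl, hpsd⟩ := h
  intro k μ hμ
  have hΩ := eq_zero_of_mulVec_eq_zero_of_sq (jointForm_mul_jointForm n k)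
  have hμp : IsProbabilityMeasure μ := by
    have := hμ.1.1
    rw [← map_joint μ]
    exact Measure.isProbabilityMeasure_map measurable_sumSplit.aemeasurable
  obtain ⟨U, b, v, -, -, hrot, hpsd'⟩ := hμ.exists_rotGauss hlam hΩ
  rw [joint_transferLeft_noiseChannel, hrot, rotGauss_eq_gauss]
  have hmap := gauss_prod_map (U * Matrix.diagonal fun i => √(v i : ℝ)) (U *ᵥ b) R c
    (Matrix.fromBlocks X 0 0 (1 : Matrix (Coord k) (Coord k) ℝ))
    (Matrix.fromRows 1 (0 : Matrix (Coord k) (Coord n) ℝ)) 0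
  simp only [add_zero] at hmap
  rw [hmap]
  refine isValidState_gauss hlam hΩ _ ?_
  have h1 := posSemidef_uncMatrix_add (posSemidef_uncMatrix_conj hpsd'
      (Matrix.fromBlocks X 0 0 (1 : Matrix (Coord k) (Coord k) ℝ)))
    (posSemidef_uncMatrix_conj hpsd (Matrix.fromRows 1 (0 : Matrix (Coord k) (Coord n) ℝ)))
  convert h1 using 2
  · rw [jointForm, Matrix.fromBlocks_transpose, Matrix.fromBlocks_multiply,
      Matrix.fromBlocks_multiply, Matrix.transpose_fromRows, Matrix.fromRows_mul,
      Matrix.fromRows_mul_fromCols, Matrix.fromBlocks_add]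
    simp
  · rw [Matrix.transpose_fromCols, Matrix.fromCols_mul_fromRows, Matrix.transpose_mul,
      Matrix.transpose_mul (Matrix.fromRows _ _), Matrix.mul_assoc, ← Matrix.mul_assoc (U * _),
      sqrt_cov_mul_transpose]
    simp only [Matrix.mul_smul, Matrix.smul_mul, smul_add, Matrix.mul_assoc]

theorem isValidTransformation_noiseChannel {lam : ℝ} (hlam : 0 < lam)
    {X : Matrix (Coord n) (Coord n) ℝ} {N : Measure (Phase n)} (h : IsAdmissibleNoise lam X N) :
    IsValidTransformation lam (noiseChannel X N) :=
  ⟨isCVP_noiseChannel hlam h, onticSupervenience_noiseChannel hlam h⟩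

/-- Invariance of Lebesgue measure under momentum inversion allows the `B`-variable to be used as
the parameter. -/
theorem choiState_noiseChannel (X : Matrix (Coord n) (Coord n) ℝ) (N : Measure (Phase n))
    [IsProbabilityMeasure N] :
    choiState (noiseChannel X N) = ((volume : Measure (Phase n)).prod N).map
      (fun p => (X *ᵥ momentumFlip p.1 + p.2, p.1)) := by
  have hF := measurable_momentumFlip (n := n)
  have hm : Measurable (fun p : Phase n × Phase n => (p.2, momentumFlip p.1)) :=
    measurable_snd.prodMk (hF.comp measurable_fst)
  have hm2 : Measurable (fun p : Phase n × Phase n => (X *ᵥ momentumFlip p.1 + p.2, p.1)) :=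
    ((measurable_mulVec_fst_add X).comp ((hF.comp measurable_fst).prodMk measurable_snd)).prodMk
      measurable_fst
  ext s hs
  rw [choiState_eq, Measure.map_apply hm hs, Measure.compProd_apply (hm hs),
    Measure.map_apply hm2 hs, Measure.prod_apply (hm2 hs),
    ← measurePreserving_momentumFlip.lintegral_comp (measurable_measure_prodMk_left (hm2 hs))]
  refine lintegral_congr fun z => ?_
  rw [noiseChannel_apply, Measure.map_apply (by fun_prop) (measurable_prodMk_left (hm hs))]
  congr 1
  ext w
  simp [momentumFlip_momentumFlip]

end Kernels

end ERL
end

noncomputable section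

namespace ERL

/-! ### Valid Gaussian approximations of the correlated state -/

section CorrelatedApproximation

open Matrix
open scoped NNReal

variable {n : ℕ}

/-- A cylinder over a ball in the `B`-variables is a neighbourhood whose mass is the volume of that
ball. -/
theorem isLocallyFiniteMeasure_joint {m : Measure (Phase n × Phase n)}
    (hm : m.map Prod.snd = volume) : IsLocallyFiniteMeasure (joint m) := by
  refine ⟨fun w => ⟨(fun w' : Coord n ⊕ Coord n → ℝ => fun i => w' (Sum.inr i)) ⁻¹'
    Metric.ball (fun i => w (Sum.inr i)) 1, ?_, ?_⟩⟩
  · have hc : Continuous (fun w' : Coord n ⊕ Coord n → ℝ => fun i => w' (Sum.inr i)) := by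
      fun_prop
    exact hc.continuousAt.preimage_mem_nhds (Metric.ball_mem_nhds _ one_pos)
  · have hme : Measurable (fun w' : Coord n ⊕ Coord n → ℝ => fun i => w' (Sum.inr i)) :=
      measurable_snd.comp measurable_sumSplit
    have : (joint m) ((fun w' : Coord n ⊕ Coord n → ℝ => fun i => w' (Sum.inr i)) ⁻¹'
        Metric.ball (fun i => w (Sum.inr i)) 1) =
        volume (Metric.ball (fun i => w (Sum.inr i)) 1) := by
      rw [joint, Measure.map_apply measurable_sumElim (hme measurableSet_ball), ← hm,
        Measure.map_apply measurable_snd measurableSet_ball]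
      rfl
    rw [this]
    exact measure_ball_lt_top

theorem joint_ne_zero {m : Measure (Phase n × Phase n)} (hm : m.map Prod.snd = volume) :
    joint m ≠ 0 := by
  intro h
  have h1 : m = 0 := by rw [← map_joint m, h, Measure.map_zero]
  rw [h1, Measure.map_zero] at hm
  exact NeZero.ne (volume : Measure (Phase n)) hm.symm

theorem fromRows_mul_mul_transpose {a b c : Type} [Fintype c] (A : Matrix a c ℝ)
    (B : Matrix b c ℝ) (M : Matrix c c ℝ) :
    Matrix.fromRows A B * M * (Matrix.fromRows A B)ᵀ =
      Matrix.fromBlocks (A * M * Aᵀ) (A * M * Bᵀ) (B * M * Aᵀ) (B * M * Bᵀ) := by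
  rw [Matrix.transpose_fromRows, Matrix.fromRows_mul, Matrix.fromRows_mul_fromCols]

theorem fromRows_mul_transpose {a b c : Type} [Fintype c] (A : Matrix a c ℝ)
    (B : Matrix b c ℝ) :
    Matrix.fromRows A B * (Matrix.fromRows A B)ᵀ =
      Matrix.fromBlocks (A * Aᵀ) (A * Bᵀ) (B * Aᵀ) (B * Bᵀ) := by
  rw [Matrix.transpose_fromRows, Matrix.fromRows_mul_fromCols]

/-- The uncertainty principle for the Gaussian approximations of the perfectly correlated state. -/
theorem posSemidef_uncMatrix_correlated {lam : ℝ} (hlam : 0 < lam) {r : ℝ} (hr : 0 < r) :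
    (uncMatrix lam (jointForm n n)
      ((lam * (r ^ 2 + 1)) • (Matrix.fromRows (flipMatrix n) 1 *
          (Matrix.fromRows (flipMatrix n) (1 : Matrix (Coord n) (Coord n) ℝ))ᵀ) +
        (lam / r ^ 2) • (Matrix.fromRows 1 (0 : Matrix (Coord n) (Coord n) ℝ) *
          (Matrix.fromRows 1 (0 : Matrix (Coord n) (Coord n) ℝ))ᵀ))).PosSemidef := by
  -- In the variables `u = x_A - F x_B` and `z = x_B`, with `F` the momentum inversion, the
  -- `u`-block `Ω + F Ω F` of the form vanishes. What remains is the off-diagonal `Ω₁` plus `Ω` on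
  -- `z`. Since `Ω₁` squares to `-1` it admits covariance `λ 1`, and the squeezing `(r⁻¹, r)`
  -- preserves it. Adding `λ 1` on `z` for the rest gives covariance `λ / r²` for `u` and `λ (r² +
  -- 1)` for `z`.
  set Ω₁ : Matrix (Coord n ⊕ Coord n) (Coord n ⊕ Coord n) ℝ :=
    Matrix.fromBlocks 0 (-(flipMatrix n * form n)) (-(form n * flipMatrix n)) 0 with hΩ₁
  have hsq : Ω₁ * Ω₁ = -1 := by
    rw [hΩ₁, Matrix.fromBlocks_multiply, ← Matrix.fromBlocks_one, Matrix.fromBlocks_neg]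
    congr 1
    · simp only [Matrix.mul_zero, Matrix.neg_mul, Matrix.mul_neg, neg_neg, zero_add]
      rw [Matrix.mul_assoc, ← Matrix.mul_assoc (form n), form_mul_form]
      simp [flipMatrix_mul_self]
    · simp
    · simp
    · simp only [Matrix.mul_zero, Matrix.neg_mul, Matrix.mul_neg, neg_neg, add_zero]
      rw [Matrix.mul_assoc, ← Matrix.mul_assoc (flipMatrix n), flipMatrix_mul_self]
      simp [form_mul_form]
  have ht : Ω₁ᵀ = -Ω₁ := by
    rw [hΩ₁, Matrix.fromBlocks_transpose, Matrix.fromBlocks_neg]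
    simp [Matrix.transpose_mul, form_transpose, flipMatrix_transpose]
  have h1 := posSemidef_uncMatrix_conj (posSemidef_uncMatrix_vacuum hlam.le hsq ht)
    (Matrix.fromBlocks (r⁻¹ • (1 : Matrix (Coord n) (Coord n) ℝ)) 0 0
      (r • (1 : Matrix (Coord n) (Coord n) ℝ)))
  have h2 := posSemidef_uncMatrix_conj
    (posSemidef_uncMatrix_vacuum hlam.le (form_mul_form n) (form_transpose n))
    (Matrix.fromRows (0 : Matrix (Coord n) (Coord n) ℝ) (1 : Matrix (Coord n) (Coord n) ℝ))
  have h3 := posSemidef_uncMatrix_conj (posSemidef_uncMatrix_add h1 h2)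
    (Matrix.fromBlocks 1 (flipMatrix n) 0 (1 : Matrix (Coord n) (Coord n) ℝ))
  rw [fromRows_mul_mul_transpose, fromRows_mul_mul_transpose,
    ← Matrix.fromBlocks_one (l := Coord n) (m := Coord n), hΩ₁] at h3
  simp only [Matrix.fromBlocks_transpose, Matrix.fromBlocks_multiply, Matrix.fromBlocks_add,
    Matrix.fromBlocks_smul] at h3
  rw [fromRows_mul_transpose, fromRows_mul_transpose, jointForm]
  simp only [Matrix.fromBlocks_add, Matrix.fromBlocks_smul]
  simp only [flipMatrix_transpose, Matrix.transpose_smul, Matrix.transpose_one,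
    Matrix.transpose_zero, Matrix.mul_zero, Matrix.zero_mul, Matrix.mul_one, Matrix.one_mul,
    add_zero, zero_add, Matrix.smul_mul, Matrix.mul_smul, smul_smul, inv_mul_cancel₀ hr.ne',
    mul_inv_cancel₀ hr.ne', one_smul, Matrix.neg_mul, Matrix.mul_neg, smul_neg, smul_zero,
    Matrix.add_mul, Matrix.mul_add, flipMatrix_mul_self] at h3 ⊢
  have e1 : flipMatrix n * (form n * flipMatrix n) = -form n := by
    rw [← Matrix.mul_assoc, flipMatrix_mul_form_mul]
  rw [e1, flipMatrix_mul_form_mul] at h3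
  have e2 : lam * (r ^ 2 + 1) = r * (r * lam) + lam := by ring
  have e3 : lam / r ^ 2 = r⁻¹ * (r⁻¹ * lam) := by field_simp
  convert h3 using 3
  · abel
  · abel
  · abel
  · abel
  · rw [e2, e3]; module
  · rw [e2]; module
  · rw [e2]; module
  · rw [e2]; module

theorem integral_diagGauss_prod {d W : Type} [Fintype d] [MeasurableSpace W] (P : Measure W)
    [IsProbabilityMeasure P] (b : d → ℝ) {v : d → ℝ≥0} (hv : ∀ i, v i ≠ 0)
    (h : (d → ℝ) × W → ℝ) :
    ∫ q, h q ∂((diagGauss b v).prod P) =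
      ∫ q : (d → ℝ) × W, (∏ i, gaussianPDFReal (b i) (v i) (q.1 i)) * h q ∂(volume.prod P) := by
  have hm : Measurable (fun x : d → ℝ => ∏ i, gaussianPDFReal (b i) (v i) (x i)) :=
    Finset.measurable_prod _ fun i _ =>
      (measurable_gaussianPDFReal _ _).comp (measurable_pi_apply i)
  have h0 : ∀ x : d → ℝ, 0 ≤ ∏ i, gaussianPDFReal (b i) (v i) (x i) := fun x =>
    Finset.prod_nonneg fun i _ => gaussianPDFReal_nonneg _ _ _
  have hm2 : Measurable (fun q : (d → ℝ) × W =>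
      ENNReal.ofReal (∏ i, gaussianPDFReal (b i) (v i) (q.1 i))) :=
    hm.ennreal_ofReal.comp measurable_fst
  rw [diagGauss_eq_withDensity b hv, prod_withDensity_left hm.ennreal_ofReal,
    integral_withDensity_eq_integral_toReal_smul hm2 (ae_of_all _ fun q => ENNReal.ofReal_lt_top)]
  refine integral_congr_ae (ae_of_all _ fun q => ?_)
  simp only [smul_eq_mul]
  rw [ENNReal.toReal_ofReal (h0 _)]

/-- Gaussian distributions of growing variance, suitably normalized, approach Lebesgue measure. -/
theorem tendsto_integral_diagGauss_prod {d W : Type} [Fintype d] [MeasurableSpace W]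
    (P : Measure W) [IsProbabilityMeasure P] {h : ℝ → (d → ℝ) × W → ℝ}
    (hmeas : ∀ s, Measurable (h s)) (hcont : ∀ q, Continuous fun s => h s q) {C : ℝ}
    (hC : ∀ s q, |h s q| ≤ C) {K : Set (d → ℝ)} (hK : IsCompact K)
    (hsupp : ∀ s q, q.1 ∉ K → h s q = 0) {v : ℕ → ℝ≥0} (hv : ∀ j, v j ≠ 0)
    (hv' : Tendsto (fun j => (v j : ℝ)) atTop atTop) {s : ℕ → ℝ} (hs : Tendsto s atTop (𝓝 0)) :
    Tendsto (fun j => √(2 * Real.pi * v j) ^ Fintype.card d *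
      ∫ q, h (s j) q ∂((diagGauss 0 fun _ => v j).prod P)) atTop
      (𝓝 (∫ q, h 0 q ∂(volume.prod P))) := by
  -- The prefactor cancels the normalization of the Gaussian density; what is left lies between `0`
  -- and `1` and tends to `1`.
  have hprod : ∀ (j : ℕ) (x : d → ℝ), √(2 * Real.pi * v j) ^ Fintype.card d *
      ∏ i, gaussianPDFReal 0 (v j) (x i) = Real.exp (-(∑ i, x i ^ 2) * (2 * (v j : ℝ))⁻¹) := by
    intro j x
    have hvj : (0 : ℝ) < v j := by exact_mod_cast pos_iff_ne_zero.2 (hv j)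
    have hne : √(2 * Real.pi * v j) ≠ 0 := (Real.sqrt_pos.2 (by positivity)).ne'
    simp only [gaussianPDFReal]
    rw [Finset.prod_mul_distrib, Finset.prod_const, Finset.card_univ, ← Real.exp_sum, ← mul_assoc,
      ← mul_pow, mul_inv_cancel₀ hne, one_pow, one_mul]
    congr 1
    simp only [sub_zero, ← Finset.sum_div, Finset.sum_neg_distrib]
    rw [div_eq_mul_inv]
  have heq : ∀ j, √(2 * Real.pi * v j) ^ Fintype.card d *
      ∫ q, h (s j) q ∂((diagGauss 0 fun _ => v j).prod P) =
      ∫ q : (d → ℝ) × W, Real.exp (-(∑ i, q.1 i ^ 2) * (2 * (v j : ℝ))⁻¹) * h (s j) q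
        ∂(volume.prod P) := by
    intro j
    rw [integral_diagGauss_prod P 0 (fun _ => hv j), ← integral_const_mul]
    refine integral_congr_ae (ae_of_all _ fun q => ?_)
    simp only [Pi.zero_apply]
    rw [← mul_assoc, hprod]
  simp_rw [heq]
  have hinv : Tendsto (fun j => (2 * (v j : ℝ))⁻¹) atTop (𝓝 0) :=
    tendsto_inv_atTop_zero.comp (hv'.const_mul_atTop two_pos)
  -- The dominating function is constant on `K ×ˢ univ`, which has finite measure because `P` is a
  -- probability measure.
  refine tendsto_integral_of_dominated_convergence
    (fun q => (K ×ˢ Set.univ).indicator (fun _ => C) q) ?_ ?_ ?_ ?_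
  · intro j
    refine Measurable.aestronglyMeasurable (Measurable.mul ?_ (hmeas _))
    have : Continuous (fun x : d → ℝ => Real.exp (-(∑ i, x i ^ 2) * (2 * (v j : ℝ))⁻¹)) := by
      fun_prop
    exact this.measurable.comp measurable_fst
  · refine (integrable_indicator_iff (hK.measurableSet.prod MeasurableSet.univ)).2 ?_
    refine integrableOn_const ?_ (by simp)
    rw [Measure.prod_prod]
    simpa using hK.measure_lt_top.ne
  · intro j
    refine ae_of_all _ fun q => ?_
    by_cases hq : q.1 ∈ K
    · rw [Set.indicator_of_mem (by simpa using hq), norm_mul, Real.norm_eq_abs, Real.norm_eq_abs,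
        Real.abs_exp]
      refine (mul_le_of_le_one_left (abs_nonneg _) (Real.exp_le_one_iff.2 ?_)).trans (hC _ _)
      have h1 : 0 ≤ ∑ i, q.1 i ^ 2 := Finset.sum_nonneg fun i _ => sq_nonneg _
      have h2 : (0 : ℝ) ≤ (2 * (v j : ℝ))⁻¹ := by positivity
      nlinarith [mul_nonneg h1 h2]
    · rw [hsupp _ _ hq, mul_zero, norm_zero]
      exact Set.indicator_nonneg (fun _ _ => (abs_nonneg _).trans (hC 0 q)) _
  · refine ae_of_all _ fun q => ?_
    have h1 : Tendsto (fun j => Real.exp (-(∑ i, q.1 i ^ 2) * (2 * (v j : ℝ))⁻¹)) atTop (𝓝 1) := by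
      have := (hinv.const_mul (-(∑ i, q.1 i ^ 2)))
      rw [mul_zero] at this
      have h2 := (Real.continuous_exp.tendsto 0).comp this
      rwa [Real.exp_zero] at h2
    simpa using h1.mul (((hcont q).tendsto 0).comp hs)

theorem std_eq_gauss {e : Type} [Fintype e] [DecidableEq e] :
    std e = gauss (1 : Matrix e e ℝ) 0 := by
  simp [gauss]

theorem diagGauss_eq_gauss {d : Type} [Fintype d] [DecidableEq d] (b : d → ℝ) (v : d → ℝ≥0) :
    diagGauss b v = gauss (Matrix.diagonal fun i => √(v i : ℝ)) b := by
  have := rotGauss_eq_gauss 1 b v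
  simpa [rotGauss] using this

theorem continuous_momentumFlip : Continuous (momentumFlip : Phase n → Phase n) := by
  have : (momentumFlip : Phase n → Phase n) = fun z => flipMatrix n *ᵥ z := by
    ext z : 1; rw [flipMatrix_mulVec]
  rw [this]; fun_prop

theorem continuous_sumElim {α a b : Type} [TopologicalSpace α] {f : α → a → ℝ} {g : α → b → ℝ}
    (hf : Continuous f) (hg : Continuous g) :
    Continuous (fun x => (Sum.elim (f x) (g x) : a ⊕ b → ℝ)) := by
  refine continuous_pi fun i => ?_
  rcases i with i | i
  · exact (continuous_apply i).comp hf
  · exact (continuous_apply i).comp hg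

/-- The distribution of `(F z + s w, z)` for independent centred Gaussian vectors `z`, of
variance `v`, and `w`, of variance `1`, where `F` is the momentum inversion. -/
def correlatedGauss (n : ℕ) (v : ℝ≥0) (s : ℝ) : Measure (Phase n × Phase n) :=
  ((diagGauss 0 fun _ => v).prod (std (Coord n))).map
    (fun p => (momentumFlip p.1 + s • p.2, p.1))

theorem measurable_flip_add_smul (s : ℝ) : Measurable
    (fun p : Phase n × Phase n => (momentumFlip p.1 + s • p.2, p.1)) := by
  have h := continuous_momentumFlip (n := n)
  have : Continuous (fun p : Phase n × Phase n => (momentumFlip p.1 + s • p.2, p.1)) := by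
    fun_prop
  exact this.measurable

instance (v : ℝ≥0) (s : ℝ) : IsProbabilityMeasure (correlatedGauss n v s) :=
  Measure.isProbabilityMeasure_map (measurable_flip_add_smul s).aemeasurable

/-- The variances `v` and `s²` are half of the covariances `λ (r² + 1)` and `λ / r²` of
`posSemidef_uncMatrix_correlated`, again by the factor `2` in `covMatrix`. -/
theorem isValidState_joint_correlatedGauss {lam : ℝ} (hlam : 0 < lam) {r s : ℝ} {v : ℝ≥0}
    (hr : 0 < r) (hv : (v : ℝ) = lam / 2 * (r ^ 2 + 1)) (hs : s * s = lam / 2 / r ^ 2) :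
    IsValidState lam (jointForm n n) (joint (correlatedGauss n v s)) := by
  have hΩ := eq_zero_of_mulVec_eq_zero_of_sq (jointForm_mul_jointForm n n)
  have hmap := gauss_prod_map (Matrix.diagonal fun _ : Coord n => √(v : ℝ)) 0
    (1 : Matrix (Coord n) (Coord n) ℝ) 0
    (Matrix.fromRows (flipMatrix n) (1 : Matrix (Coord n) (Coord n) ℝ))
    (s • Matrix.fromRows 1 (0 : Matrix (Coord n) (Coord n) ℝ)) 0
  have heq : joint (correlatedGauss n v s) =
      ((gauss (Matrix.diagonal fun _ : Coord n => √(v : ℝ)) 0).prod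
        (gauss (1 : Matrix (Coord n) (Coord n) ℝ) 0)).map (fun p =>
        Matrix.fromRows (flipMatrix n) (1 : Matrix (Coord n) (Coord n) ℝ) *ᵥ p.1 +
        (s • Matrix.fromRows 1 (0 : Matrix (Coord n) (Coord n) ℝ)) *ᵥ p.2 + 0) := by
    rw [joint, correlatedGauss, Measure.map_map measurable_sumElim (measurable_flip_add_smul s),
      diagGauss_eq_gauss, std_eq_gauss]
    congr 1
    ext p i
    rcases i with i | i <;>
      simp [Matrix.fromRows_mulVec, Matrix.smul_mulVec, flipMatrix_mulVec]
  rw [heq, hmap]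
  refine isValidState_gauss hlam hΩ _ ?_
  convert posSemidef_uncMatrix_correlated (n := n) hlam hr using 2
  have hd : (Matrix.diagonal fun _ : Coord n => √(v : ℝ)) =
      √(v : ℝ) • (1 : Matrix (Coord n) (Coord n) ℝ) := by
    rw [Matrix.smul_one_eq_diagonal]
  have h1 : √(v : ℝ) * √(v : ℝ) = lam / 2 * (r ^ 2 + 1) := by
    rw [Real.mul_self_sqrt (by positivity), hv]
  rw [Matrix.transpose_fromCols, Matrix.fromCols_mul_fromRows, hd]
  simp only [Matrix.mul_smul, Matrix.smul_mul, Matrix.mul_one, Matrix.transpose_smul, smul_smul,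
    smul_add, h1, hs]
  congr 2 <;> ring

theorem integral_transferLeft_correlatedGauss (X : Matrix (Coord n) (Coord n) ℝ)
    (N : Measure (Phase n)) [IsProbabilityMeasure N] (v : ℝ≥0) (s : ℝ)
    {f : (Coord n ⊕ Coord n → ℝ) → ℝ} (hf : Continuous f) :
    ∫ w, f w ∂(joint (transferLeft (noiseChannel X N) (correlatedGauss n v s))) =
      ∫ q, f (Sum.elim (X *ᵥ (momentumFlip q.1 + s • q.2.1) + q.2.2) q.1)
        ∂((diagGauss 0 fun _ => v).prod ((std (Coord n)).prod N)) := by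
  have hF := continuous_momentumFlip (n := n)
  have hc : Continuous (fun p : (Coord n ⊕ Coord n → ℝ) × Phase n =>
      Matrix.fromBlocks X 0 0 (1 : Matrix (Coord n) (Coord n) ℝ) *ᵥ p.1 +
        Matrix.fromRows 1 (0 : Matrix (Coord n) (Coord n) ℝ) *ᵥ p.2) := by fun_prop
  set g : Phase n × Phase n → (Coord n ⊕ Coord n → ℝ) := fun p =>
    Sum.elim (momentumFlip p.1 + s • p.2) p.1 with hg
  have hgm : Measurable g := measurable_sumElim.comp (measurable_flip_add_smul s)
  have hj : joint (correlatedGauss n v s) =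
      ((diagGauss 0 fun _ => v).prod (std (Coord n))).map g := by
    rw [joint, correlatedGauss, Measure.map_map measurable_sumElim (measurable_flip_add_smul s)]
    rfl
  have hfc : Continuous (fun p : (Coord n ⊕ Coord n → ℝ) × Phase n => f (
      Matrix.fromBlocks X 0 0 (1 : Matrix (Coord n) (Coord n) ℝ) *ᵥ p.1 +
        Matrix.fromRows 1 (0 : Matrix (Coord n) (Coord n) ℝ) *ᵥ p.2)) := hf.comp hc
  have hprod : (joint (correlatedGauss n v s)).prod N =
      (((diagGauss 0 fun _ => v).prod (std (Coord n))).prod N).map (Prod.map g id) := by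
    rw [hj, ← Measure.map_prod_map _ _ hgm measurable_id, Measure.map_id]
  have hassoc := measurePreserving_prodAssoc (diagGauss (0 : Phase n) fun _ => v)
    (std (Coord n)) N
  rw [joint_transferLeft_noiseChannel, integral_map hc.measurable.aemeasurable
    hf.measurable.aestronglyMeasurable, hprod, integral_map (hgm.prodMap measurable_id).aemeasurable
    hfc.measurable.aestronglyMeasurable, ← hassoc.integral_comp']
  refine integral_congr_ae (ae_of_all _ fun q => ?_)
  simp only [hg, Prod.map, id]
  congr 1
  ext i
  rcases i with i | i
  · simp [Matrix.fromBlocks_mulVec, Matrix.fromRows_mulVec, Function.comp_def,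
      MeasurableEquiv.prodAssoc]
    rfl
  · simp [Matrix.fromBlocks_mulVec, Matrix.fromRows_mulVec, Function.comp_def,
      MeasurableEquiv.prodAssoc]

/-- The idle variable `q.2.1` puts this integral on the same space as those of the approximations,
of which it is the integrand at `s = 0`. -/
theorem integral_choiState_noiseChannel (X : Matrix (Coord n) (Coord n) ℝ)
    (N : Measure (Phase n)) [IsProbabilityMeasure N]
    {f : (Coord n ⊕ Coord n → ℝ) → ℝ} (hf : Continuous f) :
    ∫ w, f w ∂(joint (choiState (noiseChannel X N))) =
      ∫ q : Phase n × (Phase n × Phase n), f (Sum.elim (X *ᵥ momentumFlip q.1 + q.2.2) q.1)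
        ∂(volume.prod ((std (Coord n)).prod N)) := by
  have hF := continuous_momentumFlip (n := n)
  have hc : Continuous (fun p : Phase n × Phase n => (X *ᵥ momentumFlip p.1 + p.2, p.1)) := by
    fun_prop
  have hc2 : Continuous (fun p : Phase n × Phase n =>
      f (Sum.elim (X *ᵥ momentumFlip p.1 + p.2) p.1)) :=
    hf.comp (continuous_sumElim (by fun_prop) (by fun_prop))
  have hprod : (volume : Measure (Phase n)).prod N =
      ((volume : Measure (Phase n)).prod ((std (Coord n)).prod N)).map (Prod.map id Prod.snd) := by
    rw [← Measure.map_prod_map _ _ measurable_id measurable_snd, Measure.map_id]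
    congr 1
    change N = Measure.snd _
    simp
  have hfs : Measurable (fun p : Phase n × Phase n => f (Sum.elim p.1 p.2)) :=
    hf.measurable.comp measurable_sumElim
  rw [joint, integral_map measurable_sumElim.aemeasurable hf.measurable.aestronglyMeasurable,
    choiState_noiseChannel, integral_map hc.measurable.aemeasurable
      hfs.aestronglyMeasurable, hprod,
    integral_map (measurable_id.prodMap measurable_snd).aemeasurable
      hc2.measurable.aestronglyMeasurable]
  rfl

/-- The image of the perfectly correlated state under an admissible Gaussian channel is a valid
idealized state. -/
theorem isValidIdealState_choiState_noiseChannel {lam : ℝ} (hlam : 0 < lam)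
    {X : Matrix (Coord n) (Coord n) ℝ} {N : Measure (Phase n)} (hN : IsAdmissibleNoise lam X N) :
    IsValidIdealState lam (jointForm n n) (joint (choiState (noiseChannel X N))) := by
  have hprob := hN.isProbabilityMeasure
  set r : ℕ → ℝ := fun j => j + 1 with hr
  have hr0 : ∀ j, 0 < r j := fun j => by positivity
  set v : ℕ → ℝ≥0 := fun j => Real.toNNReal (lam / 2 * (r j ^ 2 + 1)) with hv
  have hvc : ∀ j, (v j : ℝ) = lam / 2 * (r j ^ 2 + 1) := fun j =>
    Real.coe_toNNReal _ (by positivity)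
  have hvp : ∀ j, (0 : ℝ) < v j := fun j => by rw [hvc]; positivity
  have hv0 : ∀ j, v j ≠ 0 := fun j => by exact_mod_cast (hvp j).ne'
  set s : ℕ → ℝ := fun j => √(lam / 2) * (r j)⁻¹ with hs
  have hs2 : ∀ j, s j * s j = lam / 2 / r j ^ 2 := by
    intro j
    have : √(lam / 2) * √(lam / 2) = lam / 2 := Real.mul_self_sqrt (by positivity)
    calc s j * s j = (√(lam / 2) * √(lam / 2)) * ((r j)⁻¹ * (r j)⁻¹) := by rw [hs]; ring
      _ = lam / 2 / r j ^ 2 := by rw [this, div_eq_mul_inv (lam / 2), ← mul_inv, sq]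
  have hrt : Tendsto r atTop atTop := tendsto_natCast_atTop_atTop.atTop_add tendsto_const_nhds
  have hst : Tendsto s atTop (𝓝 0) := by
    have := (tendsto_inv_atTop_zero.comp hrt).const_mul (√(lam / 2))
    rwa [mul_zero] at this
  have hvt : Tendsto (fun j => (v j : ℝ)) atTop atTop := by
    simp_rw [hvc]
    refine Tendsto.const_mul_atTop (by positivity) ?_
    exact ((tendsto_pow_atTop two_ne_zero).comp hrt).atTop_add tendsto_const_nhds
  -- The approximating states are the images under the channel of valid approximations of the
  -- correlated state, so they are valid because the channel preserves validity completely.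
  refine ⟨isLocallyFiniteMeasure_joint (choiState_map_snd _), joint_ne_zero (choiState_map_snd _),
    fun j => joint (transferLeft (noiseChannel X N) (correlatedGauss n (v j) (s j))),
    fun j => √(2 * Real.pi * v j) ^ Fintype.card (Coord n), fun j => ⟨?_, ?_⟩, ?_⟩
  · exact isCVP_noiseChannel hlam hN n _
      (isValidState_joint_correlatedGauss hlam (hr0 j) (hvc j) (hs2 j))
  · have := hvp j
    positivity
  · intro f hf hfc
    have hF := continuous_momentumFlip (n := n)
    have hhc : Continuous (fun p : ℝ × (Phase n × (Phase n × Phase n)) =>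
        f (Sum.elim (X *ᵥ (momentumFlip p.2.1 + p.1 • p.2.2.1) + p.2.2.2) p.2.1)) :=
      hf.comp (continuous_sumElim (by fun_prop) (by fun_prop))
    obtain ⟨C, hC⟩ := hfc.exists_bound_of_continuous hf
    have hlim := tendsto_integral_diagGauss_prod ((std (Coord n)).prod N)
      (h := fun t q => f (Sum.elim (X *ᵥ (momentumFlip q.1 + t • q.2.1) + q.2.2) q.1))
      (fun t => (hhc.comp (by fun_prop : Continuous fun q => (t, q))).measurable)
      (fun q => hhc.comp (by fun_prop : Continuous fun t => (t, q))) (C := C) (fun t q => hC _)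
      -- The channel leaves the `B`-variable `q.1` unchanged, so the integrand vanishes unless `q.1`
      -- lies in the projection of the support of `f`, whatever the noise.
      (K := (fun w : Coord n ⊕ Coord n → ℝ => fun i => w (Sum.inr i)) '' tsupport f)
      (hfc.isCompact.image (by fun_prop))
      (fun t q hq => by
        by_contra hne
        exact hq ⟨_, subset_tsupport f hne, rfl⟩) hv0 hvt hst
    simp only [zero_smul, add_zero] at hlim
    simp_rw [integral_transferLeft_correlatedGauss X N _ _ hf,
      integral_choiState_noiseChannel X N hf]
    exact hlim

end CorrelatedApproximation

end ERL
end

noncomputable section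

namespace ERL

/-! ### Consequences of a Lebesgue marginal -/

section UniformMarginal

open Matrix

/-- A set of finite measure that is invariant under a measure-preserving map which moves every
point one unit along a coordinate is a null set. -/
theorem measure_eq_zero_of_translation_invariant {α : Type} [MeasurableSpace α] {ν : Measure α}
    {T : α → α} (hT : MeasurePreserving T ν ν) {φ : α → ℝ} (hφ : Measurable φ)
    (hφT : ∀ x, φ (T x) = φ x + 1) {S : Set α} (hS : MeasurableSet S) (hST : T ⁻¹' S = S)
    (hfin : ν S < ⊤) : ν S = 0 := by
  -- The unit slabs of `φ` cut `S` into countably many disjoint pieces, which `T` carries into each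
  -- other. They have equal measure, which must be zero if the sum is finite.
  set A : ℤ → Set α := fun k => S ∩ {x | ⌊φ x⌋ = k} with hA
  have hAm : ∀ k, MeasurableSet (A k) := fun k =>
    hS.inter (measurableSet_eq_fun (Int.measurable_floor.comp hφ) measurable_const)
  have hstep : ∀ k, ν (A (k + 1)) = ν (A k) := by
    intro k
    rw [← hT.measure_preimage (hAm (k + 1)).nullMeasurableSet]
    congr 1
    ext x
    have : T x ∈ S ↔ x ∈ S := by
      conv_rhs => rw [← hST]
      rfl
    simp [hA, hφT, this]
  have hconst : ∀ k, ν (A k) = ν (A 0) := by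
    intro k
    induction k using Int.induction_on with
    | zero => rfl
    | succ i ih => rw [hstep, ih]
    | pred i ih => rw [← ih, ← hstep]; congr 2; ring
  have hU : S = ⋃ k, A k := by
    ext x; simp [hA]
  have hsum : ν S = ∑' k : ℤ, ν (A 0) := by
    conv_lhs => rw [hU]
    rw [measure_iUnion _ hAm]
    · exact tsum_congr hconst
    · intro k l hkl
      refine Set.disjoint_left.2 fun x hx hx' => hkl ?_
      exact hx.2.symm.trans hx'.2
  by_contra hne
  have h0 : ν (A 0) ≠ 0 := by
    intro h
    rw [hsum, h, tsum_zero] at hne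
    exact hne rfl
  rw [hsum, ENNReal.tsum_const_eq_top_of_ne_zero h0] at hfin
  exact lt_irrefl _ hfin

variable {a b I J : Type} [Fintype a] [Fintype b] [Fintype I] [Fintype J]

/-- The measure with density `exp (s · t)` in the first variable, and standard Gaussian in the
second. -/
def expStd (s : I → ℝ) (J : Type) [Fintype J] : Measure ((I → ℝ) × (J → ℝ)) :=
  ((volume : Measure (I → ℝ)).prod (std J)).withDensity
    (fun q => ENNReal.ofReal (Real.exp (s ⬝ᵥ q.1)))

theorem expStd_zero : expStd (0 : I → ℝ) J = (volume : Measure (I → ℝ)).prod (std J) := by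
  simp [expStd]

theorem measurable_expDensity (s : I → ℝ) : Measurable
    (fun q : (I → ℝ) × (J → ℝ) => ENNReal.ofReal (Real.exp (s ⬝ᵥ q.1))) := by
  have : Continuous (fun q : (I → ℝ) × (J → ℝ) => Real.exp (s ⬝ᵥ q.1)) := by fun_prop
  exact this.measurable.ennreal_ofReal

theorem measurePreserving_shift (v : I → ℝ) :
    MeasurePreserving (fun q : (I → ℝ) × (J → ℝ) => (q.1 + v, q.2))
      ((volume : Measure (I → ℝ)).prod (std J)) (volume.prod (std J)) :=
  (measurePreserving_add_right volume v).prod (MeasurePreserving.id (std J))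

theorem expStd_map_shift (s v : I → ℝ) :
    (expStd s J).map (fun q => (q.1 + v, q.2)) =
      ENNReal.ofReal (Real.exp (-(s ⬝ᵥ v))) • expStd s J := by
  have hmp := measurePreserving_shift (J := J) v
  ext S hS
  rw [Measure.map_apply hmp.measurable hS, expStd, withDensity_apply _ (hmp.measurable hS),
    Measure.smul_apply, withDensity_apply _ hS, smul_eq_mul,
    ← lintegral_const_mul _ (measurable_expDensity s),
    ← hmp.setLIntegral_comp_preimage hS ((measurable_expDensity s).const_mul _)]
  refine lintegral_congr fun q => ?_
  rw [← ENNReal.ofReal_mul (Real.exp_pos _).le, ← Real.exp_add, dotProduct_add]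
  congr 2
  ring

theorem measurable_affine_pair (P : Matrix a I ℝ) (H : Matrix a J ℝ) (h : a → ℝ) :
    Measurable (fun q : (I → ℝ) × (J → ℝ) => P *ᵥ q.1 + (H *ᵥ q.2 + h)) := by
  have : Continuous (fun q : (I → ℝ) × (J → ℝ) => P *ᵥ q.1 + (H *ᵥ q.2 + h)) := by fun_prop
  exact this.measurable

/-- Translating by `s` itself multiplies the exponential measure by `exp (-(s ⬝ᵥ s))`, but only
translates its image, which is the translation-invariant Lebesgue measure. The factor must be `1`.
-/
theorem exponent_eq_zero {κ : ENNReal} {s : I → ℝ} {L : Matrix b I ℝ} {G : Matrix b J ℝ}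
    {l : b → ℝ}
    (h : κ • (expStd s J).map (fun q => L *ᵥ q.1 + (G *ᵥ q.2 + l)) = volume) : s = 0 := by
  have hψ := measurable_affine_pair L G l
  have hsh : Measurable (fun q : (I → ℝ) × (J → ℝ) => (q.1 + s, q.2)) :=
    (measurePreserving_shift (J := J) s).measurable
  have h1 : (volume : Measure (b → ℝ)).map (fun z => z + L *ᵥ s) =
      ENNReal.ofReal (Real.exp (-(s ⬝ᵥ s))) • volume := by
    conv_lhs => rw [← h]
    rw [Measure.map_smul, Measure.map_map (by fun_prop) hψ]
    have : ((fun z : b → ℝ => z + L *ᵥ s) ∘ fun q : (I → ℝ) × (J → ℝ) =>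
        L *ᵥ q.1 + (G *ᵥ q.2 + l)) =
        (fun q => L *ᵥ q.1 + (G *ᵥ q.2 + l)) ∘ (fun q => (q.1 + s, q.2)) := by
      ext q : 1
      simp only [Function.comp, Matrix.mulVec_add]
      abel
    rw [this, ← Measure.map_map hψ hsh, expStd_map_shift, Measure.map_smul, smul_comm, h]
  rw [(measurePreserving_add_right volume (L *ᵥ s)).map_eq] at h1
  have h2 := congrArg (fun μ : Measure (b → ℝ) => μ (Metric.ball 0 1)) h1
  simp only [Measure.smul_apply, smul_eq_mul] at h2
  have h3 : volume (Metric.ball (0 : b → ℝ) 1) ≠ 0 := (Metric.measure_ball_pos _ _ one_pos).ne'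
  have h4 : volume (Metric.ball (0 : b → ℝ) 1) ≠ ⊤ := measure_ball_lt_top.ne
  have h5 : ENNReal.ofReal (Real.exp (-(s ⬝ᵥ s))) = 1 := by
    have := (ENNReal.mul_left_inj h3 h4).1 ((one_mul _).trans h2)
    exact this.symm
  rw [ENNReal.ofReal_eq_one, Real.exp_eq_one_iff, neg_eq_zero] at h5
  exact dotProduct_self_eq_zero.1 h5

/-- If `L` had a kernel vector, the preimage of a ball would be invariant under translation along
it, hence of measure zero or infinity, although balls have finite positive volume. If a left inverse
`K` had one, the preimage under `K` of the unit cube would likewise have volume zero or infinity,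
whereas the hypothesis computes it to be `κ`. -/
theorem exists_inverse_of_uniform_marginal [DecidableEq I] [DecidableEq b] {κ : ENNReal}
    (hκ0 : κ ≠ 0) (hκ : κ ≠ ⊤) {L : Matrix b I ℝ} {G : Matrix b J ℝ} {l : b → ℝ}
    (h : κ • ((volume : Measure (I → ℝ)).prod (std J)).map
      (fun q => L *ᵥ q.1 + (G *ᵥ q.2 + l)) = volume) :
    ∃ K : Matrix I b ℝ, K * L = 1 ∧ L * K = 1 := by
  have hψ := measurable_affine_pair L G l
  have happ : ∀ S : Set (b → ℝ), MeasurableSet S → volume S =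
      κ * ((volume : Measure (I → ℝ)).prod (std J))
        ((fun q => L *ᵥ q.1 + (G *ᵥ q.2 + l)) ⁻¹' S) := by
    intro S hS
    rw [← h, Measure.smul_apply, Measure.map_apply hψ hS, smul_eq_mul]
  have hinj : ∀ v, L *ᵥ v = 0 → v = 0 := by
    intro v hv
    by_contra hne
    obtain ⟨i, hi⟩ := Function.ne_iff.1 hne
    simp only [Pi.zero_apply] at hi
    have hball := happ (Metric.ball 0 1) measurableSet_ball
    have h3 : volume (Metric.ball (0 : b → ℝ) 1) ≠ 0 := (Metric.measure_ball_pos _ _ one_pos).ne'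
    have h4 : volume (Metric.ball (0 : b → ℝ) 1) ≠ ⊤ := measure_ball_lt_top.ne
    have hz := measure_eq_zero_of_translation_invariant (measurePreserving_shift (J := J) v)
      (φ := fun q => q.1 i / v i)
      (((measurable_pi_apply i).comp measurable_fst).div_const _)
      (fun q => by simp [add_div, hi])
      (S := (fun q : (I → ℝ) × (J → ℝ) => L *ᵥ q.1 + (G *ᵥ q.2 + l)) ⁻¹' Metric.ball 0 1)
      (hψ measurableSet_ball) (by ext q; simp [Matrix.mulVec_add, hv]) (by
        rw [lt_top_iff_ne_top]
        intro htop
        rw [htop, ENNReal.mul_top hκ0] at hball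
        exact h4 hball)
    rw [hz, mul_zero] at hball
    exact h3 hball
  obtain ⟨K', hK'⟩ := (Matrix.toLin' L).exists_leftInverse_of_injective
    (LinearMap.ker_eq_bot'.2 (fun v hv => hinj v (by simpa using hv)))
  obtain ⟨K, rfl⟩ : ∃ K, K' = Matrix.toLin' K := ⟨LinearMap.toMatrix' K', by simp⟩
  have hKL : K * L = 1 := by
    apply Matrix.toLin'.injective
    rw [Matrix.toLin'_mul, hK', Matrix.toLin'_one]
  refine ⟨K, hKL, ?_⟩
  have hKinj : ∀ v, K *ᵥ v = 0 → v = 0 := by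
    intro v hv
    by_contra hne
    obtain ⟨i, hi⟩ := Function.ne_iff.1 hne
    simp only [Pi.zero_apply] at hi
    set Q : Set (I → ℝ) := Set.univ.pi fun _ => Set.Icc 0 1 with hQ
    have hQm : MeasurableSet Q := MeasurableSet.univ_pi fun _ => measurableSet_Icc
    have hQv : volume Q = 1 := by
      rw [hQ, volume_pi_pi]; simp
    have hSm : MeasurableSet ((fun z : b → ℝ => K *ᵥ z) ⁻¹' Q) := measurable_mulVec K hQm
    have hvol : volume ((fun z : b → ℝ => K *ᵥ z) ⁻¹' Q) = κ := by
      rw [happ _ hSm, Measure.prod_apply_symm (hψ hSm)]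
      have : ∀ y : J → ℝ, volume ((fun t : I → ℝ => (t, y)) ⁻¹'
          ((fun q : (I → ℝ) × (J → ℝ) => L *ᵥ q.1 + (G *ᵥ q.2 + l)) ⁻¹'
            ((fun z : b → ℝ => K *ᵥ z) ⁻¹' Q))) = 1 := by
        intro y
        have he : ((fun t : I → ℝ => (t, y)) ⁻¹'
          ((fun q : (I → ℝ) × (J → ℝ) => L *ᵥ q.1 + (G *ᵥ q.2 + l)) ⁻¹'
            ((fun z : b → ℝ => K *ᵥ z) ⁻¹' Q))) =
            (fun t => t + K *ᵥ (G *ᵥ y + l)) ⁻¹' Q := by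
          ext t
          simp [Matrix.mulVec_add, Matrix.mulVec_mulVec, hKL]
        rw [he, measure_preimage_add_right, hQv]
      simp [this]
    have hz := measure_eq_zero_of_translation_invariant
      (measurePreserving_add_right (volume : Measure (b → ℝ)) v)
      (φ := fun z => z i / v i) ((measurable_pi_apply i).div_const _)
      (fun q => by simp [add_div, hi]) hSm (by ext z; simp [Matrix.mulVec_add, hv])
      (by rw [hvol]; exact lt_top_iff_ne_top.2 hκ)
    exact hκ0 (hvol.symm.trans hz)
  apply Matrix.toLin'.injective
  refine LinearMap.ext fun z => ?_
  have : K *ᵥ ((L * K) *ᵥ z - z) = 0 := by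
    rw [Matrix.mulVec_sub, Matrix.mulVec_mulVec, ← Matrix.mul_assoc, hKL, Matrix.one_mul, sub_self]
  simpa [sub_eq_zero] using hKinj _ this

/-- An affine image of (Lebesgue measure) × (standard Gaussian) whose marginal on the second factor
is Lebesgue measure is a graph over that factor, up to Gaussian noise. -/
theorem eq_map_of_uniform_marginal {κ : ENNReal} {L : Matrix b I ℝ} {G : Matrix b J ℝ}
    {l : b → ℝ} {P : Matrix a I ℝ} {H : Matrix a J ℝ} {h : a → ℝ} {K : Matrix I b ℝ}
    [DecidableEq I] [DecidableEq b] (hKL : K * L = 1) (hLK : L * K = 1)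
    {m : Measure ((a → ℝ) × (b → ℝ))}
    (hm : m = κ • ((volume : Measure (I → ℝ)).prod (std J)).map
      (fun q => (P *ᵥ q.1 + (H *ᵥ q.2 + h), L *ᵥ q.1 + (G *ᵥ q.2 + l))))
    (hsnd : m.map Prod.snd = volume) :
    m = ((volume : Measure (b → ℝ)).prod (std J)).map
      (fun q => ((P * K) *ᵥ q.1 + ((H - P * K * G) *ᵥ q.2 + (h - (P * K) *ᵥ l)), q.1)) := by
  have hφ : Measurable (fun q : (b → ℝ) × (J → ℝ) =>
      ((P * K) *ᵥ q.1 + ((H - P * K * G) *ᵥ q.2 + (h - (P * K) *ᵥ l)), q.1)) :=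
    (measurable_affine_pair _ _ _).prodMk measurable_fst
  have hχ : Measurable (fun q : (I → ℝ) × (J → ℝ) => (L *ᵥ q.1 + (G *ᵥ q.2 + l), q.2)) :=
    (measurable_affine_pair L G l).prodMk measurable_snd
  -- An invertible linear image of Lebesgue measure is a Haar measure. The constant need not be
  -- computed, since comparing marginals later forces `κ * c = 1`.
  obtain ⟨c, hc⟩ : ∃ c : ENNReal, (volume : Measure (I → ℝ)).map (fun t => L *ᵥ t) =
      c • (volume : Measure (b → ℝ)) := by
    let e : (I → ℝ) ≃ₗ[ℝ] (b → ℝ) := LinearEquiv.ofLinearMap (Matrix.toLin' L) (Matrix.toLin' K)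
      (by rw [← Matrix.toLin'_mul, hLK, Matrix.toLin'_one])
      (by rw [← Matrix.toLin'_mul, hKL, Matrix.toLin'_one])
    have : ((volume : Measure (I → ℝ)).map e.toContinuousLinearEquiv).IsAddHaarMeasure :=
      e.toContinuousLinearEquiv.isAddHaarMeasure_map _
    refine ⟨_, Measure.isAddLeftInvariant_eq_smul
      ((volume : Measure (I → ℝ)).map e.toContinuousLinearEquiv) volume⟩
  -- For fixed Gaussian variable the shear is `L` followed by a translation, so it preserves the
  -- product up to the constant `c`.
  have hshear : ((volume : Measure (I → ℝ)).prod (std J)).map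
      (fun q => (L *ᵥ q.1 + (G *ᵥ q.2 + l), q.2)) =
      c • (volume : Measure (b → ℝ)).prod (std J) := by
    ext S hS
    rw [Measure.map_apply hχ hS, Measure.prod_apply_symm (hχ hS), Measure.smul_apply,
      Measure.prod_apply_symm hS, smul_eq_mul,
      ← lintegral_const_mul _ (measurable_measure_prodMk_right hS)]
    refine lintegral_congr fun y => ?_
    have hSy : MeasurableSet ((fun z : b → ℝ => (z, y)) ⁻¹' S) := measurable_prodMk_right hS
    have h1 : ((fun t : I → ℝ => (t, y)) ⁻¹'
        ((fun q : (I → ℝ) × (J → ℝ) => (L *ᵥ q.1 + (G *ᵥ q.2 + l), q.2)) ⁻¹' S)) =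
        (fun t => L *ᵥ t) ⁻¹' ((fun z => z + (G *ᵥ y + l)) ⁻¹'
          ((fun z : b → ℝ => (z, y)) ⁻¹' S)) := rfl
    rw [h1, ← Measure.map_apply (measurable_mulVec L) (measurable_add_const _ hSy), hc,
      Measure.smul_apply, measure_preimage_add_right, smul_eq_mul]
  have hcomp : (fun q : (I → ℝ) × (J → ℝ) =>
      (P *ᵥ q.1 + (H *ᵥ q.2 + h), L *ᵥ q.1 + (G *ᵥ q.2 + l))) =
      (fun q : (b → ℝ) × (J → ℝ) =>
        ((P * K) *ᵥ q.1 + ((H - P * K * G) *ᵥ q.2 + (h - (P * K) *ᵥ l)), q.1)) ∘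
      (fun q : (I → ℝ) × (J → ℝ) => (L *ᵥ q.1 + (G *ᵥ q.2 + l), q.2)) := by
    ext q : 1
    simp only [Function.comp, Prod.mk.injEq, and_true, Matrix.mulVec_add, Matrix.sub_mulVec,
      Matrix.mulVec_mulVec]
    rw [Matrix.mul_assoc P K L, hKL, Matrix.mul_one]
    abel
  have hm2 : m = (κ * c) • ((volume : Measure (b → ℝ)).prod (std J)).map
      (fun q => ((P * K) *ᵥ q.1 + ((H - P * K * G) *ᵥ q.2 + (h - (P * K) *ᵥ l)), q.1)) := by
    rw [hm, hcomp, ← Measure.map_map hφ hχ, hshear, Measure.map_smul, smul_smul]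
  have hone : κ * c = 1 := by
    rw [hm2, Measure.map_smul, Measure.map_map measurable_snd hφ] at hsnd
    have : (Prod.snd ∘ fun q : (b → ℝ) × (J → ℝ) =>
        ((P * K) *ᵥ q.1 + ((H - P * K * G) *ᵥ q.2 + (h - (P * K) *ᵥ l)), q.1)) = Prod.fst := rfl
    rw [this] at hsnd
    have hf : ((volume : Measure (b → ℝ)).prod (std J)).map Prod.fst = volume := by
      change Measure.fst _ = _
      simp
    rw [hf] at hsnd
    have h2 := congrArg (fun μ : Measure (b → ℝ) => μ (Metric.ball 0 1)) hsnd
    simp only [Measure.smul_apply, smul_eq_mul] at h2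
    have h3 : volume (Metric.ball (0 : b → ℝ) 1) ≠ 0 := (Metric.measure_ball_pos _ _ one_pos).ne'
    have h4 : volume (Metric.ball (0 : b → ℝ) 1) ≠ ⊤ := measure_ball_lt_top.ne
    exact (ENNReal.mul_left_inj h3 h4).1 (h2.trans (one_mul _).symm)
  rw [hone, one_smul] at hm2
  exact hm2

end UniformMarginal

end ERL
end

noncomputable section

namespace ERL

/-! ### Limits of Gaussians: control of the means -/

section GaussianLimits

open Matrix
open scoped NNReal

variable {d : Type} [Fintype d]

theorem exists_bump (ρ : ℝ) : ∃ f : (d → ℝ) → ℝ, Continuous f ∧ HasCompactSupport f ∧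
    (∀ x, 0 ≤ f x) ∧ (∀ x, f x ≤ 1) ∧ (∀ x, ‖x‖ ≤ ρ → f x = 1) ∧ ∀ x, ρ + 1 ≤ ‖x‖ → f x = 0 := by
  obtain ⟨f, h1, h0, hc, hI⟩ := exists_continuous_one_zero_of_isCompact
    (s := Metric.closedBall (0 : d → ℝ) ρ) (t := {x | ρ + 1 ≤ ‖x‖})
    (isCompact_closedBall _ _) (isClosed_le continuous_const continuous_norm)
    (Set.disjoint_left.2 fun x hx hx' => by
      have hx1 : ‖x‖ ≤ ρ := by simpa using hx
      have hx2 : ρ + 1 ≤ ‖x‖ := hx'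
      linarith)
  exact ⟨f, f.continuous, hc, fun x => (hI x).1, fun x => (hI x).2,
    fun x hx => h1 (by simpa using hx), fun x hx => h0 hx⟩

theorem exists_measure_closedBall_pos {W : Measure (d → ℝ)} (hW : W ≠ 0) :
    ∃ ρ : ℕ, 0 < W (Metric.closedBall 0 ρ) := by
  by_contra! h
  refine hW (Measure.measure_univ_eq_zero.1 ?_)
  rw [← Metric.iUnion_closedBall_nat (0 : d → ℝ)]
  exact measure_iUnion_null fun ρ => le_antisymm (h ρ) bot_le

theorem exists_bump_integral_pos {W : Measure (d → ℝ)} [IsLocallyFiniteMeasure W] (hW : W ≠ 0) :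
    ∃ (ρ : ℝ) (f : (d → ℝ) → ℝ), Continuous f ∧ HasCompactSupport f ∧ (∀ x, 0 ≤ f x) ∧
      (∀ x, f x ≤ 1) ∧ (∀ x, ρ + 1 ≤ ‖x‖ → f x = 0) ∧ 0 < ∫ z, f z ∂W := by
  obtain ⟨ρ, hρ⟩ := exists_measure_closedBall_pos hW
  obtain ⟨f, hf, hfc, hf0, hf1, hfρ, hfs⟩ := exists_bump (d := d) ρ
  have hpos : 0 < ∫ z, f z ∂W := by
    have hfin : W (Metric.closedBall 0 ρ) < ⊤ := (isCompact_closedBall _ _).measure_lt_top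
    refine lt_of_lt_of_le (ENNReal.toReal_pos hρ.ne' hfin.ne) ?_
    have : ∫ z, (Metric.closedBall (0 : d → ℝ) ρ).indicator 1 z ∂W =
        (W (Metric.closedBall 0 ρ)).toReal := by
      rw [integral_indicator_one measurableSet_closedBall]; rfl
    rw [← this]
    refine integral_mono ((integrable_indicator_iff measurableSet_closedBall).2
      (integrableOn_const (C := (1 : ℝ)) hfin.ne)) (hf.integrable_of_hasCompactSupport hfc)
      fun z => ?_
    by_cases hz : z ∈ Metric.closedBall (0 : d → ℝ) ρ
    · rw [Set.indicator_of_mem hz, hfρ z (by simpa using hz)]; rfl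
    · rw [Set.indicator_of_notMem hz]; exact hf0 z
  exact ⟨ρ, f, hf, hfc, hf0, hf1, hfs, hpos⟩

variable [DecidableEq d] {U : Matrix d d ℝ}

theorem abs_entry_le_one_of_orthogonal (hU : U * Uᵀ = 1) (k i : d) : |U k i| ≤ 1 := by
  have h : ∑ j, U k j * U k j = 1 := by
    have := congrFun (congrFun hU k) k
    simpa [Matrix.mul_apply] using this
  have h2 : U k i * U k i ≤ 1 := by
    rw [← h]
    exact Finset.single_le_sum (f := fun j => U k j * U k j)
      (fun j _ => mul_self_nonneg _) (Finset.mem_univ i)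
  exact abs_le_one_iff_mul_self_le_one.2 h2

theorem abs_transpose_mulVec_le (hU : U * Uᵀ = 1) (w : d → ℝ) (i : d) :
    |(Uᵀ *ᵥ w) i| ≤ Fintype.card d * ‖w‖ := by
  simp only [Matrix.mulVec, dotProduct, Matrix.transpose_apply]
  calc |∑ k, U k i * w k| ≤ ∑ k, |U k i * w k| := Finset.abs_sum_le_sum_abs _ _
    _ ≤ ∑ _k : d, ‖w‖ := by
      refine Finset.sum_le_sum fun k _ => ?_
      rw [abs_mul]
      calc |U k i| * |w k| ≤ 1 * ‖w‖ :=
            mul_le_mul (abs_entry_le_one_of_orthogonal hU k i) (norm_le_pi_norm w k)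
              (abs_nonneg _) zero_le_one
        _ = ‖w‖ := one_mul _
    _ = _ := by simp

theorem integral_rotGauss_eq (hU : U * Uᵀ = 1) (b : d → ℝ) {v : d → ℝ≥0} (hv : ∀ i, v i ≠ 0)
    (f : (d → ℝ) → ℝ) : ∫ w, f w ∂(rotGauss U b v) = ∫ w, rotDensity U b v w * f w := by
  rw [rotGauss_eq_withDensity hU b hv, integral_withDensity_eq_integral_toReal_smul
    (measurable_rotDensity U b v).ennreal_ofReal (ae_of_all _ fun _ => ENNReal.ofReal_lt_top)]
  refine integral_congr_ae (ae_of_all _ fun w => ?_)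
  simp only [smul_eq_mul]
  rw [ENNReal.toReal_ofReal (rotDensity_pos hv w).le]

/-- Where the mean of a Gaussian is far away compared to its variance, its density grows fast in
the direction of the mean. -/
theorem exp_mul_gaussianPDFReal_le {b x C R : ℝ} {v : ℝ≥0} (hv : v ≠ 0) {ε : ℝ} (hε : ε ^ 2 = 1)
    (hεb : ε * b = |b|) (hx : |x| ≤ R) (hC : 2 * R + 1 ≤ 2 * C) (hb : C * (1 + v) ≤ |b|) :
    Real.exp C * gaussianPDFReal b v x ≤ gaussianPDFReal b v (x + ε) := by
  have hv0 : (0 : ℝ) < v := by exact_mod_cast pos_iff_ne_zero.2 hv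
  simp only [gaussianPDFReal]
  rw [mul_left_comm, ← Real.exp_add]
  refine mul_le_mul_of_nonneg_left (Real.exp_le_exp.2 ?_) (by positivity)
  have hεx : ε * x ≤ R := by
    have : |ε * x| ≤ R := by
      have h1 : |ε| = 1 := by
        rcases mul_self_eq_one_iff.1 ((sq ε).symm.trans hε) with h | h <;> simp [h]
      rw [abs_mul, h1, one_mul]; exact hx
    exact (le_abs_self _).trans this
  rw [← sub_nonneg]
  -- The gain in the exponent has numerator `2|b| - 2εx - 1 - 2Cv`, at least `2C - 2R - 1` by the
  -- bound on `|b|`. The constant `C` is chosen to make this nonnegative.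
  have e : -(x + ε - b) ^ 2 / (2 * (v : ℝ)) - (C + -(x - b) ^ 2 / (2 * (v : ℝ))) =
      (2 * (ε * b) - 2 * (ε * x) - ε ^ 2 - 2 * C * v) / (2 * v) := by
    field_simp; ring
  rw [e, hεb, hε]
  refine div_nonneg ?_ (by positivity)
  linarith

/-- Translating `f` by `ε` times the `i`-th column of `U` moves only the `i`-th rotated coordinate,
one unit towards the mean, where the density is larger by a factor `exp C`. The column has sup norm
at most `1`, so `g` dominates the translate. -/
theorem exp_mul_integral_rotGauss_le (hU : U * Uᵀ = 1) {b : d → ℝ} {v : d → ℝ≥0}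
    (hv : ∀ i, v i ≠ 0) {i : d} {C ρ : ℝ} (hC : 2 * (Fintype.card d * ρ) + 1 ≤ 2 * C)
    (hb : C * (1 + v i) ≤ |b i|) {f g : (d → ℝ) → ℝ} (hf : Continuous f) (hg : Continuous g)
    (hf0 : ∀ x, 0 ≤ f x) (hf1 : ∀ x, f x ≤ 1) (hfs : ∀ x, ρ ≤ ‖x‖ → f x = 0)
    (hg0 : ∀ x, 0 ≤ g x) (hg1 : ∀ x, g x ≤ 1) (hgs : ∀ x, ‖x‖ ≤ ρ + 1 → g x = 1) :
    Real.exp C * ∫ w, f w ∂(rotGauss U b v) ≤ ∫ w, g w ∂(rotGauss U b v) := by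
  obtain ⟨ε, hε, hεb⟩ : ∃ ε : ℝ, ε ^ 2 = 1 ∧ ε * b i = |b i| := by
    rcases le_total 0 (b i) with h | h
    · exact ⟨1, by norm_num, by rw [abs_of_nonneg h, one_mul]⟩
    · exact ⟨-1, by norm_num, by rw [abs_of_nonpos h]; ring⟩
  have hε1 : |ε| = 1 := by
    rcases mul_self_eq_one_iff.1 ((sq ε).symm.trans hε) with h | h <;> simp [h]
  set u : d → ℝ := fun k => ε * U k i with hu
  have hun : ‖u‖ ≤ 1 := by
    refine (pi_norm_le_iff_of_nonneg zero_le_one).2 fun k => ?_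
    rw [hu, Real.norm_eq_abs, abs_mul, hε1, one_mul]
    exact abs_entry_le_one_of_orthogonal hU k i
  have hUu : ∀ w, Uᵀ *ᵥ (w + u) = Uᵀ *ᵥ w + Pi.single i ε := by
    intro w
    have hU' : Uᵀ * U = 1 := mul_eq_one_comm.1 hU
    have : u = U *ᵥ Pi.single i ε := by
      ext k; simp [hu, mul_comm]
    rw [Matrix.mulVec_add, this, Matrix.mulVec_mulVec, hU', Matrix.one_mulVec]
  obtain ⟨hint, -⟩ := rotDensity_integrable hU b hv
  have hbd : ∀ h : (d → ℝ) → ℝ, Continuous h → (∀ x, 0 ≤ h x) → (∀ x, h x ≤ 1) →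
      Integrable (fun w => rotDensity U b v w * h w) := fun h hc h0 h1 =>
    hint.mul_bdd (c := 1) hc.aestronglyMeasurable
      (ae_of_all _ fun x => by rw [Real.norm_eq_abs, abs_of_nonneg (h0 x)]; exact h1 x)
  have hshift : Integrable (fun w => rotDensity U b v w * f (w - u)) :=
    hbd (fun w => f (w - u)) (by fun_prop) (fun x => hf0 _) (fun x => hf1 _)
  have hshift' : Integrable (fun w => rotDensity U b v (w + u) * f w) := by
    simpa using hshift.comp_add_right u
  rw [integral_rotGauss_eq hU b hv, integral_rotGauss_eq hU b hv]
  calc Real.exp C * ∫ w, rotDensity U b v w * f w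
      = ∫ w, Real.exp C * (rotDensity U b v w * f w) := (integral_const_mul _ _).symm
    _ ≤ ∫ w, rotDensity U b v (w + u) * f w := by
      refine integral_mono ((hbd f hf hf0 hf1).const_mul _) hshift' fun w => ?_
      by_cases hw : ρ ≤ ‖w‖
      · simp [hfs w hw]
      · show Real.exp C * (rotDensity U b v w * f w) ≤ _
        rw [← mul_assoc]
        refine mul_le_mul_of_nonneg_right ?_ (hf0 w)
        simp only [rotDensity]
        rw [← Finset.mul_prod_erase _ _ (Finset.mem_univ i),
          ← Finset.mul_prod_erase _ (fun j => gaussianPDFReal (b j) (v j) ((Uᵀ *ᵥ (w + u)) j))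
            (Finset.mem_univ i), ← mul_assoc, hUu]
        have herase : ∏ j ∈ Finset.univ.erase i, gaussianPDFReal (b j) (v j)
            ((Uᵀ *ᵥ w + (Pi.single i ε : d → ℝ)) j) =
            ∏ j ∈ Finset.univ.erase i, gaussianPDFReal (b j) (v j) ((Uᵀ *ᵥ w) j) := by
          refine Finset.prod_congr rfl fun j hj => ?_
          rw [Pi.add_apply, Pi.single_eq_of_ne (Finset.ne_of_mem_erase hj), add_zero]
        rw [herase]
        refine mul_le_mul_of_nonneg_right ?_
          (Finset.prod_nonneg fun j _ => gaussianPDFReal_nonneg _ _ _)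
        rw [Pi.add_apply, Pi.single_eq_same]
        refine exp_mul_gaussianPDFReal_le (hv i) hε hεb
          ((abs_transpose_mulVec_le hU w i).trans ?_) hC hb
        exact mul_le_mul_of_nonneg_left (not_le.1 hw).le (Nat.cast_nonneg _)
    _ = ∫ w, rotDensity U b v w * f (w - u) := by
      rw [← integral_add_right_eq_self (fun w => rotDensity U b v w * f (w - u)) u]
      simp
    _ ≤ ∫ w, rotDensity U b v w * g w := by
      refine integral_mono hshift (hbd g hg hg0 hg1) fun w => ?_
      refine mul_le_mul_of_nonneg_left ?_ (rotDensity_pos hv w).le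
      by_cases hw : ρ ≤ ‖w - u‖
      · simpa [hfs _ hw] using hg0 w
      · have : ‖w‖ ≤ ρ + 1 := by
          have := norm_add_le (w - u) u
          rw [sub_add_cancel] at this
          linarith [not_le.1 hw]
        rw [hgs w this]
        exact hf1 _

/-- If Gaussian distributions have a nonzero limit, then their means grow at most as fast as their
variances. -/
theorem exists_mean_bound {W : Measure (d → ℝ)} [IsLocallyFiniteMeasure W] (hW : W ≠ 0)
    {U : ℕ → Matrix d d ℝ} {b : ℕ → d → ℝ} {v : ℕ → d → ℝ≥0} {c : ℕ → ℝ}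
    (hU : ∀ j, U j * (U j)ᵀ = 1) (hv : ∀ j i, v j i ≠ 0) (hc : ∀ j, 0 < c j)
    (hlim : ∀ f : (d → ℝ) → ℝ, Continuous f → HasCompactSupport f →
      Tendsto (fun j => c j * ∫ z, f z ∂(rotGauss (U j) (b j) (v j))) atTop (𝓝 (∫ z, f z ∂W))) :
    ∃ C : ℝ, ∀ᶠ j in atTop, ∀ i, |b j i| ≤ C * (1 + v j i) := by
  obtain ⟨ρ, f, hf, hfc, hf0, hf1, hfs, hpos⟩ := exists_bump_integral_pos hW
  obtain ⟨g, hg, hgc, hg0, hg1, hgρ, hgs⟩ := exists_bump (d := d) (ρ + 1 + 1)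
  set F := ∫ z, f z ∂W
  set G := ∫ z, g z ∂W
  -- The first term meets the requirement of the translation estimate. The second makes `exp C * (F
  -- / 2)` at least `G + 1`, contradicting the convergence of the integrals of `f` and `g` to `F`
  -- and `G`.
  set C := max (Fintype.card d * (ρ + 1) + 1) ((G + 1) / (F / 2))
  refine ⟨C, ?_⟩
  filter_upwards [(hlim f hf hfc).eventually (lt_mem_nhds (half_lt_self hpos)),
    (hlim g hg hgc).eventually (gt_mem_nhds (lt_add_one G))] with j h1 h2 i
  by_contra! hcon
  have hCle : 2 * (Fintype.card d * (ρ + 1)) + 1 ≤ 2 * C := by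
    have : Fintype.card d * (ρ + 1) + 1 ≤ C := le_max_left _ _
    linarith
  have h3 := exp_mul_integral_rotGauss_le (hU j) (hv j) hCle hcon.le hf hg hf0 hf1 hfs hg0 hg1 hgρ
  have h4 : Real.exp C * (c j * ∫ z, f z ∂(rotGauss (U j) (b j) (v j))) < G + 1 := by
    refine lt_of_le_of_lt ?_ h2
    rw [mul_left_comm]
    exact mul_le_mul_of_nonneg_left h3 (hc j).le
  have h5 : (G + 1) / (F / 2) ≤ Real.exp C :=
    (le_max_right _ _).trans ((lt_add_one C).le.trans (Real.add_one_le_exp C))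
  rw [div_le_iff₀ (half_pos hpos)] at h5
  have h6 : Real.exp C * (F / 2) < Real.exp C * (c j * ∫ z, f z ∂(rotGauss (U j) (b j) (v j))) :=
    mul_lt_mul_of_pos_left h1 (Real.exp_pos C)
  linarith

end GaussianLimits

end ERL

end

noncomputable section

namespace ERL

/-! ### Limits of Gaussians: diverging and bounded variances -/

section GaussianLimits

open Matrix
open scoped NNReal

variable {d : Type} (I : d → Prop) [DecidablePred I]

/-- The vector with the given coordinates inside and outside `I`. -/
def mergeCoord (q : ({i // I i} → ℝ) × ({i // ¬ I i} → ℝ)) : d → ℝ :=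
  fun i => if h : I i then q.1 ⟨i, h⟩ else q.2 ⟨i, h⟩

theorem continuous_mergeCoord : Continuous (mergeCoord I) := by
  refine continuous_pi fun i => ?_
  by_cases h : I i
  · simp only [mergeCoord, h, dif_pos]; fun_prop
  · simp only [mergeCoord, h, dif_neg, not_false_eq_true]; fun_prop

variable [Fintype d]

theorem mulVec_mergeCoord (U : Matrix d d ℝ) (q : ({i // I i} → ℝ) × ({i // ¬ I i} → ℝ)) :
    U *ᵥ mergeCoord I q =
      U.submatrix id Subtype.val *ᵥ q.1 + U.submatrix id Subtype.val *ᵥ q.2 := by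
  ext k
  simp only [Matrix.mulVec, dotProduct, Pi.add_apply, Matrix.submatrix_apply, id]
  rw [← Fintype.sum_subtype_add_sum_subtype I]
  congr 1 <;> refine Finset.sum_congr rfl fun i _ => ?_
  · simp [mergeCoord, i.2]
  · simp [mergeCoord, i.2]

theorem map_mergeCoord_diagGauss (b : d → ℝ) (v : d → ℝ≥0) :
    ((diagGauss (fun i : {i // I i} => b i) (fun i => v i)).prod
      (diagGauss (fun i : {i // ¬ I i} => b i) (fun i => v i))).map (mergeCoord I) =
      diagGauss b v := by
  have h := measurePreserving_piEquivPiSubtypeProd (fun i => gaussianReal (b i) (v i)) I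
  exact (h.symm _).map_eq

/-- The image of a point under the merging of coordinates, after an affine rescaling of those
outside `I`, and the linear map `U`. -/
def affineMerge (U : Matrix d d ℝ) (b τ : {i // ¬ I i} → ℝ)
    (q : ({i // I i} → ℝ) × ({i // ¬ I i} → ℝ)) : d → ℝ :=
  U *ᵥ mergeCoord I (q.1, fun j => τ j * q.2 j + b j)

theorem continuous_affineMerge (U : Matrix d d ℝ) (b τ : {i // ¬ I i} → ℝ) :
    Continuous (affineMerge I U b τ) := by
  have := continuous_mergeCoord I
  unfold affineMerge
  exact continuous_const.matrix_mulVec (this.comp (by fun_prop))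

theorem tendsto_affineMerge {U : ℕ → Matrix d d ℝ} {b τ : ℕ → {i // ¬ I i} → ℝ}
    {U₀ : Matrix d d ℝ} {b₀ τ₀ : {i // ¬ I i} → ℝ} (hU : Tendsto U atTop (𝓝 U₀))
    (hb : Tendsto b atTop (𝓝 b₀)) (hτ : Tendsto τ atTop (𝓝 τ₀))
    (q : ({i // I i} → ℝ) × ({i // ¬ I i} → ℝ)) :
    Tendsto (fun j => affineMerge I (U j) (b j) (τ j) q) atTop
      (𝓝 (affineMerge I U₀ b₀ τ₀ q)) := by
  have hc : Continuous (fun p : Matrix d d ℝ × ({i // ¬ I i} → ℝ) × ({i // ¬ I i} → ℝ) =>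
      affineMerge I p.1 p.2.1 p.2.2 q) := by
    unfold affineMerge
    exact continuous_fst.matrix_mulVec ((continuous_mergeCoord I).comp (by fun_prop))
  exact (hc.tendsto (U₀, b₀, τ₀)).comp (hU.prodMk_nhds (hb.prodMk_nhds hτ))

/-- The first factor is absorbed into the normalization. The second has a limit even when `v`
diverges, namely `exp (s t)` if `b / v` tends to `s`. -/
theorem gaussianPDFReal_eq_mul_exp (b : ℝ) {v : ℝ≥0} (hv : v ≠ 0) (t : ℝ) :
    gaussianPDFReal b v t = ((√(2 * Real.pi * v))⁻¹ * Real.exp (-b ^ 2 / (2 * v))) *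
      Real.exp (-((v : ℝ)⁻¹ * t ^ 2 / 2) + b / v * t) := by
  have hv0 : (v : ℝ) ≠ 0 := by exact_mod_cast hv
  rw [gaussianPDFReal, mul_assoc (√_)⁻¹, ← Real.exp_add]
  congr 2
  field_simp
  ring

/-- Coordinates in `I`, meant for diverging variances, are described by their density relative to
Lebesgue measure; the others as rescaled standard Gaussians, which stay meaningful when a variance
tends to zero. It matters that `k` does not depend on `f`. -/
theorem exists_integral_rotGauss_eq (U : Matrix d d ℝ) (b : d → ℝ) {v : d → ℝ≥0}
    (hv : ∀ i, v i ≠ 0) : ∃ k : ℝ, 0 < k ∧ ∀ f : (d → ℝ) → ℝ, Continuous f →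
      ∫ z, f z ∂(rotGauss U b v) = k * ∫ q : ({i // I i} → ℝ) × ({i // ¬ I i} → ℝ),
        Real.exp (∑ i : {i // I i}, (-((v i : ℝ)⁻¹ * q.1 i ^ 2 / 2) + b i / v i * q.1 i)) *
          f (affineMerge I U (fun i => b i) (fun i => √(v i : ℝ)) q) ∂(volume.prod (std _)) := by
  refine ⟨∏ i : {i // I i}, ((√(2 * Real.pi * v i))⁻¹ * Real.exp (-(b i) ^ 2 / (2 * v i))),
    Finset.prod_pos fun i _ => ?_, fun f hf => ?_⟩
  · have hv0 : (0 : ℝ) < v i := by exact_mod_cast pos_iff_ne_zero.2 (hv i)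
    positivity
  have hmm := (continuous_mergeCoord I).measurable
  have hmap : (diagGauss (fun i : {i // I i} => b i) (fun i => v i)).prod
      (diagGauss (fun i : {i // ¬ I i} => b i) (fun i => v i)) =
      ((diagGauss (fun i : {i // I i} => b i) (fun i => v i)).prod (std {i // ¬ I i})).map
        (Prod.map id (fun y (i : {i // ¬ I i}) => √(v i : ℝ) * y i + b i)) := by
    rw [diagGauss_eq_map (fun i : {i // ¬ I i} => b i),
      ← Measure.map_prod_map _ _ measurable_id (by fun_prop), Measure.map_id]
  have hm2 : Measurable (Prod.map id (fun y (i : {i // ¬ I i}) => √(v i : ℝ) * y i + b i) :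
      ({i // I i} → ℝ) × ({i // ¬ I i} → ℝ) → _) := by fun_prop
  rw [rotGauss, ← map_mergeCoord_diagGauss I, hmap, Measure.map_map hmm hm2,
    Measure.map_map (measurable_mulVec U) (hmm.comp hm2),
    integral_map ((measurable_mulVec U).comp (hmm.comp hm2)).aemeasurable
      hf.measurable.aestronglyMeasurable,
    integral_diagGauss_prod (d := {i // I i}) _ _ (fun i => hv i), ← integral_const_mul]
  refine integral_congr_ae (ae_of_all _ fun q => ?_)
  simp only [Function.comp_apply, Prod.map, id]
  rw [Finset.prod_congr rfl fun i _ => gaussianPDFReal_eq_mul_exp _ (hv _) _,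
    Finset.prod_mul_distrib, ← Real.exp_sum, mul_assoc]
  rfl

theorem integral_map_expStd (U : Matrix d d ℝ) (b τ : {i // ¬ I i} → ℝ) (s : {i // I i} → ℝ)
    {f : (d → ℝ) → ℝ} (hf : Continuous f) :
    ∫ z, f z ∂((expStd s {i // ¬ I i}).map (affineMerge I U b τ)) =
      ∫ q : ({i // I i} → ℝ) × ({i // ¬ I i} → ℝ),
        Real.exp (s ⬝ᵥ q.1) * f (affineMerge I U b τ q) ∂(volume.prod (std _)) := by
  rw [integral_map (continuous_affineMerge I U b τ).measurable.aemeasurable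
    hf.measurable.aestronglyMeasurable, expStd, integral_withDensity_eq_integral_toReal_smul
    (measurable_expDensity s) (ae_of_all _ fun _ => ENNReal.ofReal_lt_top)]
  refine integral_congr_ae (ae_of_all _ fun q => ?_)
  simp only [smul_eq_mul]
  rw [ENNReal.toReal_ofReal (Real.exp_pos _).le]

theorem map_expStd_ne_zero (U : Matrix d d ℝ)
    (b τ : {i // ¬ I i} → ℝ) (s : {i // I i} → ℝ) :
    (expStd s {i // ¬ I i}).map (affineMerge I U b τ) ≠ 0 := by
  have hm := (continuous_affineMerge I U b τ).measurable
  rw [Ne, Measure.map_eq_zero_iff hm.aemeasurable, expStd,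
    withDensity_eq_zero_iff (measurable_expDensity s).aemeasurable]
  intro h
  have hF : ∀ᵐ _q ∂((volume : Measure ({i // I i} → ℝ)).prod (std {i // ¬ I i})), False := by
    filter_upwards [h] with q hq
    exact (ENNReal.ofReal_pos.2 (Real.exp_pos (s ⬝ᵥ q.1))).ne' hq
  have h0 : ((volume : Measure ({i // I i} → ℝ)).prod (std {i // ¬ I i}))
      (Set.univ ×ˢ Set.univ) = 0 := by
    rw [ae_iff] at hF
    simpa using hF
  rw [Measure.prod_prod, measure_univ (μ := std _), mul_one] at h0
  exact Measure.measure_univ_ne_zero.2 (NeZero.ne (volume : Measure ({i // I i} → ℝ))) h0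

variable [DecidableEq d]

/-- Orthogonality of `U` lets the `I`-coordinates be read off from the image. A bounded image
confines them to a compact set on which the exponential density is under control. -/
theorem abs_le_of_affineMerge {U : Matrix d d ℝ} (hU : U * Uᵀ = 1) (b τ : {i // ¬ I i} → ℝ)
    {q : ({i // I i} → ℝ) × ({i // ¬ I i} → ℝ)} {ρ : ℝ} (h : ‖affineMerge I U b τ q‖ ≤ ρ)
    (i : {i // I i}) : |q.1 i| ≤ Fintype.card d * ρ := by
  have hU' : Uᵀ * U = 1 := mul_eq_one_comm.1 hU
  have h1 := abs_transpose_mulVec_le hU (affineMerge I U b τ q) i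
  rw [affineMerge, Matrix.mulVec_mulVec, hU', Matrix.one_mulVec] at h1
  have h2 : mergeCoord I (q.1, fun j => τ j * q.2 j + b j) i = q.1 i := by
    simp [mergeCoord, i.2]
  rw [h2] at h1
  exact h1.trans (mul_le_mul_of_nonneg_left h (Nat.cast_nonneg _))

theorem integrable_indicator_closedBall_prod {J K : Type} [Fintype J] [Fintype K] (R B : ℝ) :
    Integrable (fun q : (J → ℝ) × (K → ℝ) =>
      (Metric.closedBall (0 : J → ℝ) R).indicator (fun _ => B) q.1) (volume.prod (std K)) := by
  have h : Integrable ((Metric.closedBall (0 : J → ℝ) R).indicator (fun _ => B)) :=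
    (integrable_indicator_iff measurableSet_closedBall).2
      (integrableOn_const (isCompact_closedBall _ _).measure_lt_top.ne)
  exact h.comp_fst (std K)

theorem tendsto_integral_affineMerge {U : ℕ → Matrix d d ℝ} {b τ : ℕ → {i // ¬ I i} → ℝ}
    {α β : ℕ → {i // I i} → ℝ} {U₀ : Matrix d d ℝ} {b₀ τ₀ : {i // ¬ I i} → ℝ} {s : {i // I i} → ℝ}
    (hUo : ∀ j, U j * (U j)ᵀ = 1) (hα0 : ∀ j i, 0 ≤ α j i) (hU : Tendsto U atTop (𝓝 U₀))
    (hb : Tendsto b atTop (𝓝 b₀)) (hτ : Tendsto τ atTop (𝓝 τ₀)) (hα : Tendsto α atTop (𝓝 0))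
    (hβ : Tendsto β atTop (𝓝 s)) {f : (d → ℝ) → ℝ} (hf : Continuous f)
    (hfc : HasCompactSupport f) :
    Tendsto (fun j => ∫ q : ({i // I i} → ℝ) × ({i // ¬ I i} → ℝ),
        Real.exp (∑ i, (-(α j i * q.1 i ^ 2 / 2) + β j i * q.1 i)) *
          f (affineMerge I (U j) (b j) (τ j) q) ∂(volume.prod (std _))) atTop
      (𝓝 (∫ q : ({i // I i} → ℝ) × ({i // ¬ I i} → ℝ),
        Real.exp (s ⬝ᵥ q.1) * f (affineMerge I U₀ b₀ τ₀ q) ∂(volume.prod (std _)))) := by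
  obtain ⟨B, hB⟩ := hfc.exists_bound_of_continuous hf
  obtain ⟨ρ, hρ⟩ := hfc.isCompact.isBounded.subset_closedBall (0 : d → ℝ)
  set R : ℝ := Fintype.card d * ρ with hR
  -- On the region where `f` does not vanish the quadratic terms only decrease the exponent, and
  -- eventually each linear coefficient is at most `|s i| + 1` in absolute value.
  set D : ℝ := Real.exp (∑ i : {i // I i}, (|s i| + 1) * R) with hD
  refine tendsto_integral_filter_of_dominated_convergence (fun q =>
    (Metric.closedBall (0 : {i // I i} → ℝ) R).indicator (fun _ => D * B) q.1) ?_ ?_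
    (integrable_indicator_closedBall_prod R _) ?_
  · refine Eventually.of_forall fun j => Continuous.aestronglyMeasurable ?_
    have := continuous_affineMerge I (U j) (b j) (τ j)
    fun_prop
  · have hev : ∀ᶠ j in atTop, ∀ i, |β j i| ≤ |s i| + 1 := by
      refine eventually_all.2 fun i => ?_
      have h1 : Tendsto (fun j => |β j i|) atTop (𝓝 |s i|) :=
        ((tendsto_pi_nhds.1 hβ) i).abs
      exact (h1.eventually (gt_mem_nhds (lt_add_one _))).mono fun j hj => hj.le
    filter_upwards [hev] with j hj
    refine ae_of_all _ fun q => ?_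
    by_cases hz : f (affineMerge I (U j) (b j) (τ j) q) = 0
    · rw [hz, mul_zero, norm_zero]
      refine Set.indicator_nonneg (fun _ _ => ?_) _
      exact mul_nonneg (Real.exp_pos _).le ((norm_nonneg _).trans (hB 0))
    · have hn : ‖affineMerge I (U j) (b j) (τ j) q‖ ≤ ρ := by
        simpa using hρ (subset_tsupport f hz)
      have hq := abs_le_of_affineMerge I (hUo j) (b j) (τ j) hn
      have hR0 : 0 ≤ R := mul_nonneg (Nat.cast_nonneg _) ((norm_nonneg _).trans hn)
      have hmem : q.1 ∈ Metric.closedBall (0 : {i // I i} → ℝ) R := by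
        rw [mem_closedBall_zero_iff]
        exact (pi_norm_le_iff_of_nonneg hR0).2 hq
      rw [Set.indicator_of_mem hmem, norm_mul, Real.norm_of_nonneg (Real.exp_pos _).le]
      refine mul_le_mul (Real.exp_le_exp.2 (Finset.sum_le_sum fun i _ => ?_)) (hB _)
        (norm_nonneg _) (Real.exp_pos _).le
      have h1 : 0 ≤ α j i * q.1 i ^ 2 / 2 :=
        div_nonneg (mul_nonneg (hα0 j i) (sq_nonneg _)) zero_le_two
      have h2 : β j i * q.1 i ≤ (|s i| + 1) * R := by
        refine (le_abs_self _).trans ?_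
        rw [abs_mul]
        exact mul_le_mul (hj i) (hq i) (abs_nonneg _) (by positivity)
      linarith
  · refine ae_of_all _ fun q => ?_
    have hlin : Tendsto (fun j => ∑ i, (-(α j i * q.1 i ^ 2 / 2) + β j i * q.1 i)) atTop
        (𝓝 (s ⬝ᵥ q.1)) := by
      refine tendsto_finsetSum _ fun i _ => ?_
      have h1 := (((tendsto_pi_nhds.1 hα) i).mul_const (q.1 i ^ 2)).div_const 2
      have h2 := ((tendsto_pi_nhds.1 hβ) i).mul_const (q.1 i)
      simpa using h1.neg.add h2
    exact ((Real.continuous_exp.tendsto _).comp hlin).mul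
      ((hf.tendsto _).comp (tendsto_affineMerge I hU hb hτ q))

theorem isLocallyFiniteMeasure_map_expStd {U : Matrix d d ℝ} (hU : U * Uᵀ = 1)
    (b τ : {i // ¬ I i} → ℝ) (s : {i // I i} → ℝ) :
    IsLocallyFiniteMeasure ((expStd s {i // ¬ I i}).map (affineMerge I U b τ)) := by
  have hm := (continuous_affineMerge I U b τ).measurable
  refine ⟨fun x => ⟨Metric.closedBall x 1, Metric.closedBall_mem_nhds x one_pos, ?_⟩⟩
  set ρ : ℝ := ‖x‖ + 1
  set R : ℝ := Fintype.card d * ρ with hR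
  have hR0 : 0 ≤ R := by positivity
  set D : ℝ := Real.exp (∑ i : {i // I i}, |s i| * R) with hD
  rw [Measure.map_apply hm measurableSet_closedBall, expStd,
    withDensity_apply _ (hm measurableSet_closedBall)]
  have hsub : affineMerge I U b τ ⁻¹' Metric.closedBall x 1 ⊆
      Metric.closedBall (0 : {i // I i} → ℝ) R ×ˢ Set.univ := by
    intro q hq
    have hn : ‖affineMerge I U b τ q‖ ≤ ρ := by
      have h1 : ‖affineMerge I U b τ q - x‖ ≤ 1 := by
        simpa [dist_eq_norm] using hq
      have h2 := norm_add_le (affineMerge I U b τ q - x) x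
      rw [sub_add_cancel] at h2
      show _ ≤ ‖x‖ + 1
      linarith
    refine ⟨?_, Set.mem_univ _⟩
    rw [mem_closedBall_zero_iff]
    exact (pi_norm_le_iff_of_nonneg hR0).2 (abs_le_of_affineMerge I hU b τ hn)
  have hms : MeasurableSet (Metric.closedBall (0 : {i // I i} → ℝ) R ×ˢ
      (Set.univ : Set ({i // ¬ I i} → ℝ))) := measurableSet_closedBall.prod MeasurableSet.univ
  calc _ ≤ ∫⁻ q in Metric.closedBall (0 : {i // I i} → ℝ) R ×ˢ
        (Set.univ : Set ({i // ¬ I i} → ℝ)), ENNReal.ofReal (Real.exp (s ⬝ᵥ q.1))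
        ∂(volume.prod (std {i // ¬ I i})) := lintegral_mono_set hsub
    _ ≤ ∫⁻ _q in Metric.closedBall (0 : {i // I i} → ℝ) R ×ˢ
        (Set.univ : Set ({i // ¬ I i} → ℝ)), ENNReal.ofReal D
        ∂(volume.prod (std {i // ¬ I i})) := by
      refine setLIntegral_mono' hms fun q hq => ?_
      refine ENNReal.ofReal_le_ofReal (Real.exp_le_exp.2 (Finset.sum_le_sum fun i _ => ?_))
      have h1 : |q.1 i| ≤ R := (norm_le_pi_norm q.1 i).trans (by simpa using hq.1)
      refine (le_abs_self _).trans ?_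
      rw [abs_mul]
      exact mul_le_mul_of_nonneg_left h1 (abs_nonneg _)
    _ < ⊤ := by
      rw [setLIntegral_const, Measure.prod_prod]
      refine ENNReal.mul_lt_top ENNReal.ofReal_lt_top (ENNReal.mul_lt_top ?_ (measure_lt_top _ _))
      exact (isCompact_closedBall _ _).measure_lt_top

end GaussianLimits

end ERL

end

noncomputable section

namespace ERL

/-! ### Limits of Gaussians: compactness and the form of the limit -/

section GaussianLimits

open Matrix
open scoped NNReal

variable {d : Type} [Fintype d] [DecidableEq d]

/-- Along a subsequence, the parameters of the Gaussian distributions converge, except that some of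
the variances diverge; the means grow at most as fast as the variances. -/
theorem exists_subseq_parameters {U : ℕ → Matrix d d ℝ} {b : ℕ → d → ℝ} {v : ℕ → d → ℝ≥0}
    (hU : ∀ j, U j * (U j)ᵀ = 1) {C : ℝ}
    (hC : ∀ᶠ j in atTop, ∀ i, |b j i| ≤ C * (1 + v j i)) :
    ∃ (I : d → Prop) (φ : ℕ → ℕ) (U₀ : Matrix d d ℝ) (s b₀ v₀ : d → ℝ), StrictMono φ ∧
      U₀ * U₀ᵀ = 1 ∧ Tendsto (fun j => U (φ j)) atTop (𝓝 U₀) ∧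
      (∀ i, I i → Tendsto (fun j => (v (φ j) i : ℝ)⁻¹) atTop (𝓝 0) ∧
        Tendsto (fun j => b (φ j) i / v (φ j) i) atTop (𝓝 (s i))) ∧
      ∀ i, ¬ I i → Tendsto (fun j => (v (φ j) i : ℝ)) atTop (𝓝 (v₀ i)) ∧
        Tendsto (fun j => b (φ j) i) atTop (𝓝 (b₀ i)) := by
  set K : Set ((d → d → ℝ) × (d → ℝ) × (d → ℝ)) :=
    (Set.univ.pi fun _ => Set.univ.pi fun _ => Set.Icc (-1) 1) ×ˢ
      (Set.univ.pi fun _ => Set.Icc (-C) C) ×ˢ (Set.univ.pi fun _ => Set.Icc 0 1) with hK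
  have hKc : IsCompact K :=
    (isCompact_univ_pi fun _ => isCompact_univ_pi fun _ => isCompact_Icc).prod
      ((isCompact_univ_pi fun _ => isCompact_Icc).prod (isCompact_univ_pi fun _ => isCompact_Icc))
  -- The map `v ↦ v / (1 + v)` compactifies the half-line of variances, and `b / (1 + v)` is bounded
  -- by `hC`. The diverging coordinates are those where the first limit is `1`; there `b / (1 + v)`
  -- and `b / v` have the same limit.
  set x : ℕ → (d → d → ℝ) × (d → ℝ) × (d → ℝ) := fun j =>
    (fun k i => U j k i, fun i => b j i / (1 + v j i), fun i => v j i / (1 + v j i)) with hx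
  have hmem : ∀ᶠ j in atTop, x j ∈ K := by
    filter_upwards [hC] with j hj
    refine ⟨fun k _ i _ => abs_le.1 (abs_entry_le_one_of_orthogonal (hU j) k i),
      fun i _ => abs_le.1 ?_, fun i _ => ⟨?_, ?_⟩⟩
    · have h1 : (0 : ℝ) < 1 + v j i := by positivity
      show |b j i / (1 + v j i)| ≤ C
      rw [abs_div, abs_of_pos h1, div_le_iff₀ h1]
      exact hj i
    · show (0 : ℝ) ≤ v j i / (1 + v j i)
      positivity
    · have h1 : (0 : ℝ) < 1 + v j i := by positivity
      show (v j i : ℝ) / (1 + v j i) ≤ 1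
      rw [div_le_one h1]
      linarith
  obtain ⟨⟨U₀, β, r⟩, hKm, φ, hφ, hlim⟩ := hKc.tendsto_subseq' hmem.frequently
  have hlU : Tendsto (fun j => U (φ j)) atTop (𝓝 (Matrix.of U₀)) :=
    ((continuous_fst.tendsto _).comp hlim :)
  have hlβ : ∀ i, Tendsto (fun j => b (φ j) i / (1 + v (φ j) i)) atTop (𝓝 (β i)) := fun i =>
    ((((continuous_apply i).comp (continuous_fst.comp continuous_snd)).tendsto _).comp hlim :)
  have hlr : ∀ i, Tendsto (fun j => (v (φ j) i : ℝ) / (1 + v (φ j) i)) atTop (𝓝 (r i)) := fun i =>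
    ((((continuous_apply i).comp (continuous_snd.comp continuous_snd)).tendsto _).comp hlim :)
  have hpos : ∀ j i, (1 : ℝ) + v j i ≠ 0 := fun j i => by positivity
  refine ⟨fun i => r i = 1, φ, Matrix.of U₀, β, fun i => β i / (1 - r i),
    fun i => r i / (1 - r i), hφ, ?_, hlU, fun i hi => ?_, fun i hi => ?_⟩
  · have hc : Continuous (fun M : Matrix d d ℝ => M * Mᵀ) :=
      continuous_id.matrix_mul continuous_id.matrix_transpose
    refine tendsto_nhds_unique ((hc.tendsto _).comp hlU) ?_
    simpa only [Function.comp_def, hU] using tendsto_const_nhds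
  · have hr := hlr i
    rw [show r i = 1 from hi] at hr
    have hev : ∀ᶠ j in atTop, (v (φ j) i : ℝ) ≠ 0 := by
      filter_upwards [hr.eventually_ne one_ne_zero] with j hj h0
      exact hj (by rw [h0, zero_div])
    constructor
    · have h1 : Tendsto (fun j => (1 - (v (φ j) i : ℝ) / (1 + v (φ j) i)) /
          ((v (φ j) i : ℝ) / (1 + v (φ j) i))) atTop (𝓝 ((1 - 1) / 1)) :=
        (hr.const_sub 1).div hr one_ne_zero
      rw [sub_self, zero_div] at h1
      refine h1.congr' ?_
      filter_upwards [hev] with j hj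
      have := hpos (φ j) i
      field_simp
      ring
    · have h1 := (hlβ i).div hr one_ne_zero
      rw [div_one] at h1
      refine h1.congr' ?_
      filter_upwards [hev] with j hj
      have := hpos (φ j) i
      simp only [Pi.div_apply]
      field_simp
  · have hi' : 1 - r i ≠ 0 := sub_ne_zero.2 (Ne.symm hi)
    have h1 : ∀ j, 1 - (v j i : ℝ) / (1 + v j i) = (1 + (v j i : ℝ))⁻¹ := fun j => by
      have := hpos j i
      field_simp
      ring
    constructor
    · refine ((hlr i).div ((hlr i).const_sub 1) hi').congr fun j => ?_
      rw [Pi.div_apply, h1]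
      have := hpos (φ j) i
      field_simp
    · refine ((hlβ i).div ((hlr i).const_sub 1) hi').congr fun j => ?_
      rw [Pi.div_apply, h1]
      have := hpos (φ j) i
      field_simp

/-- The nonzero limits of Gaussian distributions, up to normalization: Gaussian in some of the
coordinates, with an exponential density in the others. -/
theorem exists_limit_form {W : Measure (d → ℝ)} [IsLocallyFiniteMeasure W] (hW : W ≠ 0)
    {U : ℕ → Matrix d d ℝ} {b : ℕ → d → ℝ} {v : ℕ → d → ℝ≥0} {c : ℕ → ℝ}
    (hU : ∀ j, U j * (U j)ᵀ = 1) (hv : ∀ j i, v j i ≠ 0) (hc : ∀ j, 0 < c j)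
    (hlim : ∀ f : (d → ℝ) → ℝ, Continuous f → HasCompactSupport f →
      Tendsto (fun j => c j * ∫ z, f z ∂(rotGauss (U j) (b j) (v j))) atTop (𝓝 (∫ z, f z ∂W))) :
    ∃ (I : d → Prop) (_ : DecidablePred I) (φ : ℕ → ℕ) (U₀ : Matrix d d ℝ)
      (b₀ τ : {i // ¬ I i} → ℝ) (s : {i // I i} → ℝ) (κ : ENNReal),
      U₀ * U₀ᵀ = 1 ∧ Tendsto (fun j => U (φ j)) atTop (𝓝 U₀) ∧
      (∀ i : {i // ¬ I i}, Tendsto (fun j => (v (φ j) i : ℝ)) atTop (𝓝 (τ i ^ 2))) ∧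
      κ ≠ 0 ∧ κ ≠ ⊤ ∧ W = κ • (expStd s {i // ¬ I i}).map (affineMerge I U₀ b₀ τ) := by
  obtain ⟨C, hC⟩ := exists_mean_bound hW hU hv hc hlim
  obtain ⟨I, φ, U₀, s, b₀, v₀, hφ, hU₀, hlU, hI, hI'⟩ := exists_subseq_parameters hU hC
  classical
  have hv₀ : ∀ i, ¬ I i → 0 ≤ v₀ i := fun i hi =>
    ge_of_tendsto' (hI' i hi).1 fun j => NNReal.coe_nonneg _
  choose k hk hint using fun j => exists_integral_rotGauss_eq I (U (φ j)) (b (φ j)) (hv (φ j))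
  set b₁ : {i // ¬ I i} → ℝ := fun i => b₀ i
  set τ : {i // ¬ I i} → ℝ := fun i => √(v₀ i)
  set s₁ : {i // I i} → ℝ := fun i => s i
  set M := (expStd s₁ {i // ¬ I i}).map (affineMerge I U₀ b₁ τ) with hM
  have hMlf : IsLocallyFiniteMeasure M := isLocallyFiniteMeasure_map_expStd I hU₀ b₁ τ s₁
  have hM0 : M ≠ 0 := map_expStd_ne_zero I U₀ b₁ τ s₁
  set A : ((d → ℝ) → ℝ) → ℕ → ℝ := fun f j =>
    ∫ q : ({i // I i} → ℝ) × ({i // ¬ I i} → ℝ),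
      Real.exp (∑ i : {i // I i}, (-((v (φ j) i : ℝ)⁻¹ * q.1 i ^ 2 / 2) +
        b (φ j) i / v (φ j) i * q.1 i)) *
          f (affineMerge I (U (φ j)) (fun i => b (φ j) i) (fun i => √(v (φ j) i : ℝ)) q)
        ∂(volume.prod (std _)) with hA
  have hAlim : ∀ f : (d → ℝ) → ℝ, Continuous f → HasCompactSupport f →
      Tendsto (A f) atTop (𝓝 (∫ z, f z ∂M)) := by
    intro f hf hfc
    rw [hM, integral_map_expStd I U₀ b₁ τ s₁ hf]
    refine tendsto_integral_affineMerge I (fun j => hU (φ j))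
      (α := fun j i => (v (φ j) i : ℝ)⁻¹) (β := fun j i => b (φ j) i / v (φ j) i)
      (fun j i => by positivity) hlU (tendsto_pi_nhds.2 fun i => (hI' i i.2).2)
      (tendsto_pi_nhds.2 fun i => (hI' i i.2).1.sqrt)
      (tendsto_pi_nhds.2 fun i => (hI i i.2).1) (tendsto_pi_nhds.2 fun i => (hI i i.2).2) hf hfc
  have hWlim : ∀ f : (d → ℝ) → ℝ, Continuous f → HasCompactSupport f →
      Tendsto (fun j => c (φ j) * k j * A f j) atTop (𝓝 (∫ z, f z ∂W)) := by
    intro f hf hfc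
    refine ((hlim f hf hfc).comp hφ.tendsto_atTop).congr fun j => ?_
    rw [Function.comp_apply, hint j f hf, mul_assoc]
  obtain ⟨-, g, hg, hgc, -, -, -, hgpos⟩ := exists_bump_integral_pos hM0
  -- One test function with positive integral against `M` fixes the limit of the normalizations; the
  -- other test functions then identify `W` with `κ M`.
  set κ : ℝ := (∫ z, g z ∂W) / ∫ z, g z ∂M with hκ
  have hκlim : Tendsto (fun j => c (φ j) * k j) atTop (𝓝 κ) := by
    refine ((hWlim g hg hgc).div (hAlim g hg hgc) hgpos.ne').congr' ?_
    filter_upwards [(hAlim g hg hgc).eventually_ne hgpos.ne'] with j hj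
    rw [Pi.div_apply, mul_div_cancel_right₀ _ hj]
  have hκ0 : 0 ≤ κ := ge_of_tendsto' hκlim fun j => (mul_pos (hc _) (hk _)).le
  have hWM : W = ENNReal.ofReal κ • M := by
    have : (ENNReal.ofReal κ • M).Regular := Measure.Regular.smul ENNReal.ofReal_ne_top
    refine Measure.ext_of_integral_eq_on_compactlySupported fun f => ?_
    rw [integral_smul_measure, ENNReal.toReal_ofReal hκ0, smul_eq_mul]
    exact tendsto_nhds_unique (hWlim f f.continuous f.hasCompactSupport)
      (hκlim.mul (hAlim f f.continuous f.hasCompactSupport))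
  refine ⟨I, inferInstance, φ, U₀, b₁, τ, s₁, ENNReal.ofReal κ, hU₀, hlU, fun i => ?_, ?_,
    ENNReal.ofReal_ne_top, hWM⟩
  · show Tendsto _ _ (𝓝 (√(v₀ i) ^ 2))
    rw [Real.sq_sqrt (hv₀ i i.2)]
    exact (hI' i i.2).1
  · intro h0
    rw [h0, zero_smul] at hWM
    exact hW hWM

end GaussianLimits

end ERL

end

noncomputable section

namespace ERL

/-! ### Valid idealized states with uniform marginal are Choi states -/

section LimitStructure

open Matrix
open scoped NNReal

theorem posSemidef_of_tendsto {e : Type} [Fintype e] {M : ℕ → Matrix e e ℂ} {M₀ : Matrix e e ℂ}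
    (h : ∀ j, (M j).PosSemidef) (hM : Tendsto M atTop (𝓝 M₀)) : M₀.PosSemidef := by
  rw [Matrix.posSemidef_iff_dotProduct_mulVec]
  constructor
  · have hc : Continuous (fun N : Matrix e e ℂ => Nᴴ) := continuous_id.matrix_conjTranspose
    refine tendsto_nhds_unique ((hc.tendsto M₀).comp hM) (hM.congr fun j => ?_)
    exact (h j).isHermitian.eq.symm
  · intro x
    have hc : Continuous (fun N : Matrix e e ℂ => star x ⬝ᵥ N *ᵥ x) :=
      continuous_const.dotProduct (continuous_id.matrix_mulVec continuous_const)
    exact ge_of_tendsto' ((hc.tendsto M₀).comp hM) fun j =>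
      (Matrix.posSemidef_iff_dotProduct_mulVec.1 (h j)).2 x

theorem continuous_uncMatrix {e : Type} (lam : ℝ) :
    Continuous (fun p : Matrix e e ℝ × Matrix e e ℝ => uncMatrix lam p.1 p.2) := by
  refine continuous_matrix fun i j => ?_
  have h1 : Continuous (fun p : Matrix e e ℝ × Matrix e e ℝ => p.1 i j) :=
    continuous_fst.matrix_elem i j
  have h2 : Continuous (fun p : Matrix e e ℝ × Matrix e e ℝ => p.2 i j) :=
    continuous_snd.matrix_elem i j
  exact (Complex.continuous_ofReal.comp h2).add
    (continuous_const.mul (Complex.continuous_ofReal.comp h1))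

theorem posSemidef_uncMatrix_of_tendsto {e : Type} [Fintype e] {lam : ℝ}
    {Ω γ : ℕ → Matrix e e ℝ} {Ω₀ γ₀ : Matrix e e ℝ}
    (h : ∀ j, (uncMatrix lam (Ω j) (γ j)).PosSemidef) (hΩ : Tendsto Ω atTop (𝓝 Ω₀))
    (hγ : Tendsto γ atTop (𝓝 γ₀)) : (uncMatrix lam Ω₀ γ₀).PosSemidef :=
  posSemidef_of_tendsto h
    (((continuous_uncMatrix lam).tendsto (Ω₀, γ₀)).comp (hΩ.prodMk_nhds hγ))

/-- The uncertainty principle in the limit, for a linear map which does not see the directions in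
which the variances diverge. -/
theorem posSemidef_uncMatrix_limit {d e : Type} [Fintype d] [DecidableEq d] [Fintype e] {lam : ℝ}
    {Ω : Matrix d d ℝ} {U : ℕ → Matrix d d ℝ} {v : ℕ → d → ℝ≥0} (hU : ∀ j, U j * (U j)ᵀ = 1)
    (hpsd : ∀ j, (uncMatrix lam Ω
      ((2 : ℝ) • (U j * diagonal (fun i => (v j i : ℝ)) * (U j)ᵀ))).PosSemidef)
    {U₀ : Matrix d d ℝ} (hU₀ : U₀ * U₀ᵀ = 1) (hlU : Tendsto U atTop (𝓝 U₀))
    {I : d → Prop} [DecidablePred I] {τ : {i // ¬ I i} → ℝ}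
    (hτ : ∀ i : {i // ¬ I i}, Tendsto (fun j => (v j i : ℝ)) atTop (𝓝 (τ i ^ 2)))
    {B : Matrix e d ℝ} (hB : ∀ a i, I i → (B * U₀) a i = 0)
    {R : Matrix e {i // ¬ I i} ℝ} (hR : ∀ a i, R a i = (B * U₀) a i * τ i) :
    (uncMatrix lam (B * Ω * Bᵀ) ((2 : ℝ) • (R * Rᵀ))).PosSemidef := by
  -- The uncertainty relation is transported by `E * (U j)ᵀ` instead of `B`. Its product with `U j`
  -- is exactly `E`, so the diverging variances drop out for every `j`; with `B` they could be
  -- multiplied by entries that merely tend to zero. In the limit `E * (U j)ᵀ` tends to `B`.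
  set E := B * U₀ with hE
  have hU' : ∀ j, (U j)ᵀ * U j = 1 := fun j => mul_eq_one_comm.1 (hU j)
  have hcov : ∀ j, (E * (U j)ᵀ) * ((2 : ℝ) • (U j * diagonal (fun i => (v j i : ℝ)) * (U j)ᵀ)) *
      (E * (U j)ᵀ)ᵀ = (2 : ℝ) • (E * diagonal (fun i => (v j i : ℝ)) * Eᵀ) := by
    intro j
    rw [Matrix.transpose_mul, Matrix.transpose_transpose, Matrix.mul_smul, Matrix.smul_mul]
    congr 1
    calc _ = E * ((U j)ᵀ * U j) * diagonal (fun i => (v j i : ℝ)) * ((U j)ᵀ * U j) * Eᵀ := by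
          simp only [Matrix.mul_assoc]
      _ = _ := by rw [hU', Matrix.mul_one, Matrix.mul_one]
  have hpsd' : ∀ j, (uncMatrix lam ((E * (U j)ᵀ) * Ω * (E * (U j)ᵀ)ᵀ)
      ((2 : ℝ) • (E * diagonal (fun i => (v j i : ℝ)) * Eᵀ))).PosSemidef := fun j => by
    rw [← hcov]
    exact posSemidef_uncMatrix_conj (hpsd j) _
  have hform : Tendsto (fun j => (E * (U j)ᵀ) * Ω * (E * (U j)ᵀ)ᵀ) atTop (𝓝 (B * Ω * Bᵀ)) := by
    have hc : Continuous (fun M : Matrix d d ℝ => (E * Mᵀ) * Ω * (E * Mᵀ)ᵀ) := by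
      have h1 : Continuous (fun M : Matrix d d ℝ => E * Mᵀ) :=
        continuous_const.matrix_mul continuous_id.matrix_transpose
      exact (h1.matrix_mul continuous_const).matrix_mul h1.matrix_transpose
    have h0 : E * U₀ᵀ = B := by rw [hE, Matrix.mul_assoc, hU₀, Matrix.mul_one]
    have := (hc.tendsto U₀).comp hlU
    rwa [h0] at this
  have hdiag : Tendsto (fun j => (2 : ℝ) • (E * diagonal (fun i => (v j i : ℝ)) * Eᵀ)) atTop
      (𝓝 ((2 : ℝ) • (R * Rᵀ))) := by
    refine tendsto_pi_nhds.2 fun a => tendsto_pi_nhds.2 fun a' => ?_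
    have h1 : ∀ j, (E * diagonal (fun i => (v j i : ℝ)) * Eᵀ) a a' =
        ∑ i : {i // ¬ I i}, E a i * v j i * E a' i := by
      intro j
      rw [Matrix.mul_apply]
      simp only [Matrix.mul_diagonal, Matrix.transpose_apply]
      rw [← Fintype.sum_subtype_add_sum_subtype I,
        Finset.sum_eq_zero fun i _ => by rw [hB a i i.2]; ring, zero_add]
    have h2 : (R * Rᵀ) a a' = ∑ i : {i // ¬ I i}, E a i * τ i ^ 2 * E a' i := by
      simp only [Matrix.mul_apply, Matrix.transpose_apply, hR]
      exact Finset.sum_congr rfl fun i _ => by ring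
    simp only [Matrix.smul_apply, h1, h2, smul_eq_mul]
    exact (tendsto_finsetSum _ fun i _ => ((hτ i).const_mul _).mul_const _).const_mul 2
  exact posSemidef_uncMatrix_of_tendsto hpsd' hform hdiag

variable {n : ℕ}

/-- The limit is a graph `x_A = A x_B` plus Gaussian noise. Since the Choi state stores the flipped
input in `B`, the channel matrix is `A` times the momentum inversion. -/
theorem IsValidIdealState.exists_noiseChannel {lam : ℝ} (hlam : 0 < lam)
    {m : Measure (Phase n × Phase n)} (h : IsValidIdealState lam (jointForm n n) (joint m))
    (hsnd : m.map Prod.snd = volume) :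
    ∃ (X : Matrix (Coord n) (Coord n) ℝ) (N : Measure (Phase n)), IsAdmissibleNoise lam X N ∧
      choiState (noiseChannel X N) = m := by
  obtain ⟨hlf, hne, μ, c, hμ, hlim⟩ := h
  choose U b v hU hv hrot hpsd using fun j => (hμ j).1.exists_rotGauss hlam
    (fun x hx => eq_zero_of_mulVec_eq_zero_of_sq (jointForm_mul_jointForm n n) x hx)
  simp only [hrot] at hlim
  obtain ⟨I, _, φ, U₀, b₀, τ, s, κ, hU₀, hlU, hτ, hκ0, hκ, hW⟩ :=
    exists_limit_form hne hU hv (fun j => (hμ j).2) hlim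
  set P : Matrix (Coord n) {i // I i} ℝ := U₀.submatrix Sum.inl Subtype.val with hP
  set L : Matrix (Coord n) {i // I i} ℝ := U₀.submatrix Sum.inr Subtype.val with hL
  set P' : Matrix (Coord n) {i // ¬ I i} ℝ := U₀.submatrix Sum.inl Subtype.val with hP'
  set L' : Matrix (Coord n) {i // ¬ I i} ℝ := U₀.submatrix Sum.inr Subtype.val with hL'
  set H := P' * diagonal τ with hH
  set G := L' * diagonal τ with hG
  have hmap : m = κ • (expStd s {i // ¬ I i}).map
      (fun q => (P *ᵥ q.1 + (H *ᵥ q.2 + P' *ᵥ b₀), L *ᵥ q.1 + (G *ᵥ q.2 + L' *ᵥ b₀))) := by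
    rw [← map_joint m, hW, Measure.map_smul, Measure.map_map measurable_sumSplit
      (continuous_affineMerge I U₀ b₀ τ).measurable]
    congr 2
    have hdiag : ∀ q : ({i // I i} → ℝ) × ({i // ¬ I i} → ℝ),
        (fun j => τ j * q.2 j + b₀ j) = diagonal τ *ᵥ q.2 + b₀ := fun q => by
      ext j; simp [Matrix.mulVec_diagonal]
    ext q i
    · simp only [Function.comp_apply, affineMerge, mulVec_mergeCoord, hdiag, hH,
        ← Matrix.mulVec_mulVec, ← Matrix.mulVec_add]
      rfl
    · simp only [Function.comp_apply, affineMerge, mulVec_mergeCoord, hdiag, hG,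
        ← Matrix.mulVec_mulVec, ← Matrix.mulVec_add]
      rfl
  have hpair : Measurable (fun q : ({i // I i} → ℝ) × ({i // ¬ I i} → ℝ) =>
      (P *ᵥ q.1 + (H *ᵥ q.2 + P' *ᵥ b₀), L *ᵥ q.1 + (G *ᵥ q.2 + L' *ᵥ b₀))) :=
    (measurable_affine_pair P H _).prodMk (measurable_affine_pair L G _)
  have hmarg : κ • (expStd s {i // ¬ I i}).map (fun q => L *ᵥ q.1 + (G *ᵥ q.2 + L' *ᵥ b₀)) =
      volume := by
    rw [← hsnd, hmap, Measure.map_smul, Measure.map_map measurable_snd hpair]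
    rfl
  have hs : s = 0 := exponent_eq_zero hmarg
  rw [hs, expStd_zero] at hmap hmarg
  obtain ⟨K, hKL, hLK⟩ := exists_inverse_of_uniform_marginal hκ0 hκ hmarg
  have hm := eq_map_of_uniform_marginal hKL hLK hmap hsnd
  set A := P * K with hA
  set R := H - A * G with hR
  set c₀ := P' *ᵥ b₀ - A *ᵥ (L' *ᵥ b₀) with hc₀
  refine ⟨A * flipMatrix n, gauss R c₀, ⟨_, inferInstance, R, c₀, rfl, ?_⟩, ?_⟩
  -- `B` computes `x_A - A x_B`, the noise. It annihilates the flat directions because `P = A L`, so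
  -- the uncertainty principle passes to the limit. The momentum inversion being antisymplectic, the
  -- transported form `Ω + A Ω Aᵀ` is the one required for the channel.
  · set B : Matrix (Coord n) (Coord n ⊕ Coord n) ℝ := fromCols 1 (-A) with hB
    have hBU : B * U₀ = U₀.submatrix Sum.inl id - A * U₀.submatrix Sum.inr id := by
      have : U₀ = fromRows (U₀.submatrix Sum.inl id) (U₀.submatrix Sum.inr id) := by
        ext (i | i) j <;> rfl
      conv_lhs => rw [this, hB, fromCols_mul_fromRows, Matrix.one_mul, Matrix.neg_mul]
      rw [sub_eq_add_neg]
    have hΩ : form n - A * flipMatrix n * form n * (A * flipMatrix n)ᵀ =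
        B * jointForm n n * Bᵀ := by
      have h1 : A * flipMatrix n * form n * (A * flipMatrix n)ᵀ = -(A * form n * Aᵀ) := by
        rw [Matrix.transpose_mul, flipMatrix_transpose]
        calc _ = A * (flipMatrix n * form n * flipMatrix n) * Aᵀ := by
              simp only [Matrix.mul_assoc]
          _ = _ := by rw [flipMatrix_mul_form_mul, Matrix.mul_neg, Matrix.neg_mul]
      rw [h1, hB, jointForm, transpose_fromCols, fromCols_mul_fromBlocks, fromCols_mul_fromRows]
      simp
    rw [hΩ]
    refine posSemidef_uncMatrix_limit (fun j => hU (φ j)) (fun j => hpsd (φ j)) hU₀ hlU hτ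
      (fun a i hi => ?_) (fun a i => ?_)
    · have h1 : P - A * L = 0 := by rw [hA, Matrix.mul_assoc, hKL, Matrix.mul_one, sub_self]
      have h2 := congrFun (congrFun h1 a) ⟨i, hi⟩
      rw [hBU]
      exact h2
    · rw [hBU, hR, hH, hG, ← Matrix.mul_assoc, ← Matrix.sub_mul, Matrix.mul_diagonal]
      rfl
  · rw [choiState_noiseChannel, hm]
    have hp : (volume : Measure (Phase n)).prod (gauss R c₀) =
        ((volume : Measure (Phase n)).prod (std {i // ¬ I i})).map
          (Prod.map id fun y => R *ᵥ y + c₀) := by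
      rw [gauss, ← Measure.map_prod_map _ _ measurable_id (measurable_mulVec_add R c₀),
        Measure.map_id]
    rw [hp, Measure.map_map _ (measurable_id.prodMap (measurable_mulVec_add R c₀))]
    · congr 1
      ext q i
      · simp only [Function.comp_apply, Prod.map, id, ← Matrix.mulVec_mulVec, flipMatrix_mulVec,
          momentumFlip_momentumFlip]
      · rfl
    · exact ((measurable_mulVec_fst_add _).comp
        ((measurable_momentumFlip.comp measurable_fst).prodMk measurable_snd)).prodMk measurable_fst

end LimitStructure

end ERL

end

/-! ### The correspondence between valid transformations and valid states -/

theorem mainTheorem3 (lam : ℝ) (hlam : 0 < lam) (n : ℕ) :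
    (∀ (η : Kernel (ERL.Phase n) (ERL.Phase n)) [IsMarkovKernel η],
      ERL.IsValidTransformation lam η ↔
        ERL.IsValidIdealState lam (ERL.jointForm n n) (ERL.joint (ERL.choiState η))) ∧
    (∀ (η : Kernel (ERL.Phase n) (ERL.Phase n)) [IsMarkovKernel η],
      (ERL.choiState η).map Prod.snd = volume) ∧
    (∀ (η η' : Kernel (ERL.Phase n) (ERL.Phase n)) [IsMarkovKernel η] [IsMarkovKernel η'],
      ERL.choiState η = ERL.choiState η' ↔ ERL.SameTransfer η η') ∧
    (∀ m : Measure (ERL.Phase n × ERL.Phase n),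
      ERL.IsValidIdealState lam (ERL.jointForm n n) (ERL.joint m) →
      m.map Prod.snd = volume →
      ∃ η : Kernel (ERL.Phase n) (ERL.Phase n),
        IsMarkovKernel η ∧ ERL.IsValidTransformation lam η ∧ ERL.choiState η = m) := by
  refine ⟨fun η _ => ⟨fun h => ?_, fun h => ?_⟩, fun η _ => ERL.choiState_map_snd η,
    fun η η' _ _ => ERL.choiState_eq_iff_ae_eq.trans ERL.sameTransfer_iff_ae_eq.symm,
    fun m hm hsnd => ?_⟩
  · obtain ⟨X, N, hN, hη⟩ := h.2.exists_noiseChannel hlam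
    have := hN.isProbabilityMeasure
    rw [ERL.choiState_eq_iff_ae_eq.2 hη]
    exact ERL.isValidIdealState_choiState_noiseChannel hlam hN
  · obtain ⟨X, N, hN, hη⟩ := h.exists_noiseChannel hlam (ERL.choiState_map_snd η)
    have := hN.isProbabilityMeasure
    exact (ERL.isValidTransformation_noiseChannel hlam hN).congr
      (ERL.choiState_eq_iff_ae_eq.1 hη)
  · obtain ⟨X, N, hN, hη⟩ := hm.exists_noiseChannel hlam hsnd
    have := hN.isProbabilityMeasure
    exact ⟨ERL.noiseChannel X N, inferInstance,
      ERL.isValidTransformation_noiseChannel hlam hN, hη⟩
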